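/- Let $d\in\{1,2,3\}$, let $\Omega\subset\mathbb R^d$ be a bounded polygonal (polyhedral) domain (a bounded connected open set with $\Omega=\operatorname{int}\overline\Omega$ whose closure is a finite union of convex polytopes), let $k\ge 0$ be an integer, $1<p<\infty$, and $\sigma,\kappa,\gamma_0>0$. A mesh $\mathcal T_h$ of $\Omega$ is a finite, linearly ordered family of compact convex polytopes $T$ with nonempty, pairwise disjoint interiors and union $\overline\Omega$; put $h_T=\operatorname{diam}T$. We consider meshes that are shape regular (every $T$ contains a ball of radius $\sigma h_T$) and quasi-uniform ($h_T\le\kappa h_{T'}$ for all $T,T'\in\mathcal T_h$). The interior faces $e\in\mathcal E_h^I$ are the sets $e=\partial T^+\cap\partial T^-$ of positive $(d-1)$-dimensional measure, where $T^-$ has the smaller index; $\nu_e$ is the unit normal outward to $T^+$ (pointing towards $T^-$), $[v]=v^+-v^-$, $\{v\}=\frac12(v^++v^-)$, and $h_e=\operatorname{diam}e$ (if $d=1$, $h_e=\max(h_{T^+},h_{T^-})$). On a boundary face $e\in\mathcal E_h^B$, contained in $\partial T\cap\partial\Omega$, $[v]=\{v\}=v|_T$ and $\nu_e$ is the outward unit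 normal; $\mathcal E_h=\mathcal E_h^I\cup\mathcal E_h^B$. Let $\gamma_e\ge\gamma_0$ be constants for $e\in\mathcal E_h^I$. Let $V_h$ be the space of functions whose restriction to each $T\in\mathcal T_h$ is a polynomial of degree at most $k$. Let $W^{1,p}(\mathcal T_h)=\prod_{T}W^{1,p}(T)$, whose members are given on faces by their traces, with $$\|\nabla v\|_{L^p(\mathcal T_h)}=\Bigl(\sum_{T}\|\nabla v\|_{L^p(T)}^p\Bigr)^{1/p},\qquad |v|_{W^{1,p}(\mathcal T_h)}=\|\nabla v\|_{L^p(\mathcal T_h)}+\Bigl(\sum_{e\in\mathcal E_h^I}\int_e\gamma_e h_e^{1-p}\,|[v]|^p\,dS\Bigr)^{1/p}.$$ For $v\in W^{1,p}(\mathcal T_h)$ and $1\le i\le d$ set $\mathcal Q_i^\pm(v)=\{v\}\pm\frac12\operatorname{sgn}(\nu_e^i)[v]$ on $e\in\mathcal E_h^I$ (with $\operatorname{sgn}0=1$) and $\mathcal Q_i^\pm(v)=v$ on $e\in\mathcal E_h^B$. Define $\partial_{h,x_i}^\pm(v)\in V_h$ by $$\int_\Omega\partial_{h,x_i}^\pm(v)\,\varphi_h\,dx=\sum_{e\in\mathcal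 E_h}\int_e\mathcal Q_i^\pm(v)\,\nu_e^i\,[\varphi_h]\,dS-\sum_{T\in\mathcal T_h}\int_T v\,\partial_{x_i}\varphi_h\,dx\qquad\forall\varphi_h\in V_h,$$ and let the DG-FE numerical gradient $\nabla_hv$ have the components $\partial_{h,x_i}(v)=\frac12\bigl(\partial_{h,x_i}^+(v)+\partial_{h,x_i}^-(v)\bigr)$. Then there is a constant $C>0$, depending only on $d,\Omega,k,p,\sigma,\kappa,\gamma_0$ (in particular not on the mesh, i.e. not on $h$), such that for all such meshes and parameters $\gamma_e$ $$\|\nabla_h v\|_{L^p(\mathcal T_h)}\le C\,|v|_{W^{1,p}(\mathcal T_h)}\qquad\text{for all } v\in W^{1,p}(\mathcal T_h).$$ -/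

import Mathlib

open MeasureTheory Set Filter Topology
open scoped ContDiff RealInnerProductSpace

noncomputable section

namespace DGFE

/-- The Euclidean space `ℝ^d`. -/
abbrev E (d : ℕ) : Type := EuclideanSpace ℝ (Fin d)

/-! ### Sobolev spaces and traces -/

/-- `G` is a weak gradient of `u` on the open set `U`. -/
def HasWeakGrad {d : ℕ} (U : Set (E d)) (u : E d → ℝ) (G : E d → E d) : Prop :=
  LocallyIntegrableOn u U volume ∧ LocallyIntegrableOn G U volume ∧
    ∀ φ : E d → ℝ, ContDiff ℝ ∞ φ → HasCompactSupport φ → tsupport φ ⊆ U → ∀ w : E d,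
      ∫ x in U, u x * fderiv ℝ φ x w = - ∫ x in U, ⟪G x, w⟫ * φ x

/-- The Sobolev space `W^{1,p}(U)`. -/
def MemW1p {d : ℕ} (p : ℝ) (U : Set (E d)) (u : E d → ℝ) : Prop :=
  MemLp u (ENNReal.ofReal p) (volume.restrict U) ∧
    ∃ G : E d → E d, MemLp G (ENNReal.ofReal p) (volume.restrict U) ∧ HasWeakGrad U u G

open Classical in
/-- The weak gradient `∇u` on `U` (unique almost everywhere on `U` where it exists). -/
def weakGrad {d : ℕ} (U : Set (E d)) (u : E d → ℝ) : E d → E d :=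
  if h : ∃ G : E d → E d, HasWeakGrad U u G then h.choose else 0

/-- The surface measure of `ℝ^d`: the `(d-1)`-dimensional Hausdorff measure, normalized so that it
agrees with Lebesgue measure on hyperplanes (and is the counting measure if `d = 1`). -/
def surf (d : ℕ) : Measure (E d) := μHE[d - 1]

/-- `τ ∈ L^p(∂T)` is the trace of `u ∈ W^{1,p}(int T)`: there are functions that are smooth up to
the boundary, converge to `u` in `W^{1,p}(int T)`, and whose restrictions to `∂T` converge to `τ`
in `L^p(∂T)`. -/
def IsTrace {d : ℕ} (p : ℝ) (T : Set (E d)) (u τ : E d → ℝ) : Prop :=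
  MemLp τ (ENNReal.ofReal p) ((surf d).restrict (frontier T)) ∧
    ∃ w : ℕ → E d → ℝ, (∀ n, ContDiff ℝ ∞ (w n)) ∧
      Tendsto (fun n => eLpNorm (fun x => w n x - u x) (ENNReal.ofReal p)
        (volume.restrict (interior T))) atTop (𝓝 0) ∧
      Tendsto (fun n => eLpNorm (fun x => gradient (w n) x - weakGrad (interior T) u x)
        (ENNReal.ofReal p) (volume.restrict (interior T))) atTop (𝓝 0) ∧
      Tendsto (fun n => eLpNorm (fun x => w n x - τ x) (ENNReal.ofReal p)
        ((surf d).restrict (frontier T))) atTop (𝓝 0)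

open Classical in
/-- The trace on `∂T` of a function in `W^{1,p}(int T)` (unique almost everywhere on `∂T`). -/
def trace {d : ℕ} (p : ℝ) (T : Set (E d)) (u : E d → ℝ) : E d → ℝ :=
  if h : ∃ τ : E d → ℝ, IsTrace p T u τ then h.choose else 0

/-! ### Domains and meshes -/

/-- A (full-dimensional, compact, convex) polytope: a bounded intersection of finitely many closed
half-spaces, with nonempty interior. -/
def IsPolytope {d : ℕ} (T : Set (E d)) : Prop :=
  (∃ s : Finset (E d × ℝ), T = {x | ∀ a ∈ s, ⟪a.1, x⟫ ≤ a.2}) ∧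
    Bornology.IsBounded T ∧ (interior T).Nonempty

/-- A bounded polygonal (polyhedral) domain: a bounded connected open set without slits whose
closure is a finite union of polytopes. -/
def IsPolygonalDomain {d : ℕ} (Ω : Set (E d)) : Prop :=
  IsOpen Ω ∧ IsConnected Ω ∧ Bornology.IsBounded Ω ∧ interior (closure Ω) = Ω ∧
    ∃ F : Set (Set (E d)), F.Finite ∧ (∀ T ∈ F, IsPolytope T) ∧ ⋃₀ F = closure Ω

/-- A mesh of `Ω` into polytopes (intervals, triangles, quadrilaterals, tetrahedra, ...), numbered
by a global index. -/
structure Mesh {d : ℕ} (Ω : Set (E d)) where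
  /-- the number of elements -/
  N : ℕ
  /-- the (closed) elements -/
  T : Fin N → Set (E d)
  polytope : ∀ i, IsPolytope (T i)
  disjoint : ∀ i j, i ≠ j → Disjoint (interior (T i)) (interior (T j))
  cover : ⋃ i, T i = closure Ω

/-- The outward unit normal of a convex body `T` at `x ∈ ∂T`; if `T` is a polytope, it is unique
for almost every `x ∈ ∂T`. -/
def IsOutwardNormal {d : ℕ} (T : Set (E d)) (x ν : E d) : Prop :=
  ‖ν‖ = 1 ∧ ∀ y ∈ T, ⟪ν, y - x⟫ ≤ 0

open Classical in
/-- The outward unit normal field on the boundary of a convex body. -/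
def outwardNormal {d : ℕ} (T : Set (E d)) (x : E d) : E d :=
  if h : ∃ ν, IsOutwardNormal T x ν then h.choose else 0

/-- The sign with the convention `sgn 0 = 1`. -/
def sgn (ξ : ℝ) : ℝ := if 0 ≤ ξ then 1 else -1

/-- Evaluation of a polynomial in `d` variables at a point of `ℝ^d`. -/
def pev {d : ℕ} (P : MvPolynomial (Fin d) ℝ) (x : E d) : ℝ := MvPolynomial.eval (fun l => x l) P

namespace Mesh

variable {d : ℕ} {Ω : Set (E d)}

/-- Shape regularity with parameter `σ`: every element `T` contains a ball of radius `σ h_T`,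
where `h_T = diam T`. -/
def ShapeRegular (M : Mesh Ω) (σ : ℝ) : Prop :=
  ∀ i, ∃ c, Metric.closedBall c (σ * Metric.diam (M.T i)) ⊆ M.T i

/-- Quasi-uniformity with parameter `κ`: the diameters of any two elements differ at most by the
factor `κ`. -/
def QuasiUniform (M : Mesh Ω) (κ : ℝ) : Prop :=
  ∀ i j, Metric.diam (M.T i) ≤ κ * Metric.diam (M.T j)

/-- The interior face `e = ∂T⁺ ∩ ∂T⁻`, where `T⁻ = T e.1` and `T⁺ = T e.2`. -/
def face (M : Mesh Ω) (e : Fin M.N × Fin M.N) : Set (E d) :=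
  frontier (M.T e.2) ∩ frontier (M.T e.1)

open Classical in
/-- The interior faces `e = ∂T⁺ ∩ ∂T⁻`, given by the pairs of elements whose common boundary has
positive `(d-1)`-dimensional measure; `T⁻` is the element with the smaller index. -/
def interiorFaces (M : Mesh Ω) : Finset (Fin M.N × Fin M.N) :=
  Finset.univ.filter fun e => e.1 < e.2 ∧ 0 < surf d (M.face e)

/-- The unit normal `ν_e` of an interior face: outward for `T⁺`, so that it points towards the
element with the smaller index. -/
def normal (M : Mesh Ω) (e : Fin M.N × Fin M.N) (x : E d) : E d := outwardNormal (M.T e.2) x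

/-- The size `h_e` of an interior face: its diameter, and in dimension one, where faces are points,
the larger length of the two adjacent elements. -/
def faceSize (M : Mesh Ω) (e : Fin M.N × Fin M.N) : ℝ :=
  if d = 1 then max (Metric.diam (M.T e.1)) (Metric.diam (M.T e.2)) else Metric.diam (M.face e)

/-- The broken Sobolev space `W^{1,p}(𝒯_h) = ∏_T W^{1,p}(T)`. -/
def MemBroken (M : Mesh Ω) (p : ℝ) (v : Fin M.N → E d → ℝ) : Prop :=
  ∀ i, MemW1p p (interior (M.T i)) (v i)

/-- The jump `[a] = a⁺ - a⁻` on an interior face of a family of functions on the elements. -/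
def jump (M : Mesh Ω) (a : Fin M.N → E d → ℝ) (e : Fin M.N × Fin M.N) (x : E d) : ℝ :=
  a e.2 x - a e.1 x

/-- The average `{a} = (a⁺ + a⁻) / 2` on an interior face. -/
def average (M : Mesh Ω) (a : Fin M.N → E d → ℝ) (e : Fin M.N × Fin M.N) (x : E d) : ℝ :=
  (1 / 2) * (a e.2 x + a e.1 x)

/-- The traces of a broken Sobolev function on the boundaries of the elements. -/
def traces (M : Mesh Ω) (p : ℝ) (v : Fin M.N → E d → ℝ) : Fin M.N → E d → ℝ :=
  fun i => trace p (M.T i) (v i)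

/-- The trace operators `Q_l^±(v) = {v} ± ½ sgn(ν_e^l) [v]` on an interior face, with `s = ±1`. -/
def traceOp (M : Mesh Ω) (p s : ℝ) (l : Fin d) (v : Fin M.N → E d → ℝ)
    (e : Fin M.N × Fin M.N) (x : E d) : ℝ :=
  M.average (M.traces p v) e x + s * ((1 / 2) * sgn (M.normal e x l) * M.jump (M.traces p v) e x)

/-- The discontinuous Galerkin space `V_h` of piecewise polynomials of total degree at most `k`;
a member is given by its polynomial on each element. -/
def MemDG (M : Mesh Ω) (k : ℕ) (φ : Fin M.N → MvPolynomial (Fin d) ℝ) : Prop :=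
  ∀ i, (φ i).totalDegree ≤ k

/-- The right-hand side
`∑_e ∫_e Q_l^±(v) ν_e^l [φ] dS - ∑_T ∫_T v ∂_l φ dx`
of the definition of the numerical partial derivatives. The first sum runs over all faces; the
boundary faces, on which `Q_l^±(v) = v`, `[φ] = φ` and `ν_e` is the outward normal, are collected
elementwise, as those of `T` make up `∂T ∩ ∂Ω`. -/
def derivFunctional (M : Mesh Ω) (p s : ℝ) (l : Fin d) (v : Fin M.N → E d → ℝ)
    (φ : Fin M.N → MvPolynomial (Fin d) ℝ) : ℝ :=
  ((∑ e ∈ M.interiorFaces, ∫ x in M.face e,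
      M.traceOp p s l v e x * M.normal e x l * M.jump (fun i => pev (φ i)) e x ∂(surf d)) +
    ∑ i, ∫ x in frontier (M.T i) ∩ frontier Ω,
      trace p (M.T i) (v i) x * outwardNormal (M.T i) x l * pev (φ i) x ∂(surf d)) -
    ∑ i, ∫ x in interior (M.T i), v i x * pev (MvPolynomial.pderiv l (φ i)) x

/-- `g ∈ V_h` is the numerical partial derivative `∂_{h,x_l}^±(v)`, with `s = ±1`. -/
def IsNumDeriv (M : Mesh Ω) (p : ℝ) (k : ℕ) (s : ℝ) (l : Fin d) (v : Fin M.N → E d → ℝ)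
    (g : Fin M.N → MvPolynomial (Fin d) ℝ) : Prop :=
  M.MemDG k g ∧ ∀ φ, M.MemDG k φ →
    ∑ i, ∫ x in interior (M.T i), pev (g i) x * pev (φ i) x = M.derivFunctional p s l v φ

open Classical in
/-- The numerical partial derivative `∂_{h,x_l}^±(v) ∈ V_h`, with `s = ±1`, that is, the Riesz
representative in `V_h ⊆ L²(Ω)` of the above functional. -/
def numDeriv (M : Mesh Ω) (p : ℝ) (k : ℕ) (s : ℝ) (l : Fin d) (v : Fin M.N → E d → ℝ) :
    Fin M.N → MvPolynomial (Fin d) ℝ :=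
  if h : ∃ g, M.IsNumDeriv p k s l v g then h.choose else 0

/-- The (central) numerical gradient `∇_h v`, whose components are
`∂_{h,x_l} v = (∂_{h,x_l}^+ v + ∂_{h,x_l}^- v) / 2`, on each element. -/
def numGrad (M : Mesh Ω) (p : ℝ) (k : ℕ) (v : Fin M.N → E d → ℝ) (i : Fin M.N) (x : E d) : E d :=
  WithLp.toLp 2 fun l =>
    (1 / 2) * (pev (M.numDeriv p k 1 l v i) x + pev (M.numDeriv p k (-1) l v i) x)

/-- `‖G‖_{L^p(𝒯_h)} = (∑_T ‖G‖_{L^p(T)}^p)^{1/p}` for a piecewise defined vector field. -/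
def brokenLpNorm (M : Mesh Ω) (p : ℝ) (G : Fin M.N → E d → E d) : ℝ :=
  (∑ i, ∫ x in interior (M.T i), ‖G i x‖ ^ p) ^ (1 / p)

/-- The piecewise (weak) gradient `∇v`. -/
def piecewiseGrad (M : Mesh Ω) (v : Fin M.N → E d → ℝ) : Fin M.N → E d → E d :=
  fun i => weakGrad (interior (M.T i)) (v i)

/-- The broken Sobolev seminorm
`|v|_{W^{1,p}(𝒯_h)} = ‖∇v‖_{L^p(𝒯_h)} + (∑_{e interior} ∫_e γ_e h_e^{1-p} |[v]|^p dS)^{1/p}`. -/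
def brokenSeminorm (M : Mesh Ω) (p : ℝ) (γ : Fin M.N × Fin M.N → ℝ) (v : Fin M.N → E d → ℝ) : ℝ :=
  M.brokenLpNorm p (M.piecewiseGrad v) +
    (∑ e ∈ M.interiorFaces, ∫ x in M.face e,
      γ e * M.faceSize e ^ (1 - p) * |M.jump (M.traces p v) e x| ^ p ∂(surf d)) ^ (1 / p)

end Mesh

end DGFE

end

open scoped ContDiff RealInnerProductSpace

/-! The estimate is local. Let `g` be a numerical partial derivative of `v`, restricted to an
element `T`. Test its definition with `g` itself on `T`, extended by zero, and integrate the volume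
term by parts. On `∂T ∩ ∂Ω` the boundary terms cancel; on an interior face only `Q^±(v) - v|_T = m
[v]` with `|m| ≤ 1` is left. Hence `∫_T g² ≤ max_T |g| · A`, where `A = ∑_{e ⊆ ∂T} ∫_e |[v]| + ∫_T
|∇v|` is `localVariation` (`abs_derivFunctional_single_le`). The inverse estimate `max_T |g|² · |T|
≤ K ∫_T g²` (`exists_sq_pev_mul_volume_le`) turns this into `max_T |g| · |T| ≤ K A`.

By Hölder, `A^p ≤ 2^(p-1) (|∂T|^(p-1) ∑ ∫_e |[v]|^p + |T|^(p-1) ∫_T |∇v|^p)`. The divergence theorem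
for the field `x - c` gives `σ h_T |∂T| ≤ d |T|`, and `h_e ≤ κ h_T`; so `|∂T|^(p-1)` is at most a
constant times `|T|^(p-1) h_e^(1-p)`, and the powers of `|T|` cancel in `∫_T |g|^p ≤ |T| max_T
|g|^p`. Summing over the elements counts every interior face at most twice.

Most of the work is the foundation of the integration by parts. The divergence theorem on polytopes
with Hausdorff surface measure (`UnitRep.integral_fderiv`) comes from smooth cut-offs whose
gradients concentrate on the facets. It yields a trace inequality, which together with the density
of smooth functions gives traces (`UnitRep.exists_isTrace`) and integration by parts in `W^{1,p}`
(`UnitRep.integral_mul_fderiv`). Finally, almost every point of `∂T` either lies on `∂Ω` and on no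
other element boundary, or lies off `∂Ω` and on exactly one other element boundary, with opposite
normal (`Mesh.ae_boundary`). -/

namespace DGFE

variable {d : ℕ}

/-! ### Polytopes -/

/-- The polyhedron cut out by the constraints `⟪a.1, x⟫ ≤ a.2`. -/
def polyhedron (s : Finset (E d × ℝ)) : Set (E d) := {x | ∀ a ∈ s, ⟪a.1, x⟫ ≤ a.2}

/-- The hyperplane `⟪a.1, x⟫ = a.2`. -/
def hyperplane (a : E d × ℝ) : Set (E d) := {x | ⟪a.1, x⟫ = a.2}

/-- The points at which `a` is the only active constraint. -/
def facetCore (s : Finset (E d × ℝ)) (a : E d × ℝ) : Set (E d) :=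
  {x | ⟪a.1, x⟫ = a.2 ∧ ∀ c ∈ s, c ≠ a → ⟪c.1, x⟫ < c.2}

/-- `s` describes the polytope `T` by half-spaces with unit normals. -/
structure UnitRep (T : Set (E d)) (s : Finset (E d × ℝ)) : Prop where
  norm : ∀ a ∈ s, ‖a.1‖ = 1
  eq : T = polyhedron s
  bounded : Bornology.IsBounded T
  nonempty : (interior T).Nonempty

theorem IsPolytope.exists_unitRep {T : Set (E d)} (hT : IsPolytope T) :
    ∃ s : Finset (E d × ℝ), UnitRep T s := by
  classical
  obtain ⟨⟨s, hs⟩, hb, hne⟩ := hT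
  refine ⟨(s.filter fun a => a.1 ≠ 0).image fun a => (‖a.1‖⁻¹ • a.1, ‖a.1‖⁻¹ * a.2), ?_, ?_, hb, hne⟩
  · intro a ha
    obtain ⟨c, hc, rfl⟩ := Finset.mem_image.1 ha
    have : ‖c.1‖ ≠ 0 := norm_ne_zero_iff.2 (Finset.mem_filter.1 hc).2
    simp [norm_smul, this]
  · obtain ⟨z, hz⟩ := hne
    have hz' := interior_subset hz
    rw [hs] at hz'
    rw [hs]
    ext x
    simp only [polyhedron, mem_ofPred_eq, Finset.mem_image, Finset.mem_filter]
    constructor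
    · rintro h _ ⟨c, ⟨hc, hc0⟩, rfl⟩
      have : 0 < ‖c.1‖ := norm_pos_iff.2 hc0
      simp only [real_inner_smul_left]
      exact mul_le_mul_of_nonneg_left (h c hc) (by positivity)
    · intro h a ha
      -- A constraint with zero normal reads `0 ≤ a.2`; it was dropped, but the point `z` of `T`
      -- shows that it holds.
      by_cases h0 : a.1 = 0
      · have := hz' a ha
        simpa [h0] using this
      · have h1 := h _ ⟨a, ⟨ha, h0⟩, rfl⟩
        have : 0 < ‖a.1‖ := norm_pos_iff.2 h0
        simp only [real_inner_smul_left] at h1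
        exact le_of_mul_le_mul_left h1 (by positivity)

theorem isClosed_polyhedron (s : Finset (E d × ℝ)) : IsClosed (polyhedron s) := by
  have : polyhedron s = ⋂ a ∈ s, {x | ⟪a.1, x⟫ ≤ a.2} := by ext; simp [polyhedron]
  rw [this]
  exact isClosed_biInter fun a _ => isClosed_le (by fun_prop) (by fun_prop)

theorem isClosed_hyperplane (a : E d × ℝ) : IsClosed (hyperplane a) :=
  isClosed_eq (by fun_prop) (by fun_prop)

theorem convex_polyhedron (s : Finset (E d × ℝ)) : Convex ℝ (polyhedron s) := by
  have : polyhedron s = ⋂ a ∈ s, {x | ⟪a.1, x⟫ ≤ a.2} := by ext; simp [polyhedron]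
  rw [this]
  exact convex_iInter₂ fun a _ => convex_halfSpace_le
    ((innerSL ℝ a.1).toLinearMap.isLinear) _

theorem isOpen_strict (s : Finset (E d × ℝ)) : IsOpen {x : E d | ∀ a ∈ s, ⟪a.1, x⟫ < a.2} := by
  have : {x : E d | ∀ a ∈ s, ⟪a.1, x⟫ < a.2} = ⋂ a ∈ s, {x | ⟪a.1, x⟫ < a.2} := by ext; simp
  rw [this]
  exact isOpen_biInter_finset fun a _ => isOpen_lt (by fun_prop) (by fun_prop)

theorem exists_pos_add_smul_mem {A : Set (E d)} {x : E d} (hx : x ∈ interior A) (w : E d) :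
    ∃ t : ℝ, 0 < t ∧ x + t • w ∈ A := by
  have h : Tendsto (fun t : ℝ => x + t • w) (𝓝[>] 0) (𝓝 x) := by
    have : Tendsto (fun t : ℝ => x + t • w) (𝓝 0) (𝓝 (x + (0 : ℝ) • w)) :=
      Continuous.tendsto (by fun_prop) _
    rw [zero_smul, add_zero] at this
    exact this.mono_left nhdsWithin_le_nhds
  obtain ⟨t, h1, h2⟩ := ((h.eventually (mem_interior_iff_mem_nhds.1 hx)).and
    self_mem_nhdsWithin).exists
  exact ⟨t, h2, h1⟩

/-- From a point with an active constraint, any step along its unit normal leaves the polyhedron. -/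
theorem interior_polyhedron {s : Finset (E d × ℝ)} (hs : ∀ a ∈ s, ‖a.1‖ = 1) :
    interior (polyhedron s) = {x | ∀ a ∈ s, ⟪a.1, x⟫ < a.2} := by
  refine Subset.antisymm (fun x hx a ha => ?_)
    (interior_maximal (fun x hx a ha => (hx a ha).le) (isOpen_strict s))
  obtain ⟨t, ht, h⟩ := exists_pos_add_smul_mem hx a.1
  have := h a ha
  rw [inner_add_right, real_inner_smul_right, real_inner_self_eq_norm_sq, hs a ha] at this
  linarith

namespace UnitRep

variable {T : Set (E d)} {s : Finset (E d × ℝ)}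

theorem isClosed (h : UnitRep T s) : IsClosed T := h.eq ▸ isClosed_polyhedron s

theorem convex (h : UnitRep T s) : Convex ℝ T := h.eq ▸ convex_polyhedron s

theorem isCompact (h : UnitRep T s) : IsCompact T :=
  Metric.isCompact_of_isClosed_isBounded h.isClosed h.bounded

theorem interior_eq (h : UnitRep T s) : interior T = {x | ∀ a ∈ s, ⟪a.1, x⟫ < a.2} := by
  rw [h.eq, interior_polyhedron h.norm]

theorem mem_frontier_iff (h : UnitRep T s) {x : E d} :
    x ∈ frontier T ↔ x ∈ T ∧ ∃ a ∈ s, ⟪a.1, x⟫ = a.2 := by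
  rw [h.isClosed.frontier_eq, h.interior_eq, Set.mem_sdiff]
  refine and_congr_right fun hx => ?_
  rw [h.eq] at hx
  simp only [mem_ofPred_eq, not_forall, not_lt]
  constructor
  · rintro ⟨a, ha, h'⟩; exact ⟨a, ha, le_antisymm (hx a ha) h'⟩
  · rintro ⟨a, ha, h'⟩; exact ⟨a, ha, h'.ge⟩

theorem facetCore_subset_frontier (h : UnitRep T s) {a : E d × ℝ} (ha : a ∈ s) :
    facetCore s a ⊆ frontier T := by
  intro x hx
  refine h.mem_frontier_iff.2 ⟨?_, a, ha, hx.1⟩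
  rw [h.eq]
  intro c hc
  by_cases hca : c = a
  · rw [hca]; exact hx.1.le
  · exact (hx.2 c hc hca).le

theorem measurableSet_facetCore (s : Finset (E d × ℝ)) (a : E d × ℝ) :
    MeasurableSet (facetCore s a) := by
  classical
  have : facetCore s a = hyperplane a ∩ {x | ∀ c ∈ s.erase a, ⟪c.1, x⟫ < c.2} := by
    ext x
    simp only [facetCore, hyperplane, mem_inter_iff, mem_ofPred_eq, Finset.mem_erase]
    refine and_congr_right fun _ => ⟨fun h c hc => h c hc.2 hc.1, fun h c hc hca => h c ⟨hca, hc⟩⟩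
  rw [this]
  exact (isClosed_hyperplane a).measurableSet.inter (isOpen_strict _).measurableSet

theorem disjoint_facetCore {a c : E d × ℝ} (ha : a ∈ s) (hac : a ≠ c) :
    Disjoint (facetCore s a) (facetCore s c) := by
  refine Set.disjoint_left.2 fun x hx hx' => ?_
  have := hx'.2 a ha hac
  exact this.ne hx.1

/-- Near a point with one active constraint, a polytope is a half-space. -/
theorem eventually_mem_iff (h : UnitRep T s) {a : E d × ℝ} (ha : a ∈ s) {x : E d}
    (hx : x ∈ facetCore s a) : ∀ᶠ y in 𝓝 x, (y ∈ T ↔ ⟪a.1, y - x⟫ ≤ 0) := by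
  classical
  have h1 : {x : E d | ∀ c ∈ s.erase a, ⟪c.1, x⟫ < c.2} ∈ 𝓝 x :=
    (isOpen_strict _).mem_nhds fun c hc =>
      hx.2 c (Finset.mem_of_mem_erase hc) (Finset.ne_of_mem_erase hc)
  filter_upwards [h1] with y hy
  rw [inner_sub_right, hx.1, h.eq]
  constructor
  · intro h'; linarith [h' a ha]
  · intro h' c hc
    by_cases hca : c = a
    · rw [hca]; linarith
    · exact (hy c (Finset.mem_erase.2 ⟨hca, hc⟩)).le

end UnitRep

/-- A unit vector that is nonpositive on the half-space with unit normal `ν` equals `ν`. -/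
theorem eq_of_halfSpace_le {ν ν' : E d} (h1 : ‖ν‖ = 1) (h2 : ‖ν'‖ = 1)
    (h : ∀ w, ⟪ν, w⟫ ≤ 0 → ⟪ν', w⟫ ≤ 0) : ν' = ν := by
  -- The component of `ν'` orthogonal to `ν` gives `⟪ν, ν'⟫² ≥ 1`, and `-ν` gives `⟪ν, ν'⟫ ≥ 0`;
  -- equality in Cauchy–Schwarz follows.
  have h3 := h (ν' - ⟪ν, ν'⟫ • ν) (by
    rw [inner_sub_right, real_inner_smul_right, real_inner_self_eq_norm_sq, h1]; simp)
  rw [inner_sub_right, real_inner_smul_right, real_inner_self_eq_norm_sq, h2,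
    real_inner_comm ν ν'] at h3
  have h4 := h (-ν) (by rw [inner_neg_right, real_inner_self_eq_norm_sq, h1]; norm_num)
  rw [inner_neg_right, real_inner_comm ν ν'] at h4
  have h5 : ⟪ν, ν'⟫ = 1 := by
    have := real_inner_le_norm ν ν'
    rw [h1, h2] at this
    nlinarith
  exact ((inner_eq_one_iff_of_norm_eq_one (𝕜 := ℝ) h1 h2).1 h5).symm

/-- If near `x` the set `T` is the half-space with outward normal `ν`, then `ν` is the outward
normal of the convex set `T` at `x`. -/
theorem outwardNormal_eq {T : Set (E d)} (hT : Convex ℝ T) {x ν : E d} (hν : ‖ν‖ = 1)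
    (h : ∀ᶠ y in 𝓝 x, (y ∈ T ↔ ⟪ν, y - x⟫ ≤ 0)) : outwardNormal T x = ν := by
  have hxT : x ∈ T := by simpa using h.self_of_nhds
  -- A short step reaches the neighbourhood where `T` is a half-space; `t ≤ 1` lets convexity keep
  -- the step towards a point of `T` inside `T`.
  have key : ∀ w, ∃ t : ℝ, 0 < t ∧ t ≤ 1 ∧ (x + t • w ∈ T ↔ ⟪ν, (x + t • w) - x⟫ ≤ 0) := by
    intro w
    have h0 : Tendsto (fun t : ℝ => x + t • w) (𝓝[>] 0) (𝓝 x) := by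
      have : Tendsto (fun t : ℝ => x + t • w) (𝓝 0) (𝓝 (x + (0 : ℝ) • w)) :=
        Continuous.tendsto (by fun_prop) _
      rw [zero_smul, add_zero] at this
      exact this.mono_left nhdsWithin_le_nhds
    obtain ⟨t, h1, h2⟩ := ((h0.eventually h).and (Ioc_mem_nhdsGT one_pos)).exists
    exact ⟨t, h2.1, h2.2, h1⟩
  have hex : ∃ ν, IsOutwardNormal T x ν := by
    refine ⟨ν, hν, fun y hy => ?_⟩
    obtain ⟨t, ht, ht1, h⟩ := key (y - x)
    have h1 : x + t • (y - x) ∈ T := by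
      have := hT hxT hy (sub_nonneg.2 ht1) ht.le (by ring)
      convert this using 1
      module
    have h2 := h.1 h1
    rw [add_sub_cancel_left, real_inner_smul_right] at h2
    exact nonpos_of_mul_nonpos_right h2 ht
  rw [outwardNormal, dif_pos hex]
  have hs := hex.choose_spec
  refine eq_of_halfSpace_le hν hs.1 fun w hw => ?_
  obtain ⟨t, ht, ht1, h⟩ := key w
  have h2 := hs.2 _ (h.2 (by
    rw [add_sub_cancel_left, real_inner_smul_right]; exact mul_nonpos_of_nonneg_of_nonpos ht.le hw))
  rw [add_sub_cancel_left, real_inner_smul_right] at h2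
  exact nonpos_of_mul_nonpos_right h2 ht

theorem UnitRep.outwardNormal_eq {T : Set (E d)} {s : Finset (E d × ℝ)} (h : UnitRep T s)
    {a : E d × ℝ} (ha : a ∈ s) {x : E d} (hx : x ∈ facetCore s a) : outwardNormal T x = a.1 :=
  DGFE.outwardNormal_eq h.convex (h.norm a ha) (h.eventually_mem_iff ha hx)

/-! ### Surface measure on hyperplanes -/

theorem isometry_hyperplaneParam (a : E d × ℝ) :
    Isometry (fun y : (ℝ ∙ a.1)ᗮ => a.2 • a.1 + (y : E d)) := by
  have h : Isometry (fun y : (ℝ ∙ a.1)ᗮ => (y : E d)) := isometry_subtype_coe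
  exact (IsometryEquiv.addLeft (a.2 • a.1)).isometry.comp h

theorem range_hyperplaneParam {a : E d × ℝ} (ha : ‖a.1‖ = 1) :
    range (fun y : (ℝ ∙ a.1)ᗮ => a.2 • a.1 + (y : E d)) = hyperplane a := by
  ext x
  constructor
  · rintro ⟨y, rfl⟩
    have := (Submodule.mem_orthogonal_singleton_iff_inner_right).1 y.2
    simp [hyperplane, inner_add_right, real_inner_smul_right, ha, this]
  · intro hx
    refine ⟨⟨x - a.2 • a.1, (Submodule.mem_orthogonal_singleton_iff_inner_right).2 ?_⟩, by simp⟩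
    rw [inner_sub_right, real_inner_smul_right, real_inner_self_eq_norm_sq, ha]
    simp only [hyperplane, mem_ofPred_eq] at hx
    linarith

theorem finrank_orthogonal_unit {ν : E d} (hν : ‖ν‖ = 1) :
    Module.finrank ℝ (ℝ ∙ ν)ᗮ = d - 1 := by
  have h0 : ν ≠ 0 := by rintro rfl; simp at hν
  have h := (ℝ ∙ ν).finrank_add_finrank_orthogonal
  rw [finrank_span_singleton h0, finrank_euclideanSpace_fin] at h
  omega

theorem map_hyperplaneParam {a : E d × ℝ} (ha : ‖a.1‖ = 1) :
    (volume : Measure (ℝ ∙ a.1)ᗮ).map (fun y : (ℝ ∙ a.1)ᗮ => a.2 • a.1 + (y : E d)) =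
      (surf d).restrict (hyperplane a) := by
  rw [← InnerProductSpace.euclideanHausdorffMeasure_eq_volume,
    (isometry_hyperplaneParam a).map_euclideanHausdorffMeasure, range_hyperplaneParam ha,
    finrank_orthogonal_unit ha, surf]

theorem measurableEmbedding_hyperplaneParam (a : E d × ℝ) :
    MeasurableEmbedding (fun y : (ℝ ∙ a.1)ᗮ => a.2 • a.1 + (y : E d)) :=
  (isometry_hyperplaneParam a).isClosedEmbedding.measurableEmbedding

/-- Cartesian coordinates adapted to the hyperplane `a`: depth below it and position in it. -/
theorem measurePreserving_depth {a : E d × ℝ} (ha : ‖a.1‖ = 1) :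
    MeasurePreserving (fun q : ℝ × (ℝ ∙ a.1)ᗮ => (a.2 - q.1) • a.1 + (q.2 : E d))
      (volume.prod volume) volume := by
  have h0 : a.1 ≠ 0 := by intro h; simp [h] at ha
  have h1 := ((ℝ ∙ a.1).measurePreserving_measurableEquivProd (a.2 • a.1)).symm
  rw [InnerProductSpace.euclideanHausdorffMeasure_eq_volume] at h1
  -- The inward unit normal, so that the first coordinate is depth.
  let v' : (ℝ ∙ a.1) := ⟨-a.1, by simp⟩
  have hv' : ‖v'‖ = 1 := by simp [v', ha]
  have h2 : MeasurePreserving (fun t : ℝ => t • v') volume volume := by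
    let e : ℝ ≃ₗᵢ[ℝ] (ℝ ∙ a.1) := LinearIsometryEquiv.ofSurjective
      ⟨LinearMap.toSpanSingleton ℝ _ v', fun t => by simp [norm_smul, hv']⟩ (by
        rintro ⟨y, hy⟩
        obtain ⟨t, rfl⟩ := Submodule.mem_span_singleton.1 hy
        exact ⟨-t, by ext1; simp [v']⟩)
    exact e.measurePreserving
  have h3 := h1.comp (h2.prod (MeasurePreserving.id (volume : Measure (ℝ ∙ a.1)ᗮ)))
  have h4 : (fun q : ℝ × (ℝ ∙ a.1)ᗮ => (a.2 - q.1) • a.1 + (q.2 : E d)) =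
      ((ℝ ∙ a.1).measurableEquivProd (a.2 • a.1)).symm ∘ Prod.map (fun t => t • v') id := by
    funext q
    simp only [Function.comp, Prod.map, Submodule.measurableEquivProd_symm_apply, vadd_eq_add, id,
      v', Submodule.coe_smul]
    module
  rw [h4]
  exact h3

/-- As the coordinates form a measurable embedding, `F` needs no measurability. -/
theorem integral_depth {a : E d × ℝ} (ha : ‖a.1‖ = 1) (F : E d → ℝ) :
    ∫ x, F x = ∫ q : ℝ × (ℝ ∙ a.1)ᗮ, F ((a.2 - q.1) • a.1 + (q.2 : E d)) ∂(volume.prod volume) := by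
  have h := measurePreserving_depth ha
  have : MeasurableEmbedding (fun q : ℝ × (ℝ ∙ a.1)ᗮ => (a.2 - q.1) • a.1 + (q.2 : E d)) := by
    refine Continuous.measurableEmbedding (by fun_prop) ?_
    rintro ⟨t, y⟩ ⟨t', y'⟩ h
    have hy := (Submodule.mem_orthogonal_singleton_iff_inner_right).1 y.2
    have hy' := (Submodule.mem_orthogonal_singleton_iff_inner_right).1 y'.2
    have h' : (a.2 - t) • a.1 + (y : E d) = (a.2 - t') • a.1 + (y' : E d) := h
    have h2 := congrArg (fun z => ⟪a.1, z⟫) h'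
    simp only [inner_add_right, real_inner_smul_right, real_inner_self_eq_norm_sq, ha, hy, hy'] at h2
    have ht : t = t' := by linarith
    subst ht
    have := add_left_cancel h'
    rw [Subtype.ext this]
  exact (h.integral_comp this F).symm

/-- Parallel normals are equal or opposite. If equal, the hyperplanes are disjoint because `a ≠ c`;
if opposite, a common point would contradict the strict inequalities at `z`. Otherwise the level set
is a proper affine subspace of the hyperplane, hence null. In dimension one only the parallel case
occurs. -/
theorem volume_level_eq_zero {a : E d × ℝ} (ha : ‖a.1‖ = 1) {c : E d × ℝ} (hc : ‖c.1‖ = 1)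
    {z : E d} (hza : ⟪a.1, z⟫ < a.2) (hzc : ⟪c.1, z⟫ < c.2) (hac : a ≠ c) :
    (volume : Measure (ℝ ∙ a.1)ᗮ) {y | ⟪c.1, a.2 • a.1 + (y : E d)⟫ = c.2} = 0 := by
  by_cases hspan : c.1 ∈ ℝ ∙ a.1
  · obtain ⟨t, ht⟩ := Submodule.mem_span_singleton.1 hspan
    have htabs : |t| = 1 := by
      have := hc; rw [← ht, norm_smul, ha] at this; simpa using this
    suffices h : {y : (ℝ ∙ a.1)ᗮ | ⟪c.1, a.2 • a.1 + (y : E d)⟫ = c.2} = ∅ by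
      rw [h, measure_empty]
    refine eq_empty_of_forall_notMem fun y hy => ?_
    have hy0 := (Submodule.mem_orthogonal_singleton_iff_inner_right).1 y.2
    simp only [mem_ofPred_eq, ← ht, real_inner_smul_left, inner_add_right, real_inner_smul_right,
      real_inner_self_eq_norm_sq, ha, hy0] at hy
    rw [← ht, real_inner_smul_left] at hzc
    rcases eq_or_eq_neg_of_abs_eq htabs with rfl | rfl
    · refine hac (Prod.ext (by simpa using ht) (by linarith))
    · linarith
  · let L : (ℝ ∙ a.1)ᗮ →ₗ[ℝ] ℝ := (innerSL ℝ c.1).toLinearMap ∘ₗ (ℝ ∙ a.1)ᗮ.subtype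
    have hL : L ≠ 0 := by
      intro h0
      apply hspan
      rw [← Submodule.orthogonal_orthogonal (ℝ ∙ a.1), Submodule.mem_orthogonal']
      intro u hu
      exact congrArg (fun M : (ℝ ∙ a.1)ᗮ →ₗ[ℝ] ℝ => M ⟨u, hu⟩) h0
    obtain ⟨u, hu⟩ : ∃ u, L u ≠ 0 := by
      by_contra! h
      exact hL (LinearMap.ext h)
    have hset : {y : (ℝ ∙ a.1)ᗮ | ⟪c.1, a.2 • a.1 + (y : E d)⟫ = c.2} =
        (AffineSubspace.mk' (((c.2 - a.2 * ⟪c.1, a.1⟫) / L u) • u) (LinearMap.ker L) :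
          Set (ℝ ∙ a.1)ᗮ) := by
      ext y
      have e1 : L y = ⟪c.1, (y : E d)⟫ := rfl
      simp only [mem_ofPred_eq, SetLike.mem_coe, AffineSubspace.mem_mk', LinearMap.mem_ker,
        vsub_eq_sub, map_sub, map_smul, smul_eq_mul, div_mul_cancel₀ _ hu, inner_add_right,
        real_inner_smul_right, e1]
      constructor <;> intro h <;> linarith
    rw [hset]
    refine Measure.addHaar_affineSubspace _ _ fun htop => ?_
    have := congrArg AffineSubspace.direction htop
    rw [AffineSubspace.direction_mk', AffineSubspace.direction_top, LinearMap.ker_eq_top] at this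
    exact hL this

theorem surf_hyperplane_inter_eq_zero {a : E d × ℝ} (ha : ‖a.1‖ = 1) {c : E d × ℝ}
    (hc : ‖c.1‖ = 1) {z : E d} (hza : ⟪a.1, z⟫ < a.2) (hzc : ⟪c.1, z⟫ < c.2) (hac : a ≠ c) :
    surf d (hyperplane a ∩ hyperplane c) = 0 := by
  rw [inter_comm, ← Measure.restrict_apply (isClosed_hyperplane c).measurableSet,
    ← map_hyperplaneParam ha, (measurableEmbedding_hyperplaneParam a).map_apply]
  exact volume_level_eq_zero ha hc hza hzc hac

theorem surf_hyperplane_inter_lt_top {a : E d × ℝ} (ha : ‖a.1‖ = 1) {B : Set (E d)}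
    (hB : IsCompact B) : surf d (B ∩ hyperplane a) < ⊤ := by
  rw [← Measure.restrict_apply hB.isClosed.measurableSet,
    ← map_hyperplaneParam ha, (measurableEmbedding_hyperplaneParam a).map_apply]
  exact (((isometry_hyperplaneParam a).isClosedEmbedding).isCompact_preimage hB).measure_lt_top

namespace UnitRep

variable {T : Set (E d)} {s : Finset (E d × ℝ)}

theorem frontier_subset (h : UnitRep T s) : frontier T ⊆ ⋃ a ∈ s, T ∩ hyperplane a := by
  intro x hx
  obtain ⟨h1, a, ha, h2⟩ := h.mem_frontier_iff.1 hx
  exact mem_biUnion ha ⟨h1, h2⟩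

theorem surf_frontier_lt_top (h : UnitRep T s) : surf d (frontier T) < ⊤ := by
  refine (measure_mono h.frontier_subset).trans_lt ?_
  exact (measure_biUnion_finset_le _ _).trans_lt
    (ENNReal.sum_lt_top.2 fun a ha => surf_hyperplane_inter_lt_top (h.norm a ha) h.isCompact)

/-- Almost every boundary point of a polytope has exactly one active constraint. -/
theorem surf_frontier_diff_cores (h : UnitRep T s) :
    surf d (frontier T \ ⋃ a ∈ s, facetCore s a) = 0 := by
  classical
  obtain ⟨z, hz⟩ := h.nonempty
  rw [h.interior_eq] at hz
  refine measure_mono_null (t := ⋃ a ∈ s, ⋃ c ∈ s.erase a, hyperplane a ∩ hyperplane c) ?_ ?_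
  · rintro x ⟨hx, hx'⟩
    obtain ⟨h1, a, ha, h2⟩ := h.mem_frontier_iff.1 hx
    simp only [mem_iUnion, not_exists] at hx'
    have := hx' a ha
    simp only [facetCore, mem_ofPred_eq, h2, true_and, not_forall, not_lt] at this
    obtain ⟨c, hc, hca, h3⟩ := this
    rw [h.eq] at h1
    exact mem_biUnion ha (mem_biUnion (Finset.mem_erase.2 ⟨hca, hc⟩)
      ⟨h2, le_antisymm (h1 c hc) h3⟩)
  · refine (measure_biUnion_null_iff s.countable_toSet).2 fun a ha =>
      (measure_biUnion_null_iff (s.erase a).countable_toSet).2 fun c hc => ?_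
    have hcs := Finset.mem_of_mem_erase hc
    exact surf_hyperplane_inter_eq_zero (h.norm a ha) (h.norm c hcs) (hz a ha) (hz c hcs)
      (Finset.ne_of_mem_erase hc).symm

theorem ae_frontier (h : UnitRep T s) :
    ∀ᵐ x ∂(surf d).restrict (frontier T), ∃ a ∈ s, x ∈ facetCore s a := by
  rw [ae_restrict_iff' isClosed_frontier.measurableSet, ae_iff]
  convert h.surf_frontier_diff_cores using 2
  ext x
  simp

theorem frontier_ae_eq (h : UnitRep T s) : frontier T =ᵐ[surf d] ⋃ a ∈ s, facetCore s a := by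
  refine (ae_le_set.2 h.surf_frontier_diff_cores).antisymm ?_
  have h1 : ⋃ a ∈ s, facetCore s a ⊆ frontier T :=
    iUnion₂_subset fun a ha => h.facetCore_subset_frontier ha
  exact h1.eventuallyLE

end UnitRep

end DGFE

namespace DGFE

variable {d : ℕ}

/-! ### Cut-off functions -/

theorem continuous_deriv_smoothTransition : Continuous (deriv Real.smoothTransition) :=
  (Real.smoothTransition.contDiff (n := 1)).continuous_deriv (by norm_num)

theorem deriv_smoothTransition_eq_zero {t : ℝ} (ht : t ∉ Icc (0 : ℝ) 1) :
    deriv Real.smoothTransition t = 0 := by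
  rcases lt_or_ge t 0 with h | h
  · have : Real.smoothTransition =ᶠ[𝓝 t] fun _ => 0 := by
      filter_upwards [Iio_mem_nhds h] with u hu
      exact Real.smoothTransition.zero_of_nonpos (le_of_lt hu)
    rw [this.deriv_eq, deriv_const]
  · have h1 : 1 < t := by
      by_contra h'
      exact ht ⟨h, not_lt.1 h'⟩
    have : Real.smoothTransition =ᶠ[𝓝 t] fun _ => 1 := by
      filter_upwards [Ioi_mem_nhds h1] with u hu
      exact Real.smoothTransition.one_of_one_le (le_of_lt hu)
    rw [this.deriv_eq, deriv_const]

/-- The derivative is supported in `[0, 1]` and has mass one, so after scaling by `ε` it acts as an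
approximate identity in the depth below a facet. -/
theorem integral_deriv_smoothTransition : ∫ t, deriv Real.smoothTransition t = 1 := by
  rw [← setIntegral_eq_integral_of_forall_compl_eq_zero
    (fun t ht => deriv_smoothTransition_eq_zero ht), integral_Icc_eq_integral_Ioc,
    ← intervalIntegral.integral_of_le zero_le_one, intervalIntegral.integral_deriv_eq_sub]
  · simp
  · exact fun t _ => (Real.smoothTransition.contDiff (n := 1)).differentiable one_ne_zero t
  · exact continuous_deriv_smoothTransition.intervalIntegrable _ _

theorem exists_deriv_smoothTransition_le : ∃ M, 0 ≤ M ∧ ∀ t, |deriv Real.smoothTransition t| ≤ M := by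
  obtain ⟨M, hM⟩ := (isCompact_Icc (a := (0 : ℝ)) (b := 1)).exists_bound_of_continuousOn
    continuous_deriv_smoothTransition.continuousOn
  refine ⟨M, (norm_nonneg _).trans (hM 0 (by simp)), fun t => ?_⟩
  by_cases ht : t ∈ Icc (0 : ℝ) 1
  · exact hM t ht
  · rw [deriv_smoothTransition_eq_zero ht, abs_zero]
    exact (norm_nonneg _).trans (hM 0 (by simp))

/-- A smooth cut-off function of the polyhedron `s`, equal to one at points of depth `ε`. -/
noncomputable def cutoff (s : Finset (E d × ℝ)) (ε : ℝ) (x : E d) : ℝ :=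
  ∏ a ∈ s, Real.smoothTransition ((a.2 - ⟪a.1, x⟫) / ε)

theorem cutoff_nonneg (s : Finset (E d × ℝ)) (ε : ℝ) (x : E d) : 0 ≤ cutoff s ε x :=
  Finset.prod_nonneg fun _ _ => Real.smoothTransition.nonneg _

theorem cutoff_le_one (s : Finset (E d × ℝ)) (ε : ℝ) (x : E d) : cutoff s ε x ≤ 1 :=
  Finset.prod_le_one (fun _ _ => Real.smoothTransition.nonneg _)
    fun _ _ => Real.smoothTransition.le_one _

theorem abs_cutoff_le_one (s : Finset (E d × ℝ)) (ε : ℝ) (x : E d) : |cutoff s ε x| ≤ 1 := by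
  rw [abs_of_nonneg (cutoff_nonneg s ε x)]; exact cutoff_le_one s ε x

theorem cutoff_eq_zero {s : Finset (E d × ℝ)} {ε : ℝ} (hε : 0 < ε) {x : E d} {a : E d × ℝ}
    (ha : a ∈ s) (hx : a.2 ≤ ⟪a.1, x⟫) : cutoff s ε x = 0 :=
  Finset.prod_eq_zero ha
    (Real.smoothTransition.zero_of_nonpos (div_nonpos_of_nonpos_of_nonneg (by linarith) hε.le))

theorem continuous_cutoff (s : Finset (E d × ℝ)) (ε : ℝ) : Continuous (cutoff s ε) := by
  refine continuous_finsetProd _ fun a _ => Real.smoothTransition.continuous.comp ?_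
  fun_prop

theorem tendsto_cutoff_one {s : Finset (E d × ℝ)} {x : E d} (hx : ∀ a ∈ s, ⟪a.1, x⟫ < a.2)
    {X : ℝ → E d} (hX : Tendsto X (𝓝[>] 0) (𝓝 x)) :
    Tendsto (fun ε => cutoff s ε (X ε)) (𝓝[>] 0) (𝓝 1) := by
  have : Tendsto (fun ε => cutoff s ε (X ε)) (𝓝[>] 0) (𝓝 (∏ a ∈ s, 1)) := by
    refine tendsto_finsetProd _ fun a ha => ?_
    have h1 : Tendsto (fun ε => a.2 - ⟪a.1, X ε⟫) (𝓝[>] 0) (𝓝 (a.2 - ⟪a.1, x⟫)) :=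
      Tendsto.const_sub a.2 (Tendsto.inner tendsto_const_nhds hX)
    have h2 := Tendsto.pos_mul_atTop (sub_pos.2 (hx a ha)) h1 tendsto_inv_nhdsGT_zero
    refine tendsto_const_nhds.congr' ?_
    filter_upwards [h2.eventually_ge_atTop 1] with ε hε
    exact (Real.smoothTransition.one_of_one_le hε).symm
  simpa using this

theorem tendsto_cutoff_zero {s : Finset (E d × ℝ)} {x : E d} {a : E d × ℝ} (ha : a ∈ s)
    (hx : a.2 < ⟪a.1, x⟫) {X : ℝ → E d} (hX : Tendsto X (𝓝[>] 0) (𝓝 x)) :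
    Tendsto (fun ε => cutoff s ε (X ε)) (𝓝[>] 0) (𝓝 0) := by
  refine tendsto_const_nhds.congr' ?_
  filter_upwards [(Tendsto.inner tendsto_const_nhds hX).eventually_const_lt hx, self_mem_nhdsWithin]
    with ε h1 h2
  exact (cutoff_eq_zero h2 ha (le_of_lt h1)).symm

open Classical in
theorem hasFDerivAt_cutoff (s : Finset (E d × ℝ)) (ε : ℝ) (x : E d) :
    HasFDerivAt (cutoff s ε) (∑ a ∈ s, cutoff (s.erase a) ε x •
      ((deriv Real.smoothTransition ((a.2 - ⟪a.1, x⟫) / ε) * (-ε⁻¹)) • innerSL ℝ a.1)) x := by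
  refine HasFDerivAt.finsetProd fun a _ => ?_
  have h1 : HasFDerivAt (fun x : E d => (a.2 - ⟪a.1, x⟫) / ε) ((-ε⁻¹) • innerSL ℝ a.1) x := by
    have := (((innerSL ℝ a.1).hasFDerivAt (x := x)).const_sub a.2).mul_const ε⁻¹
    simpa [div_eq_mul_inv] using this
  have h2 := ((Real.smoothTransition.contDiff (n := 1)).differentiable one_ne_zero
    ((a.2 - ⟪a.1, x⟫) / ε)).hasDerivAt
  have h3 := h2.comp_hasFDerivAt x h1
  rw [smul_smul] at h3
  exact h3

namespace UnitRep

variable {T : Set (E d)} {s : Finset (E d × ℝ)}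

theorem support_cutoff (h : UnitRep T s) {ε : ℝ} (hε : 0 < ε) {x : E d} (hx : x ∉ interior T) :
    cutoff s ε x = 0 := by
  rw [h.interior_eq] at hx
  simp only [mem_ofPred_eq, not_forall, not_lt] at hx
  obtain ⟨a, ha, h'⟩ := hx
  exact cutoff_eq_zero hε ha h'

theorem integrable_indicator_of_continuous (h : UnitRep T s) {g : E d → ℝ} (hg : Continuous g) :
    Integrable (T.indicator g) := by
  rw [integrable_indicator_iff h.isClosed.measurableSet]
  exact hg.continuousOn.integrableOn_compact h.isCompact

theorem tendsto_integral_cutoff (h : UnitRep T s) {g : E d → ℝ} (hg : Continuous g) :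
    Tendsto (fun ε => ∫ x, cutoff s ε x * g x) (𝓝[>] 0) (𝓝 (∫ x in interior T, g x)) := by
  rw [← integral_indicator isOpen_interior.measurableSet]
  refine tendsto_integral_filter_of_dominated_convergence (T.indicator fun x => |g x|) ?_ ?_
    (h.integrable_indicator_of_continuous hg.abs) (Eventually.of_forall fun x => ?_)
  · exact Eventually.of_forall fun ε => ((continuous_cutoff s ε).mul hg).aestronglyMeasurable
  · filter_upwards [self_mem_nhdsWithin] with ε hε
    refine Eventually.of_forall fun x => ?_
    by_cases hx : x ∈ interior T
    · rw [indicator_of_mem (interior_subset hx), norm_mul, Real.norm_eq_abs, Real.norm_eq_abs]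
      exact mul_le_of_le_one_left (abs_nonneg _) (abs_cutoff_le_one s ε x)
    · rw [h.support_cutoff hε hx, zero_mul, norm_zero]
      exact indicator_nonneg (fun _ _ => abs_nonneg _) _
  · by_cases hx : x ∈ interior T
    · rw [indicator_of_mem hx]
      rw [h.interior_eq] at hx
      simpa using (tendsto_cutoff_one hx tendsto_const_nhds).mul_const (g x)
    · rw [indicator_of_notMem hx]
      refine tendsto_const_nhds.congr' ?_
      filter_upwards [self_mem_nhdsWithin] with ε hε
      rw [h.support_cutoff hε hx, zero_mul]

end UnitRep

/-! ### Layer integrals and the divergence theorem -/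

theorem integral_depth_scaled {a : E d × ℝ} (ha : ‖a.1‖ = 1) (F : E d → ℝ) {ε : ℝ} (hε : 0 < ε) :
    ∫ q : ℝ × (ℝ ∙ a.1)ᗮ, F ((a.2 - ε * q.1) • a.1 + (q.2 : E d)) ∂(volume.prod volume) =
      ε⁻¹ * ∫ x, F x := by
  rw [integral_depth ha F]
  have hemb : MeasurableEmbedding (Prod.map (fun t : ℝ => ε * t) (id : (ℝ ∙ a.1)ᗮ → (ℝ ∙ a.1)ᗮ)) :=
    (Homeomorph.mulLeft₀ ε hε.ne').measurableEmbedding.prodMap MeasurableEmbedding.id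
  have h1 := hemb.integral_map (μ := (volume : Measure ℝ).prod (volume : Measure (ℝ ∙ a.1)ᗮ))
    (fun q : ℝ × (ℝ ∙ a.1)ᗮ => F ((a.2 - q.1) • a.1 + (q.2 : E d)))
  rw [← Measure.map_prod_map _ _ (by fun_prop) (by fun_prop), Real.map_volume_mul_left hε.ne',
    Measure.map_id, Measure.prod_smul_left, integral_smul_measure,
    ENNReal.toReal_ofReal (abs_nonneg _), abs_of_pos (inv_pos.2 hε), smul_eq_mul] at h1
  rw [h1]
  rfl

namespace UnitRep

variable {T : Set (E d)} {s : Finset (E d × ℝ)}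

-- The factor of the cut-off gradient belonging to `a` lives in a layer of thickness `ε` below the
-- hyperplane of `a`. Measuring depth in units of `ε` turns the layer into `[0, 1]` times the
-- hyperplane and absorbs `ε⁻¹`; the other cut-off factors tend to the indicator of the facet, and
-- the depth profile integrates to one.
open Classical in
theorem tendsto_integral_deriv_cutoff (h : UnitRep T s) {a : E d × ℝ} (ha : a ∈ s)
    {g : E d → ℝ} (hg : Continuous g) :
    Tendsto (fun ε => ε⁻¹ * ∫ x, deriv Real.smoothTransition ((a.2 - ⟪a.1, x⟫) / ε) *
      (cutoff (s.erase a) ε x * g x)) (𝓝[>] 0) (𝓝 (∫ x in facetCore s a, g x ∂surf d)) := by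
  have hna := h.norm a ha
  obtain ⟨z, hz⟩ := h.nonempty
  rw [h.interior_eq] at hz
  set Φ : ℝ → (ℝ ∙ a.1)ᗮ → E d := fun t y => (a.2 - t) • a.1 + (y : E d) with hΦ
  have hdepth : ∀ t y, a.2 - ⟪a.1, Φ t y⟫ = t := by
    intro t y
    have := (Submodule.mem_orthogonal_singleton_iff_inner_right).1 y.2
    simp [hΦ, inner_add_right, real_inner_smul_right, hna, this]
  have hlim : ∫ q : ℝ × (ℝ ∙ a.1)ᗮ, deriv Real.smoothTransition q.1 *
      (facetCore s a).indicator g (Φ 0 q.2) ∂(volume.prod volume) =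
      ∫ x in facetCore s a, g x ∂surf d := by
    rw [integral_prod_mul (deriv Real.smoothTransition)
      (fun y => (facetCore s a).indicator g (Φ 0 y)), integral_deriv_smoothTransition, one_mul]
    have hsub : facetCore s a ⊆ hyperplane a := fun x hx => hx.1
    have h1 := (measurableEmbedding_hyperplaneParam a).integral_map (μ := volume)
      ((facetCore s a).indicator g)
    rw [map_hyperplaneParam hna, setIntegral_indicator (measurableSet_facetCore s a),
      inter_eq_right.2 hsub] at h1
    rw [h1]
    simp [hΦ]
  rw [← hlim]
  obtain ⟨M, hM0, hM⟩ := exists_deriv_smoothTransition_le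
  obtain ⟨B, hB⟩ := h.isCompact.exists_bound_of_continuousOn hg.continuousOn
  obtain ⟨R, hR⟩ := h.bounded.exists_norm_le
  -- For `ε ≤ 1` this compact set carries all the integrands: the scaled depth is in `[0, 1]`, and a
  -- point of `T` has position of norm at most `R + |a.2| + ε`.
  set S : Set (ℝ × (ℝ ∙ a.1)ᗮ) := Icc 0 1 ×ˢ Metric.closedBall 0 (R + (|a.2| + 1)) with hS
  have hScompact : IsCompact S := isCompact_Icc.prod (isCompact_closedBall _ _)
  have heq : ∀ ε : ℝ, 0 < ε → ∀ q : ℝ × (ℝ ∙ a.1)ᗮ,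
      deriv Real.smoothTransition ((a.2 - ⟪a.1, Φ (ε * q.1) q.2⟫) / ε) *
        (cutoff (s.erase a) ε (Φ (ε * q.1) q.2) * g (Φ (ε * q.1) q.2)) =
      deriv Real.smoothTransition q.1 *
        (cutoff (s.erase a) ε (Φ (ε * q.1) q.2) * g (Φ (ε * q.1) q.2)) := by
    intro ε hε q
    rw [hdepth, mul_div_cancel_left₀ _ hε.ne']
  have hcongr : (fun ε : ℝ => ∫ q : ℝ × (ℝ ∙ a.1)ᗮ, deriv Real.smoothTransition q.1 *
      (cutoff (s.erase a) ε (Φ (ε * q.1) q.2) * g (Φ (ε * q.1) q.2)) ∂(volume.prod volume))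
      =ᶠ[𝓝[>] 0] fun ε => ε⁻¹ * ∫ x, deriv Real.smoothTransition ((a.2 - ⟪a.1, x⟫) / ε) *
      (cutoff (s.erase a) ε x * g x) := by
    filter_upwards [self_mem_nhdsWithin] with ε hε
    rw [← integral_depth_scaled hna _ hε]
    exact integral_congr_ae (Eventually.of_forall fun q => (heq ε hε q).symm)
  refine Tendsto.congr' hcongr ?_
  refine tendsto_integral_filter_of_dominated_convergence (S.indicator fun _ => M * B) ?_ ?_ ?_ ?_
  · refine Eventually.of_forall fun ε => Continuous.aestronglyMeasurable ?_
    have h1 : Continuous fun q : ℝ × (ℝ ∙ a.1)ᗮ => Φ (ε * q.1) q.2 := by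
      simp only [hΦ]; fun_prop
    exact (continuous_deriv_smoothTransition.comp continuous_fst).mul
      (((continuous_cutoff _ ε).comp h1).mul (hg.comp h1))
  · filter_upwards [Ioc_mem_nhdsGT (one_pos : (0 : ℝ) < 1)] with ε hε
    refine Eventually.of_forall fun q => ?_
    by_cases hq : q ∈ S ∧ Φ (ε * q.1) q.2 ∈ T
    · rw [indicator_of_mem hq.1, norm_mul, norm_mul]
      refine mul_le_mul (hM _) ?_ (by positivity) hM0
      exact (mul_le_of_le_one_left (norm_nonneg _) (abs_cutoff_le_one _ _ _)).trans (hB _ hq.2)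
    · have hzero : deriv Real.smoothTransition q.1 *
          (cutoff (s.erase a) ε (Φ (ε * q.1) q.2) * g (Φ (ε * q.1) q.2)) = 0 := by
        by_cases hq1 : q.1 ∈ Icc (0 : ℝ) 1
        · by_cases hT : Φ (ε * q.1) q.2 ∈ T
          · refine absurd ⟨⟨hq1, ?_⟩, hT⟩ hq
            have e1 : ((q.2 : (ℝ ∙ a.1)ᗮ) : E d) = Φ (ε * q.1) q.2 - (a.2 - ε * q.1) • a.1 := by
              simp [hΦ]
            rw [mem_closedBall_zero_iff]
            change ‖((q.2 : (ℝ ∙ a.1)ᗮ) : E d)‖ ≤ _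
            rw [e1]
            refine (norm_sub_le _ _).trans (add_le_add (hR _ hT) ?_)
            rw [norm_smul, hna, mul_one, Real.norm_eq_abs]
            refine (abs_sub _ _).trans (add_le_add le_rfl ?_)
            rw [abs_of_nonneg (mul_nonneg hε.1.le hq1.1)]
            exact mul_le_one₀ hε.2 hq1.1 hq1.2
          · rw [h.eq] at hT
            simp only [polyhedron, mem_ofPred_eq, not_forall, not_le] at hT
            obtain ⟨c, hc, hcx⟩ := hT
            -- The depth below `a` is nonnegative here, so the violated constraint is another one,
            -- and its factor in the cut-off vanishes.
            have hca : c ≠ a := by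
              rintro rfl
              have := hdepth (ε * q.1) q.2
              have := mul_nonneg hε.1.le hq1.1
              linarith
            rw [cutoff_eq_zero hε.1 (Finset.mem_erase.2 ⟨hca, hc⟩) hcx.le, zero_mul, mul_zero]
        · rw [deriv_smoothTransition_eq_zero hq1, zero_mul]
      rw [hzero, norm_zero]
      refine indicator_nonneg (fun _ _ => mul_nonneg hM0 ?_) _
      exact (norm_nonneg _).trans (hB z (by rw [h.eq]; exact fun c hc => (hz c hc).le))
  · rw [integrable_indicator_iff hScompact.isClosed.measurableSet]
    exact continuousOn_const.integrableOn_compact hScompact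
  -- The pointwise limit of the cut-off is undecided only where a second constraint is active, which
  -- is a null set.
  · have hnull : ∀ᵐ y : (ℝ ∙ a.1)ᗮ, ∀ c ∈ s.erase a, ⟪c.1, Φ 0 y⟫ ≠ c.2 := by
      refine (ae_ball_iff (s.erase a).countable_toSet).2 fun c hc => ?_
      have hcs := Finset.mem_of_mem_erase hc
      have := volume_level_eq_zero hna (h.norm c hcs) (hz a ha) (hz c hcs)
        (Finset.ne_of_mem_erase hc).symm
      rw [ae_iff]
      simpa [hΦ] using this
    filter_upwards [Measure.quasiMeasurePreserving_snd.ae hnull] with q hq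
    have hX : Tendsto (fun ε : ℝ => Φ (ε * q.1) q.2) (𝓝[>] 0) (𝓝 (Φ 0 q.2)) := by
      have : Tendsto (fun ε : ℝ => Φ (ε * q.1) q.2) (𝓝 0) (𝓝 (Φ (0 * q.1) q.2)) :=
        Continuous.tendsto (by simp only [hΦ]; fun_prop) _
      rw [zero_mul] at this
      exact this.mono_left nhdsWithin_le_nhds
    refine Tendsto.const_mul _ ?_
    by_cases hcore : ∀ c ∈ s.erase a, ⟪c.1, Φ 0 q.2⟫ < c.2
    · have hmem : Φ 0 q.2 ∈ facetCore s a :=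
        ⟨by linarith [hdepth 0 q.2], fun c hc hca => hcore c (Finset.mem_erase.2 ⟨hca, hc⟩)⟩
      rw [indicator_of_mem hmem]
      simpa using (tendsto_cutoff_one hcore hX).mul ((hg.tendsto _).comp hX)
    · simp only [not_forall, not_lt] at hcore
      obtain ⟨c, hc, hcx⟩ := hcore
      have hlt : c.2 < ⟪c.1, Φ 0 q.2⟫ := lt_of_le_of_ne hcx (hq c hc).symm
      have hmem : Φ 0 q.2 ∉ facetCore s a := fun hm =>
        hlt.not_gt (hm.2 c (Finset.mem_of_mem_erase hc) (Finset.ne_of_mem_erase hc))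
      rw [indicator_of_notMem hmem]
      simpa using (tendsto_cutoff_zero hc hlt hX).mul ((hg.tendsto _).comp hX)

theorem integrableOn_frontier_of_continuous (h : UnitRep T s) {f : E d → ℝ} (hf : Continuous f) :
    IntegrableOn f (frontier T) (surf d) := by
  obtain ⟨B, hB⟩ := h.isCompact.exists_bound_of_continuousOn hf.continuousOn
  exact IntegrableOn.of_bound h.surf_frontier_lt_top hf.aestronglyMeasurable B
    ((ae_restrict_iff' isClosed_frontier.measurableSet).2 (Eventually.of_forall fun x hx =>
      hB x (h.isClosed.frontier_subset hx)))

theorem integral_frontier_eq_sum (h : UnitRep T s) {f : E d → ℝ}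
    (hf : IntegrableOn f (frontier T) (surf d)) :
    ∫ x in frontier T, f x ∂surf d = ∑ a ∈ s, ∫ x in facetCore s a, f x ∂surf d := by
  rw [setIntegral_congr_set h.frontier_ae_eq]
  exact integral_biUnion_finset s (fun a _ => measurableSet_facetCore s a)
    (fun a ha c _ hac => disjoint_facetCore ha hac)
    (fun a ha => hf.mono_set (h.facetCore_subset_frontier ha))

/-- The normal field is defined by choice; it is measurable because almost everywhere it is constant
on each facet. -/
theorem aestronglyMeasurable_outwardNormal (h : UnitRep T s) :
    AEStronglyMeasurable (outwardNormal T) ((surf d).restrict (frontier T)) := by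
  classical
  refine ⟨fun x => ∑ a ∈ s, (facetCore s a).indicator (fun _ => a.1) x, ?_, ?_⟩
  · exact Finset.stronglyMeasurable_fun_sum s fun a _ =>
      stronglyMeasurable_const.indicator (measurableSet_facetCore s a)
  · filter_upwards [h.ae_frontier] with x hx
    obtain ⟨a, ha, hxa⟩ := hx
    rw [h.outwardNormal_eq ha hxa, Finset.sum_eq_single_of_mem a ha, indicator_of_mem hxa]
    intro c hc hca
    exact indicator_of_notMem (fun hxc => Set.disjoint_left.1 (disjoint_facetCore hc hca) hxc hxa) _

theorem ae_norm_outwardNormal (h : UnitRep T s) :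
    ∀ᵐ x ∂(surf d).restrict (frontier T), ‖outwardNormal T x‖ = 1 := by
  filter_upwards [h.ae_frontier] with x hx
  obtain ⟨a, ha, hxa⟩ := hx
  rw [h.outwardNormal_eq ha hxa, h.norm a ha]

theorem integrableOn_frontier_mul_normal (h : UnitRep T s) {f : E d → ℝ}
    (hf : IntegrableOn f (frontier T) (surf d)) (w : E d) :
    IntegrableOn (fun x => f x * ⟪outwardNormal T x, w⟫) (frontier T) (surf d) := by
  refine Integrable.mul_bdd (c := ‖w‖) hf
    (h.aestronglyMeasurable_outwardNormal.inner aestronglyMeasurable_const) ?_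
  filter_upwards [h.ae_norm_outwardNormal] with x hx
  exact (norm_inner_le_norm _ _).trans (by rw [hx, one_mul])

/-- The divergence theorem on a polytope. -/
theorem integral_fderiv (h : UnitRep T s) {f : E d → ℝ} (hf : ContDiff ℝ 1 f) (w : E d) :
    ∫ x in interior T, fderiv ℝ f x w =
      ∫ x in frontier T, f x * ⟪outwardNormal T x, w⟫ ∂surf d := by
  classical
  have hf' : Continuous fun x => fderiv ℝ f x w :=
    (hf.continuous_fderiv one_ne_zero).clm_apply continuous_const
  have hint := h.integrableOn_frontier_of_continuous hf.continuous
  rw [h.integral_frontier_eq_sum (h.integrableOn_frontier_mul_normal hint w)]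
  have e1 : ∀ a ∈ s, ∫ x in facetCore s a, f x * ⟪outwardNormal T x, w⟫ ∂surf d =
      ⟪a.1, w⟫ * ∫ x in facetCore s a, f x ∂surf d := by
    intro a ha
    rw [← integral_const_mul]
    refine setIntegral_congr_fun (measurableSet_facetCore s a) fun x hx => ?_
    simp only [h.outwardNormal_eq ha hx, mul_comm]
  rw [Finset.sum_congr rfl e1]
  refine tendsto_nhds_unique (h.tendsto_integral_cutoff hf') ?_
  refine Tendsto.congr' ?_ (tendsto_finsetSum s fun a ha =>
    (h.tendsto_integral_deriv_cutoff ha hf.continuous).const_mul ⟪a.1, w⟫)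
  filter_upwards [self_mem_nhdsWithin] with ε hε
  have hcs : HasCompactSupport (cutoff s ε) :=
    HasCompactSupport.intro h.isCompact fun x hx =>
      h.support_cutoff hε fun hx' => hx (interior_subset hx')
  have hd : ∀ x, fderiv ℝ (cutoff s ε) x w = ∑ a ∈ s, (-ε⁻¹ * ⟪a.1, w⟫) *
      (deriv Real.smoothTransition ((a.2 - ⟪a.1, x⟫) / ε) * cutoff (s.erase a) ε x) := by
    intro x
    rw [(hasFDerivAt_cutoff s ε x).fderiv]
    simp only [_root_.sum_apply, _root_.smul_apply, innerSL_apply_apply,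
      smul_eq_mul]
    exact Finset.sum_congr rfl fun a _ => by ring
  have hcont : ∀ a, Continuous fun x : E d =>
      deriv Real.smoothTransition ((a.2 - ⟪a.1, x⟫) / ε) * cutoff (s.erase a) ε x := by
    intro a
    exact (continuous_deriv_smoothTransition.comp (by fun_prop)).mul (continuous_cutoff _ ε)
  have hdc : Continuous fun x => fderiv ℝ (cutoff s ε) x w := by
    simp only [hd]
    exact continuous_finsetSum s fun a _ => continuous_const.mul (hcont a)
  have hdcs : HasCompactSupport fun x => fderiv ℝ (cutoff s ε) x w := hcs.fderiv_apply (𝕜 := ℝ) w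
  have hae : ∀ a ∈ s, Integrable fun x => deriv Real.smoothTransition ((a.2 - ⟪a.1, x⟫) / ε) *
      (cutoff (s.erase a) ε x * f x) := by
    intro a ha
    have hc : Continuous fun x => deriv Real.smoothTransition ((a.2 - ⟪a.1, x⟫) / ε) *
      (cutoff (s.erase a) ε x * f x) := by
      simp only [← mul_assoc]
      exact (hcont a).mul hf.continuous
    refine hc.integrable_of_hasCompactSupport (HasCompactSupport.intro h.isCompact fun x hx => ?_)
    rw [h.eq] at hx
    simp only [polyhedron, mem_ofPred_eq, not_forall, not_le] at hx
    obtain ⟨c, hc, hcx⟩ := hx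
    by_cases hca : c = a
    · subst hca
      rw [deriv_smoothTransition_eq_zero, zero_mul]
      intro h'
      exact absurd h'.1 (not_le.2 (div_neg_of_neg_of_pos (by linarith) hε))
    · rw [cutoff_eq_zero hε (Finset.mem_erase.2 ⟨hca, hc⟩) hcx.le, zero_mul, mul_zero]
  -- The cut-off has compact support, so integration by parts on the whole space leaves no boundary
  -- term. Its derivative carries `-ε⁻¹ ⟪a.1, w⟫`, and the two minus signs cancel.
  rw [integral_mul_fderiv_eq_neg_fderiv_mul_of_integrable
    ((hdc.mul hf.continuous).integrable_of_hasCompactSupport hdcs.mul_right)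
    (((continuous_cutoff s ε).mul hf').integrable_of_hasCompactSupport hcs.mul_right)
    (((continuous_cutoff s ε).mul hf.continuous).integrable_of_hasCompactSupport hcs.mul_right)
    (fun x _ => (hasFDerivAt_cutoff s ε x).differentiableAt)
    (fun x _ => hf.differentiable one_ne_zero x)]
  have e2 : ∀ x, fderiv ℝ (cutoff s ε) x w * f x = ∑ a ∈ s, (-ε⁻¹ * ⟪a.1, w⟫) *
      (deriv Real.smoothTransition ((a.2 - ⟪a.1, x⟫) / ε) * (cutoff (s.erase a) ε x * f x)) := by
    intro x
    rw [hd, Finset.sum_mul]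
    exact Finset.sum_congr rfl fun a _ => by ring
  simp only [e2]
  rw [integral_finsetSum _ fun a ha => (hae a ha).const_mul _, ← Finset.sum_neg_distrib]
  refine Finset.sum_congr rfl fun a _ => ?_
  rw [integral_const_mul]
  ring

end UnitRep

end DGFE

namespace DGFE

variable {d : ℕ} {F : Type*} [NormedAddCommGroup F] [NormedSpace ℝ F] [CompleteSpace F]

/-! ### Smoothing in star-shaped domains -/

/-- Mollification of `f` by the normalized bump function `φ`. -/
noncomputable def mollify (φ : ContDiffBump (0 : E d)) (f : E d → F) : E d → F :=
  convolution (φ.normed volume) f (ContinuousLinearMap.lsmul ℝ ℝ) volume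

omit [CompleteSpace F] in
theorem mollify_apply (φ : ContDiffBump (0 : E d)) (f : E d → F) (x : E d) :
    mollify φ f x = ∫ t, φ.normed volume t • f (x - t) := rfl

-- Mollification averages the translates of `f` against the probability measure `ν` with the bump as
-- density. Jensen's inequality moves the power inside; Tonelli and translation invariance finish.
omit [CompleteSpace F] in
theorem eLpNorm_mollify_le {p : ℝ} (hp : 1 ≤ p) (φ : ContDiffBump (0 : E d)) {f : E d → F}
    (hf : AEStronglyMeasurable f volume) :
    eLpNorm (mollify φ f) (ENNReal.ofReal p) volume ≤ eLpNorm f (ENNReal.ofReal p) volume := by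
  have hp0 : 0 < p := one_pos.trans_le hp
  set r : E d → ENNReal := fun t => ‖φ.normed volume t‖ₑ with hr
  have hrm : Measurable r := φ.continuous_normed.measurable.enorm
  have hr1 : ∫⁻ t, r t = 1 := by
    rw [← ENNReal.ofReal_one, ← φ.integral_normed (μ := volume),
      ofReal_integral_eq_lintegral_ofReal φ.integrable_normed
        (Eventually.of_forall fun t => φ.nonneg_normed t)]
    exact lintegral_congr fun t => Real.enorm_of_nonneg (φ.nonneg_normed t)
  set ν : Measure (E d) := volume.withDensity r with hν
  have hprob : IsProbabilityMeasure ν := ⟨by rw [hν, withDensity_apply _ MeasurableSet.univ,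
    Measure.restrict_univ, hr1]⟩
  have hqm : Measure.QuasiMeasurePreserving (fun q : E d × E d => q.1 - q.2)
      ((volume : Measure (E d)).prod ν) volume :=
    quasiMeasurePreserving_sub_of_right_invariant volume ν
  have hmeas : AEStronglyMeasurable (fun q : E d × E d => f (q.1 - q.2)) (volume.prod ν) :=
    hf.comp_quasiMeasurePreserving hqm
  have hslice' : ∀ x, AEStronglyMeasurable (fun t => f (x - t)) (volume : Measure (E d)) :=
    fun x => hf.comp_quasiMeasurePreserving (quasiMeasurePreserving_sub_left volume x)
  have hslice : ∀ x, AEStronglyMeasurable (fun t => f (x - t)) ν :=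
    fun x => (hslice' x).mono_ac (withDensity_absolutelyContinuous _ _)
  have hpt : ∀ x, ‖mollify φ f x‖ₑ ^ p ≤ ∫⁻ t, ‖f (x - t)‖ₑ ^ p ∂ν := by
    intro x
    have h1 : ‖mollify φ f x‖ₑ ≤ ∫⁻ t, ‖f (x - t)‖ₑ ∂ν := by
      rw [mollify_apply, hν]
      refine (enorm_integral_le_lintegral_enorm _).trans ?_
      rw [lintegral_withDensity_eq_lintegral_mul₀ hrm.aemeasurable (hslice' x).enorm]
      simp only [enorm_smul]
      rfl
    have h2 := eLpNorm'_le_eLpNorm'_of_exponent_le one_pos hp ν (hslice x)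
    simp only [eLpNorm', ENNReal.rpow_one, div_one] at h2
    refine (ENNReal.rpow_le_rpow (h1.trans h2) hp0.le).trans ?_
    rw [← ENNReal.rpow_mul, one_div, inv_mul_cancel₀ hp0.ne', ENNReal.rpow_one]
  have hP0 : ENNReal.ofReal p ≠ 0 := by simpa using hp0
  rw [eLpNorm_eq_lintegral_rpow_enorm_toReal hP0 ENNReal.ofReal_ne_top,
    eLpNorm_eq_lintegral_rpow_enorm_toReal hP0 ENNReal.ofReal_ne_top, ENNReal.toReal_ofReal hp0.le]
  refine ENNReal.rpow_le_rpow ?_ (by positivity)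
  calc ∫⁻ x, ‖mollify φ f x‖ₑ ^ p ≤ ∫⁻ x, ∫⁻ t, ‖f (x - t)‖ₑ ^ p ∂ν := lintegral_mono hpt
    _ = ∫⁻ t, (∫⁻ x, ‖f (x - t)‖ₑ ^ p) ∂ν :=
        lintegral_lintegral_swap (hmeas.enorm.pow_const p)
    _ = ∫⁻ _, (∫⁻ x, ‖f x‖ₑ ^ p) ∂ν := by
        refine lintegral_congr fun t => ?_
        exact lintegral_sub_right_eq_self (fun x => ‖f x‖ₑ ^ p) t
    _ = ∫⁻ x, ‖f x‖ₑ ^ p := by simp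

/-- The parameter of the smoothing operators. -/
noncomputable def smoothParam (n : ℕ) : ℝ := 1 / (n + 2)

theorem smoothParam_pos (n : ℕ) : 0 < smoothParam n := by unfold smoothParam; positivity

theorem smoothParam_le (n : ℕ) : smoothParam n ≤ 1 / 2 := by
  unfold smoothParam
  exact one_div_le_one_div_of_le two_pos (by linarith [(Nat.cast_nonneg n : (0 : ℝ) ≤ n)])

theorem tendsto_smoothParam : Tendsto smoothParam atTop (𝓝 0) := by
  have := (tendsto_one_div_add_atTop_nhds_zero_nat (𝕜 := ℝ)).comp (tendsto_add_atTop_nat 1)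
  refine this.congr fun n => ?_
  simp only [Function.comp, smoothParam]
  push_cast
  ring_nf

/-- The bump function of radius `r / (n + 2)`. -/
noncomputable def smoothBump (d : ℕ) (r : ℝ) (hr : 0 < r) (n : ℕ) : ContDiffBump (0 : E d) where
  rIn := smoothParam n * r / 2
  rOut := smoothParam n * r
  rIn_pos := by have := smoothParam_pos n; positivity
  rIn_lt_rOut := by have := mul_pos (smoothParam_pos n) hr; linarith

/-- The contraction of `E d` towards `c`. -/
noncomputable def shrink (c : E d) (n : ℕ) (x : E d) : E d :=
  (1 - smoothParam n) • x + smoothParam n • c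

/-- A smooth approximation of `f`, which at `x` depends on `f` near `shrink c n x` only. -/
noncomputable def smoothing (c : E d) (r : ℝ) (hr : 0 < r) (n : ℕ) (f : E d → F) (x : E d) : F :=
  mollify (smoothBump d r hr n) f (shrink c n x)

theorem lintegral_shrink (c : E d) (n : ℕ) (g : E d → ENNReal) :
    ∫⁻ x, g (shrink c n x) =
      ENNReal.ofReal (((1 - smoothParam n) ^ d)⁻¹) * ∫⁻ x, g x := by
  have h0 : 0 < 1 - smoothParam n := by linarith [smoothParam_le n]
  have h1 : ∫⁻ x, g x = ∫⁻ x, g (x + smoothParam n • c) :=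
    (lintegral_add_right_eq_self g _).symm
  have hemb : MeasurableEmbedding fun x : E d => (1 - smoothParam n) • x :=
    (Homeomorph.smulOfNeZero _ h0.ne').measurableEmbedding
  have h2 := hemb.lintegral_map (μ := volume) (fun x => g (x + smoothParam n • c))
  rw [Measure.map_addHaar_smul _ h0.ne', lintegral_smul_measure, finrank_euclideanSpace_fin,
    abs_of_pos (by positivity), ← h1, smul_eq_mul] at h2
  exact h2.symm

-- Since `1 - smoothParam n ≥ 1 / 2`, the Jacobian of the contraction costs at most `2 ^ d`,
-- uniformly in `n`.
omit [CompleteSpace F] in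
theorem eLpNorm_smoothing_le {p : ℝ} (hp : 1 ≤ p) (c : E d) {r : ℝ} (hr : 0 < r) (n : ℕ)
    {f : E d → F} (hf : AEStronglyMeasurable f volume) :
    eLpNorm (smoothing c r hr n f) (ENNReal.ofReal p) volume ≤
      ENNReal.ofReal (2 ^ d) ^ (1 / p) * eLpNorm f (ENNReal.ofReal p) volume := by
  have hp0 : 0 < p := one_pos.trans_le hp
  have hP0 : ENNReal.ofReal p ≠ 0 := by simpa using hp0
  refine le_trans ?_ (mul_le_mul_right (eLpNorm_mollify_le hp (smoothBump d r hr n) hf) _)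
  rw [eLpNorm_eq_lintegral_rpow_enorm_toReal hP0 ENNReal.ofReal_ne_top,
    eLpNorm_eq_lintegral_rpow_enorm_toReal hP0 ENNReal.ofReal_ne_top, ENNReal.toReal_ofReal hp0.le,
    ← ENNReal.mul_rpow_of_nonneg _ _ (by positivity)]
  refine ENNReal.rpow_le_rpow ?_ (by positivity)
  have := lintegral_shrink c n fun y => ‖mollify (smoothBump d r hr n) f y‖ₑ ^ p
  refine this.trans_le (mul_le_mul_left (ENNReal.ofReal_le_ofReal ?_) _)
  have h0 : 1 / 2 ≤ 1 - smoothParam n := by linarith [smoothParam_le n]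
  rw [← inv_pow]
  refine pow_le_pow_left₀ (inv_nonneg.2 (by linarith)) ?_ d
  rw [inv_le_comm₀ (by linarith) two_pos]
  linarith

theorem tendsto_smoothing_of_continuous {p : ℝ} (hp : 1 ≤ p) (c : E d) {r : ℝ} (hr : 0 < r)
    {f : E d → F} (hf : Continuous f) (hfs : HasCompactSupport f) :
    Tendsto (fun n => eLpNorm (smoothing c r hr n f - f) (ENNReal.ofReal p) volume)
      atTop (𝓝 0) := by
  have hp0 : 0 < p := one_pos.trans_le hp
  obtain ⟨R, hR⟩ := hfs.isCompact.isBounded.exists_norm_le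
  have hR' : ∀ x, R < ‖x‖ → f x = 0 := fun x hx =>
    image_eq_zero_of_notMem_tsupport fun h => hx.not_ge (hR x h)
  -- As `smoothParam n ≤ 1 / 2`, one has `‖shrink c n x‖ ≥ (‖x‖ - ‖c‖) / 2`; beyond this radius the
  -- mollifier, of radius at most `r`, no longer meets the support of `f`.
  set R' : ℝ := max R (2 * (R + r + ‖c‖)) with hRR
  have hdist : ∀ n x, dist (shrink c n x) x = smoothParam n * ‖c - x‖ := by
    intro n x
    have e1 : shrink c n x - x = smoothParam n • (c - x) := by
      rw [shrink]
      module
    rw [dist_eq_norm, e1, norm_smul, Real.norm_eq_abs, abs_of_pos (smoothParam_pos n)]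
  have hsupp : ∀ n, Function.support (smoothing c r hr n f) ⊆ Metric.closedBall 0 R' := by
    intro n x hx
    rw [mem_closedBall_zero_iff]
    by_contra! hlt
    refine hx ?_
    have h1 : 2 * (R + r + ‖c‖) < ‖x‖ := (le_max_right _ _).trans_lt hlt
    have hδ := smoothParam_le n
    have hδ0 := smoothParam_pos n
    have h2 : R + r < ‖shrink c n x‖ := by
      have e1 : ‖(1 - smoothParam n) • x‖ = (1 - smoothParam n) * ‖x‖ := by
        rw [norm_smul, Real.norm_eq_abs, abs_of_pos (by linarith)]
      have e2 : ‖smoothParam n • c‖ = smoothParam n * ‖c‖ := by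
        rw [norm_smul, Real.norm_eq_abs, abs_of_pos hδ0]
      have e3 : (1 - smoothParam n) • x = shrink c n x - smoothParam n • c := by
        simp [shrink]
      have e4 := norm_sub_le (shrink c n x) (smoothParam n • c)
      rw [← e3, e1, e2] at e4
      nlinarith [norm_nonneg x, norm_nonneg c]
    rw [smoothing, mollify_apply]
    refine integral_eq_zero_of_ae (Eventually.of_forall fun t => ?_)
    by_cases ht : t ∈ Metric.ball (0 : E d) (smoothBump d r hr n).rOut
    · have ht' : ‖t‖ < smoothParam n * r := by simpa [smoothBump] using ht
      have : f (shrink c n x - t) = 0 := by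
        apply hR'
        have := norm_sub_norm_le (shrink c n x) t
        nlinarith
      simp [this]
    · rw [← (smoothBump d r hr n).support_normed_eq (μ := volume)] at ht
      simp [Function.notMem_support.1 ht]
  have hsuppf : Function.support f ⊆ Metric.closedBall 0 R' := by
    intro x hx
    rw [mem_closedBall_zero_iff]
    by_contra! hlt
    exact hx (hR' x ((le_max_left _ _).trans_lt hlt))
  have huc := hfs.uniformContinuous_of_continuous hf
  set V : ENNReal := volume (Metric.closedBall (0 : E d) R') ^ (1 / (ENNReal.ofReal p).toReal) with hV
  have hVtop : V ≠ ⊤ := by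
    refine ENNReal.rpow_ne_top_of_nonneg (by positivity) (isCompact_closedBall _ _).measure_lt_top.ne
  have key : ∀ ε > 0, ∀ᶠ n in atTop, eLpNorm (smoothing c r hr n f - f) (ENNReal.ofReal p) volume ≤
      ENNReal.ofReal ε * V := by
    intro ε hε
    obtain ⟨η, hη, hcont⟩ := Metric.uniformContinuous_iff.1 huc (ε / 2) (half_pos hε)
    have hlim : Tendsto (fun n => smoothParam n * (r + ‖c‖ + R')) atTop (𝓝 0) := by
      simpa using tendsto_smoothParam.mul_const (r + ‖c‖ + R')
    filter_upwards [hlim.eventually_lt_const hη] with n hn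
    have hδ0 := smoothParam_pos n
    refine eLpNorm_sub_le_of_dist_bdd volume ENNReal.ofReal_ne_top
      Metric.isClosed_closedBall.measurableSet hε.le (fun x => ?_) (hsupp n) hsuppf
    by_cases hx : x ∈ Metric.closedBall (0 : E d) R'
    · rw [mem_closedBall_zero_iff] at hx
      have hR'0 : 0 ≤ R' := (norm_nonneg x).trans hx
      have h1 : dist (smoothing c r hr n f x) (f (shrink c n x)) ≤ ε / 2 := by
        refine ContDiffBump.dist_normed_convolution_le hf.aestronglyMeasurable fun y hy => ?_
        refine (hcont (lt_of_lt_of_le hy ?_)).le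
        change smoothParam n * r ≤ η
        nlinarith [norm_nonneg c]
      have h2 : dist (f (shrink c n x)) (f x) ≤ ε / 2 := by
        refine (hcont ?_).le
        rw [hdist]
        have := norm_sub_le c x
        nlinarith
      linarith [dist_triangle (smoothing c r hr n f x) (f (shrink c n x)) (f x)]
    · rw [Function.notMem_support.1 fun h => hx (hsupp n h),
        Function.notMem_support.1 fun h => hx (hsuppf h), dist_self]
      exact hε.le
  rw [ENNReal.tendsto_nhds_zero]
  intro ε hε
  have h1 : Tendsto (fun e : ℝ => ENNReal.ofReal e * V) (𝓝[>] 0) (𝓝 0) := by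
    have : Tendsto (fun e : ℝ => ENNReal.ofReal e * V) (𝓝 0) (𝓝 (ENNReal.ofReal 0 * V)) :=
      ENNReal.Tendsto.mul_const (ENNReal.tendsto_ofReal tendsto_id) (Or.inr hVtop)
    rw [ENNReal.ofReal_zero, zero_mul] at this
    exact this.mono_left nhdsWithin_le_nhds
  obtain ⟨e, he, he0⟩ := (((ENNReal.tendsto_nhds_zero.1 h1) ε hε).and self_mem_nhdsWithin).exists
  filter_upwards [key e he0] with n hn
  exact hn.trans he

omit [CompleteSpace F] in
theorem smoothing_sub (c : E d) {r : ℝ} (hr : 0 < r) (n : ℕ) {f g : E d → F}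
    (hf : LocallyIntegrable f) (hg : LocallyIntegrable g) :
    smoothing c r hr n (f - g) = smoothing c r hr n f - smoothing c r hr n g := by
  ext1 x
  have h := fun (f : E d → F) (hf : LocallyIntegrable f) =>
    ((smoothBump d r hr n).hasCompactSupport_normed (μ := volume)).convolutionExists_left
      (ContinuousLinearMap.lsmul ℝ ℝ) (smoothBump d r hr n).continuous_normed hf (shrink c n x)
  simp only [smoothing, mollify, convolution_def, Pi.sub_apply, map_sub]
  exact integral_sub (h f hf) (h g hg)

/-- The operators are bounded on `L^p` uniformly in `n` and converge on the dense set of compactly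
supported continuous functions. -/
theorem tendsto_smoothing {p : ℝ} (hp : 1 ≤ p) (c : E d) {r : ℝ} (hr : 0 < r) {f : E d → F}
    (hf : MemLp f (ENNReal.ofReal p) volume) :
    Tendsto (fun n => eLpNorm (smoothing c r hr n f - f) (ENNReal.ofReal p) volume)
      atTop (𝓝 0) := by
  have hP1 : 1 ≤ ENNReal.ofReal p := by simpa using hp
  set K : ENNReal := ENNReal.ofReal (2 ^ d) ^ (1 / p) with hK
  have hKtop : K ≠ ⊤ := ENNReal.rpow_ne_top_of_nonneg (by positivity) ENNReal.ofReal_ne_top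
  have key : ∀ e : ENNReal, e ≠ 0 → ∀ᶠ n in atTop,
      eLpNorm (smoothing c r hr n f - f) (ENNReal.ofReal p) volume ≤ K * e + e + e := by
    intro e he
    obtain ⟨g, hgs, hg, hgc, hgp⟩ := hf.exists_hasCompactSupport_eLpNorm_sub_le
      ENNReal.ofReal_ne_top he
    have hfl := hf.locallyIntegrable hP1
    have hgl := hgp.locallyIntegrable hP1
    have hmeas : ∀ (u : E d → F) (_ : LocallyIntegrable u) (n : ℕ),
        AEStronglyMeasurable (smoothing c r hr n u) volume := by
      intro u hu n
      have h1 : Continuous (mollify (smoothBump d r hr n) u) :=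
        ((smoothBump d r hr n).hasCompactSupport_normed (μ := volume)).continuous_convolution_left
          _ (smoothBump d r hr n).continuous_normed hu
      refine Continuous.aestronglyMeasurable (h1.comp ?_)
      unfold shrink
      fun_prop
    filter_upwards [(ENNReal.tendsto_nhds_zero.1
      (tendsto_smoothing_of_continuous hp c hr hgc hgs)) e (pos_iff_ne_zero.2 he)] with n hn
    have e1 : smoothing c r hr n f - f =
        (smoothing c r hr n (f - g) + (smoothing c r hr n g - g)) + (g - f) := by
      rw [smoothing_sub c hr n hfl hgl]
      abel
    have m1 : AEStronglyMeasurable (smoothing c r hr n (f - g)) volume :=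
      hmeas _ (hfl.sub hgl) n
    have m2 : AEStronglyMeasurable (smoothing c r hr n g - g) volume :=
      (hmeas g hgl n).sub hgc.aestronglyMeasurable
    rw [e1]
    refine (eLpNorm_add_le (m1.add m2) (hgc.aestronglyMeasurable.sub hf.1) hP1).trans ?_
    refine add_le_add ((eLpNorm_add_le m1 m2 hP1).trans (add_le_add ?_ hn)) ?_
    · exact (eLpNorm_smoothing_le hp c hr n (hf.1.sub hgc.aestronglyMeasurable)).trans
        (mul_le_mul_right hg _)
    · rw [eLpNorm_sub_comm]; exact hg
  rw [ENNReal.tendsto_nhds_zero]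
  intro ε hε
  have h1 : Tendsto (fun e : ENNReal => K * e + e + e) (𝓝[≠] 0) (𝓝 0) := by
    have : Tendsto (fun e : ENNReal => K * e + e + e) (𝓝 0) (𝓝 (K * 0 + 0 + 0)) :=
      ((ENNReal.Tendsto.const_mul tendsto_id (Or.inr hKtop)).add tendsto_id).add tendsto_id
    simp only [mul_zero, add_zero] at this
    exact this.mono_left nhdsWithin_le_nhds
  obtain ⟨e, he, he0⟩ := (((ENNReal.tendsto_nhds_zero.1 h1) ε hε).and self_mem_nhdsWithin).exists
  filter_upwards [key e he0] with n hn
  exact hn.trans he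

omit [CompleteSpace F] in
theorem contDiff_smoothing (c : E d) {r : ℝ} (hr : 0 < r) (n : ℕ) {f : E d → F}
    (hf : LocallyIntegrable f) : ContDiff ℝ ∞ (smoothing c r hr n f) := by
  have h1 : ContDiff ℝ ∞ (mollify (smoothBump d r hr n) f) :=
    ((smoothBump d r hr n).hasCompactSupport_normed (μ := volume)).contDiff_convolution_left
      _ (smoothBump d r hr n).contDiff_normed hf
  refine h1.comp ?_
  unfold shrink
  fun_prop

/-- The contraction moves a convex set containing `closedBall c r` into its interior. -/
theorem closedBall_shrink_subset {T : Set (E d)} (hT : Convex ℝ T) {c : E d} {r : ℝ}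
    (hc : Metric.closedBall c r ⊆ T) (n : ℕ) {x : E d} (hx : x ∈ interior T) :
    Metric.closedBall (shrink c n x) (smoothParam n * r) ⊆ interior T := by
  intro y hy
  have hδ0 := smoothParam_pos n
  have hδ := smoothParam_le n
  -- This writes `y` as a convex combination of the interior point `x` and a point of the ball
  -- around `c`.
  have hy' : c + (smoothParam n)⁻¹ • (y - shrink c n x) ∈ T := by
    apply hc
    rw [mem_closedBall_iff_norm, add_sub_cancel_left, norm_smul, norm_inv, Real.norm_eq_abs,
      abs_of_pos hδ0, inv_mul_le_iff₀ hδ0]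
    exact mem_closedBall_iff_norm.1 hy
  have h1 := hT.combo_interior_self_mem_interior hx hy'
    (a := 1 - smoothParam n) (b := smoothParam n) (by linarith) hδ0.le (by ring)
  convert h1 using 1
  rw [smul_add, smul_smul, mul_inv_cancel₀ hδ0.ne', one_smul, shrink]
  abel

/-! ### Smoothing of weakly differentiable functions -/

/-- A weak gradient commutes with mollification. -/
theorem fderiv_mollify {U : Set (E d)} (hU : IsOpen U) {v : E d → ℝ} {G : E d → E d}
    (h : HasWeakGrad U v G) (hv : LocallyIntegrable (U.indicator v))
    (hG : LocallyIntegrable (U.indicator G)) (φ : ContDiffBump (0 : E d)) {y : E d}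
    (hy : Metric.closedBall y φ.rOut ⊆ U) (w : E d) :
    HasFDerivAt (mollify φ (U.indicator v)) (fderiv ℝ (mollify φ (U.indicator v)) y) y ∧
    fderiv ℝ (mollify φ (U.indicator v)) y w = ⟪mollify φ (U.indicator G) y, w⟫ := by
  have h1 := (φ.hasCompactSupport_normed (μ := volume)).hasFDerivAt_convolution_left
    (ContinuousLinearMap.lsmul ℝ ℝ) φ.contDiff_normed hv y
  change HasFDerivAt (mollify φ (U.indicator v)) _ y at h1
  refine ⟨h1.differentiableAt.hasFDerivAt, ?_⟩
  rw [h1.fderiv]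
  -- The reflected bump is an admissible test function because the ball around `y` lies in `U`;
  -- differentiating in `t` instead of `y` produces the sign that cancels the one in the weak
  -- gradient.
  set ψ : E d → ℝ := fun t => φ.normed volume (y - t) with hψ
  have hψs : ContDiff ℝ ∞ ψ := φ.contDiff_normed.comp (by fun_prop)
  have hψt : tsupport ψ ⊆ Metric.closedBall y φ.rOut := by
    refine closure_minimal ?_ Metric.isClosed_closedBall
    intro t ht
    have : y - t ∈ Function.support (φ.normed volume) := ht
    rw [φ.support_normed_eq, mem_ball_zero_iff] at this
    rw [mem_closedBall_iff_norm, norm_sub_rev]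
    exact this.le
  have hψc : HasCompactSupport ψ :=
    (isCompact_closedBall y φ.rOut).of_isClosed_subset (isClosed_tsupport _) hψt
  have hdψ : ∀ t, fderiv ℝ ψ t w = -fderiv ℝ (φ.normed volume) (y - t) w := by
    intro t
    have e1 : HasFDerivAt (φ.normed volume) (fderiv ℝ (φ.normed volume) (y - t)) (y - t) :=
      ((φ.contDiff_normed (n := 1)).differentiable one_ne_zero _).hasFDerivAt
    have e2 : HasFDerivAt (fun t : E d => y - t) (-ContinuousLinearMap.id ℝ (E d)) t :=
      (hasFDerivAt_id t).const_sub y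
    have e3 : HasFDerivAt ψ _ t := e1.comp t e2
    rw [e3.fderiv]
    simp
  have hw := h.2.2 ψ hψs hψc (hψt.trans hy) w
  have hconv := (((φ.hasCompactSupport_normed (μ := volume)).fderiv ℝ).convolutionExists_left
      ((ContinuousLinearMap.lsmul ℝ ℝ).precompL (E d))
      ((φ.contDiff_normed (n := 1)).continuous_fderiv one_ne_zero) hv) y
  have hconvG := (φ.hasCompactSupport_normed (μ := volume)).convolutionExists_left
      (ContinuousLinearMap.lsmul ℝ ℝ) φ.continuous_normed hG y
  rw [convolution_def, ContinuousLinearMap.integral_apply hconv]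
  have l1 : ∫ t, (((ContinuousLinearMap.lsmul ℝ ℝ).precompL (E d))
      (fderiv ℝ (φ.normed volume) t) (U.indicator v (y - t))) w =
      ∫ t, fderiv ℝ (φ.normed volume) t w * U.indicator v (y - t) := rfl
  rw [l1, ← integral_sub_left_eq_self (fun t => fderiv ℝ (φ.normed volume) t w *
    U.indicator v (y - t)) volume y]
  have l2 : ∫ t, fderiv ℝ (φ.normed volume) (y - t) w * U.indicator v (y - (y - t)) =
      - ∫ x in U, v x * fderiv ℝ ψ x w := by
    rw [← integral_indicator hU.measurableSet, ← integral_neg]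
    refine integral_congr_ae (Eventually.of_forall fun t => ?_)
    by_cases ht : t ∈ U
    · simp [ht, hdψ, mul_comm]
    · simp [ht]
  rw [l2, hw, neg_neg, mollify, convolution_def, real_inner_comm, ← integral_inner hconvG w,
    ← integral_sub_left_eq_self (fun t => ⟪w, (ContinuousLinearMap.lsmul ℝ ℝ)
      (φ.normed volume t) (U.indicator G (y - t))⟫) volume y, ← integral_indicator hU.measurableSet]
  refine integral_congr_ae (Eventually.of_forall fun t => ?_)
  by_cases ht : t ∈ U
  · simp [ht, hψ, real_inner_smul_right, real_inner_comm, mul_comm]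
  · simp [ht]

/-- At an interior point the mollifier sees only the interior of `T`, so extending by zero does no
harm; the factor is the chain rule for the contraction. -/
theorem gradient_smoothing {T : Set (E d)} (hT : Convex ℝ T) {c : E d} {r : ℝ} (hr : 0 < r)
    (hc : Metric.closedBall c r ⊆ T) {v : E d → ℝ} {G : E d → E d}
    (h : HasWeakGrad (interior T) v G) (hv : LocallyIntegrable ((interior T).indicator v))
    (hG : LocallyIntegrable ((interior T).indicator G)) (n : ℕ) {x : E d} (hx : x ∈ interior T) :
    gradient (smoothing c r hr n ((interior T).indicator v)) x =
      (1 - smoothParam n) • smoothing c r hr n ((interior T).indicator G) x := by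
  have h1 := fderiv_mollify isOpen_interior h hv hG (smoothBump d r hr n)
    (y := shrink c n x) (closedBall_shrink_subset hT hc n hx)
  have h2 : HasFDerivAt (shrink c n) ((1 - smoothParam n) • ContinuousLinearMap.id ℝ (E d)) x :=
    ((hasFDerivAt_id x).const_smul (1 - smoothParam n)).add_const _
  have h3 := (h1 0).1.comp x h2
  refine ext_inner_right ℝ fun w => ?_
  rw [gradient, InnerProductSpace.toDual_symm_apply]
  change fderiv ℝ (mollify _ _ ∘ shrink c n) x w = _
  rw [h3.fderiv]
  simp only [ContinuousLinearMap.comp_apply, _root_.smul_apply, ContinuousLinearMap.id_apply,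
    map_smul, smul_eq_mul, (h1 w).2, real_inner_smul_left]
  rfl

/-- Weak gradients are unique almost everywhere. -/
theorem HasWeakGrad.ae_eq {U : Set (E d)} (hU : IsOpen U) {u : E d → ℝ} {G G' : E d → E d}
    (h : HasWeakGrad U u G) (h' : HasWeakGrad U u G') : G =ᵐ[volume.restrict U] G' := by
  have hli := h.2.1.sub h'.2.1
  -- The fundamental lemma of the calculus of variations for `G - G'`, whose vector integrals are
  -- tested against each direction `w`.
  have key := hU.ae_eq_zero_of_integral_contDiff_smul_eq_zero hli (fun g hg hgc hgs => ?_)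
  · rw [EventuallyEq, ae_restrict_iff' hU.measurableSet]
    filter_upwards [key] with x hx hxU
    exact sub_eq_zero.1 (hx hxU)
  have hint : ∀ H : E d → E d, LocallyIntegrableOn H U volume →
      Integrable (fun x => g x • H x) := by
    intro H hH
    have e1 : IntegrableOn H (tsupport g) := hH.integrableOn_compact_subset hgs hgc
    have e2 : IntegrableOn (fun x => g x • H x) (tsupport g) :=
      e1.continuousOn_smul hg.continuous.continuousOn hgc
    refine (integrableOn_iff_integrable_of_support_subset fun x hx => ?_).1 e2
    by_contra hx'
    exact hx (by simp [image_eq_zero_of_notMem_tsupport hx'])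
  refine ext_inner_right ℝ fun w => ?_
  have hU' : ∀ H : E d → E d, ∫ x in U, ⟪H x, w⟫ * g x = ∫ x, ⟪w, g x • H x⟫ := by
    intro H
    rw [setIntegral_eq_integral_of_forall_compl_eq_zero]
    · refine integral_congr_ae (Eventually.of_forall fun x => ?_)
      simp only [real_inner_smul_right, real_inner_comm, mul_comm]
    · intro x hx
      rw [image_eq_zero_of_notMem_tsupport fun h => hx (hgs h), mul_zero]
  have e1 := (h.2.2 g hg hgc hgs w).symm.trans (h'.2.2 g hg hgc hgs w)
  rw [neg_inj, hU', hU', integral_inner (hint _ h.2.1), integral_inner (hint _ h'.2.1)] at e1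
  simp only [Pi.sub_apply, smul_sub]
  rw [integral_sub (hint _ h.2.1) (hint _ h'.2.1), inner_sub_left, real_inner_comm, e1,
    real_inner_comm, sub_self, inner_zero_left]

theorem MemW1p.hasWeakGrad_weakGrad {p : ℝ} {U : Set (E d)} {u : E d → ℝ} (h : MemW1p p U u) :
    HasWeakGrad U u (weakGrad U u) := by
  obtain ⟨-, G, -, hG⟩ := h
  have hex : ∃ G, HasWeakGrad U u G := ⟨G, hG⟩
  rw [weakGrad, dif_pos hex]
  exact hex.choose_spec

/-- The gradient picked by choice agrees almost everywhere with the one known to be in `L^p`. -/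
theorem MemW1p.memLp_weakGrad {p : ℝ} {U : Set (E d)} (hU : IsOpen U) {u : E d → ℝ}
    (h : MemW1p p U u) : MemLp (weakGrad U u) (ENNReal.ofReal p) (volume.restrict U) := by
  obtain ⟨-, G, hGp, hG⟩ := id h
  exact hGp.ae_eq (hG.ae_eq hU h.hasWeakGrad_weakGrad)

/-- Functions that are smooth up to the boundary are dense in `W^{1,p}` of a convex body. -/
theorem MemW1p.exists_smooth_approx {p : ℝ} (hp : 1 ≤ p) {T : Set (E d)} (hT : Convex ℝ T)
    (hne : (interior T).Nonempty) {u : E d → ℝ} (h : MemW1p p (interior T) u) :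
    ∃ w : ℕ → E d → ℝ, (∀ n, ContDiff ℝ ∞ (w n)) ∧
      Tendsto (fun n => eLpNorm (fun x => w n x - u x) (ENNReal.ofReal p)
        (volume.restrict (interior T))) atTop (𝓝 0) ∧
      Tendsto (fun n => eLpNorm (fun x => gradient (w n) x - weakGrad (interior T) u x)
        (ENNReal.ofReal p) (volume.restrict (interior T))) atTop (𝓝 0) := by
  have hP1 : 1 ≤ ENNReal.ofReal p := by simpa using hp
  have hm : MeasurableSet (interior T) := isOpen_interior.measurableSet
  obtain ⟨c, hcT⟩ := hne
  obtain ⟨r, hr, hc⟩ := Metric.nhds_basis_closedBall.mem_iff.1 (mem_interior_iff_mem_nhds.1 hcT)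
  have hW := h.hasWeakGrad_weakGrad
  have hu := (memLp_indicator_iff_restrict hm).2 h.1
  have hG := (memLp_indicator_iff_restrict hm).2 (h.memLp_weakGrad isOpen_interior)
  set f := (interior T).indicator u with hf
  set H := (interior T).indicator (weakGrad (interior T) u) with hH
  refine ⟨fun n => smoothing c r hr n f,
    fun n => contDiff_smoothing c hr n (hu.locallyIntegrable hP1), ?_, ?_⟩
  · refine tendsto_of_tendsto_of_tendsto_of_le_of_le tendsto_const_nhds
      (tendsto_smoothing hp c hr hu) (fun n => bot_le) fun n => ?_
    refine le_trans (le_of_eq ?_) (eLpNorm_mono_measure _ (Measure.restrict_le_self (s := interior T)))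
    refine eLpNorm_congr_ae ((ae_restrict_iff' hm).2 (Eventually.of_forall fun x hx => ?_))
    simp [hf, hx]
  · set K : ENNReal := ENNReal.ofReal (2 ^ d) ^ (1 / p) with hK
    have hKtop : K ≠ ⊤ := ENNReal.rpow_ne_top_of_nonneg (by positivity) ENNReal.ofReal_ne_top
    -- Two errors: the smoothing of the gradient, and the deviation of the chain-rule factor `1 -
    -- smoothParam n` from one.
    have hlim : Tendsto (fun n => eLpNorm (smoothing c r hr n H - H) (ENNReal.ofReal p) volume +
        ENNReal.ofReal (smoothParam n) * (K * eLpNorm H (ENNReal.ofReal p) volume))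
        atTop (𝓝 0) := by
      have h1 : Tendsto (fun n => ENNReal.ofReal (smoothParam n)) atTop (𝓝 0) := by
        simpa using ENNReal.tendsto_ofReal tendsto_smoothParam
      have h2 := ENNReal.Tendsto.mul_const (b := K * eLpNorm H (ENNReal.ofReal p) volume) h1
        (Or.inr (ENNReal.mul_ne_top hKtop hG.eLpNorm_ne_top))
      simpa using (tendsto_smoothing hp c hr hG).add h2
    refine tendsto_of_tendsto_of_tendsto_of_le_of_le tendsto_const_nhds hlim
      (fun n => bot_le) fun n => ?_
    have hsm := (contDiff_smoothing c hr n (hG.locallyIntegrable hP1)).continuous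
      |>.aestronglyMeasurable (μ := volume)
    have e1 : eLpNorm (fun x => gradient (smoothing c r hr n f) x - weakGrad (interior T) u x)
        (ENNReal.ofReal p) (volume.restrict (interior T)) ≤
        eLpNorm ((smoothing c r hr n H - H) - smoothParam n • smoothing c r hr n H)
          (ENNReal.ofReal p) volume := by
      refine le_trans (le_of_eq ?_) (eLpNorm_mono_measure _ (Measure.restrict_le_self (s := interior T)))
      refine eLpNorm_congr_ae ((ae_restrict_iff' hm).2 (Eventually.of_forall fun x hx => ?_))
      simp only [Pi.sub_apply, Pi.smul_apply]
      rw [hf, gradient_smoothing hT hr hc hW (hu.locallyIntegrable hP1)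
        (hG.locallyIntegrable hP1) n hx, ← hH, hH, indicator_of_mem hx, ← hH]
      module
    refine e1.trans ((eLpNorm_sub_le (hsm.sub hG.1) (hsm.const_smul _) hP1).trans
      (add_le_add le_rfl ?_))
    rw [eLpNorm_const_smul, Real.enorm_of_nonneg (smoothParam_pos n).le]
    exact mul_le_mul_right (eLpNorm_smoothing_le hp c hr n hG.1) _

end DGFE

namespace DGFE

variable {d : ℕ}

/-! ### Trace inequalities and traces -/

namespace UnitRep

variable {T : Set (E d)} {s : Finset (E d × ℝ)}

theorem integrableOn_interior_of_continuous (h : UnitRep T s) {f : E d → ℝ} (hf : Continuous f) :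
    IntegrableOn f (interior T) :=
  (hf.continuousOn.integrableOn_compact h.isCompact).mono_set interior_subset

theorem volume_interior_lt_top (h : UnitRep T s) : volume (interior T) < ⊤ :=
  (measure_mono interior_subset).trans_lt h.isCompact.measure_lt_top

theorem memLp_interior_of_continuous (h : UnitRep T s) {F : Type*} [NormedAddCommGroup F]
    {f : E d → F} (hf : Continuous f) (P : ENNReal) : MemLp f P (volume.restrict (interior T)) := by
  obtain ⟨B, hB⟩ := h.isCompact.exists_bound_of_continuousOn hf.continuousOn
  have := Fact.mk h.volume_interior_lt_top
  exact MemLp.of_bound (hf.aestronglyMeasurable) B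
    ((ae_restrict_iff' isOpen_interior.measurableSet).2 (Eventually.of_forall fun x hx =>
      hB x (interior_subset hx)))

theorem memLp_frontier_of_continuous (h : UnitRep T s) {f : E d → ℝ} (hf : Continuous f)
    (P : ENNReal) : MemLp f P ((surf d).restrict (frontier T)) := by
  obtain ⟨B, hB⟩ := h.isCompact.exists_bound_of_continuousOn hf.continuousOn
  have := Fact.mk h.surf_frontier_lt_top
  exact MemLp.of_bound hf.aestronglyMeasurable B
    ((ae_restrict_iff' isClosed_frontier.measurableSet).2 (Eventually.of_forall fun x hx =>
      hB x (h.isClosed.frontier_subset hx)))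

/-- The point `c + ρ ν` belongs to the ball, so it satisfies the constraint that is active at `x`.
-/
theorem le_inner_outwardNormal (h : UnitRep T s) {c : E d} {ρ : ℝ} (hρ : 0 ≤ ρ)
    (hc : Metric.closedBall c ρ ⊆ T) :
    ∀ᵐ x ∂(surf d).restrict (frontier T), ρ ≤ ⟪outwardNormal T x, x - c⟫ := by
  filter_upwards [h.ae_frontier] with x hx
  obtain ⟨a, ha, hxa⟩ := hx
  rw [h.outwardNormal_eq ha hxa, inner_sub_right, hxa.1]
  have hna := h.norm a ha
  have h1 : c + ρ • a.1 ∈ T := hc (by simp [norm_smul, hna, abs_of_nonneg hρ])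
  rw [h.eq] at h1
  have := h1 a ha
  rw [inner_add_right, real_inner_smul_right, real_inner_self_eq_norm_sq, hna] at this
  linarith

/-- The divergence theorem for the field `f(x) (x - c)`, whose normal component is at least `ρ f`.
With `f = 1` it bounds the surface area; with `f = |w|^p` it gives the trace inequality. -/
theorem mul_integral_frontier_le (h : UnitRep T s) {c : E d} {ρ : ℝ} (hρ : 0 ≤ ρ)
    (hc : Metric.closedBall c ρ ⊆ T) {f : E d → ℝ} (hf : ContDiff ℝ 1 f) (hf0 : ∀ x, 0 ≤ f x) :
    ρ * ∫ x in frontier T, f x ∂surf d ≤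
      ∫ x in interior T, (d * f x + fderiv ℝ f x (x - c)) := by
  have hb : ∀ l : Fin d, ContDiff ℝ 1 fun x : E d => f x * (x l - c l) := fun l =>
    hf.mul ((contDiff_piLp_apply (p := 2) (i := l)).sub contDiff_const)
  have hd : ∀ x (l : Fin d), fderiv ℝ (fun x : E d => f x * (x l - c l)) x
      (EuclideanSpace.single l 1) =
      f x + fderiv ℝ f x ((x l - c l) • EuclideanSpace.single l 1) := by
    intro x l
    have e1 : HasFDerivAt (fun x : E d => x l - c l) (EuclideanSpace.proj l : E d →L[ℝ] ℝ) x :=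
      (EuclideanSpace.proj (𝕜 := ℝ) l : E d →L[ℝ] ℝ).hasFDerivAt.sub_const _
    have e2 : HasFDerivAt (fun x : E d => f x * (x l - c l)) _ x :=
      (hf.differentiable one_ne_zero x).hasFDerivAt.mul e1
    rw [e2.fderiv]
    simp
  have hsum : ∀ x, ∑ l, fderiv ℝ (fun x : E d => f x * (x l - c l)) x (EuclideanSpace.single l 1) =
      d * f x + fderiv ℝ f x (x - c) := by
    intro x
    simp only [hd]
    rw [Finset.sum_add_distrib, ← map_sum]
    simp only [Finset.sum_const, Finset.card_univ, Fintype.card_fin, nsmul_eq_mul]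
    congr 2
    ext m
    simp [Finset.sum_apply, Pi.single_apply]
  have hcont : ∀ l, Continuous fun x => fderiv ℝ (fun x : E d => f x * (x l - c l)) x
      (EuclideanSpace.single l 1) := fun l =>
    ((hb l).continuous_fderiv one_ne_zero).clm_apply continuous_const
  simp only [← hsum]
  rw [integral_finsetSum _ fun l _ => h.integrableOn_interior_of_continuous (hcont l)]
  simp only [h.integral_fderiv (hb _)]
  rw [← integral_finsetSum _ fun l _ => h.integrableOn_frontier_mul_normal
    (h.integrableOn_frontier_of_continuous (hb l).continuous) _, ← integral_const_mul]
  refine integral_mono_ae ((h.integrableOn_frontier_of_continuous hf.continuous).const_mul ρ)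
    (integrable_finsetSum _ fun l _ => h.integrableOn_frontier_mul_normal
      (h.integrableOn_frontier_of_continuous (hb l).continuous) _) ?_
  filter_upwards [h.le_inner_outwardNormal hρ hc] with x hx
  have : ∑ l, f x * (x l - c l) * ⟪outwardNormal T x, EuclideanSpace.single l 1⟫ =
      f x * ⟪outwardNormal T x, x - c⟫ := by
    simp only [PiLp.inner_apply, RCLike.inner_apply, conj_trivial, PiLp.sub_apply, Finset.mul_sum]
    refine Finset.sum_congr rfl fun l _ => ?_
    simp [mul_assoc]
  rw [this, mul_comm]
  exact mul_le_mul_of_nonneg_left hx (hf0 x)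

/-- Surface area is controlled by volume over inradius. -/
theorem mul_surf_frontier_le (h : UnitRep T s) {c : E d} {ρ : ℝ} (hρ : 0 ≤ ρ)
    (hc : Metric.closedBall c ρ ⊆ T) :
    ρ * (surf d).real (frontier T) ≤ d * volume.real (interior T) := by
  have := h.mul_integral_frontier_le hρ hc (f := fun _ => 1) contDiff_const fun _ => zero_le_one
  simpa [mul_comm] using this

theorem exists_integral_frontier_rpow_le (h : UnitRep T s) {p : ℝ} (hp : 1 < p) :
    ∃ C, 0 ≤ C ∧ ∀ w : E d → ℝ, ContDiff ℝ 1 w →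
      ∫ x in frontier T, ‖w x‖ ^ p ∂surf d ≤
        C * ((∫ x in interior T, ‖w x‖ ^ p) + ∫ x in interior T, ‖gradient w x‖ ^ p) := by
  obtain ⟨c, hcT⟩ := h.nonempty
  obtain ⟨ρ, hρ, hc⟩ := Metric.nhds_basis_closedBall.mem_iff.1 (mem_interior_iff_mem_nhds.1 hcT)
  obtain ⟨R, hR⟩ := h.bounded.exists_norm_le
  have hD : ∀ x ∈ interior T, ‖x - c‖ ≤ R + ‖c‖ := fun x hx =>
    (norm_sub_le x c).trans (by linarith [hR x (interior_subset hx)])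
  have hD0 : 0 ≤ R + ‖c‖ := (norm_nonneg _).trans (hD c hcT)
  set D := R + ‖c‖
  refine ⟨(d + p * D) / ρ, by positivity, fun w hw => ?_⟩
  have h1 := h.mul_integral_frontier_le hρ.le hc (hw.norm_rpow hp) fun x => by positivity
  have hgrad : ∀ x, ‖gradient w x‖ = ‖fderiv ℝ w x‖ := fun x => by simp [gradient]
  have hgc : Continuous fun x => ‖gradient w x‖ ^ p := by
    simp only [hgrad]
    exact (hw.continuous_fderiv one_ne_zero).norm.rpow_const fun _ => Or.inr (by linarith)
  have hwc : Continuous fun x => ‖w x‖ ^ p :=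
    hw.continuous.norm.rpow_const fun _ => Or.inr (by linarith)
  have hi1 := h.integrableOn_interior_of_continuous hwc
  have hi2 := h.integrableOn_interior_of_continuous hgc
  rw [div_mul_eq_mul_div, le_div_iff₀ hρ, mul_comm _ ρ]
  refine h1.trans ?_
  rw [← integral_add hi1 hi2, ← integral_const_mul]
  refine setIntegral_mono_on (h.integrableOn_interior_of_continuous ?_)
    ((hi1.add hi2).const_mul _) isOpen_interior.measurableSet fun x hx => ?_
  · exact (continuous_const.mul hwc).add (((hw.norm_rpow hp).continuous_fderiv
      one_ne_zero).clm_apply (continuous_id.sub continuous_const))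
  · have e1 : fderiv ℝ (fun x => ‖w x‖ ^ p) x (x - c) ≤
        p * ‖w x‖ ^ (p - 1) * ‖gradient w x‖ * D := by
      rw [hgrad]
      refine (le_abs_self _).trans (((fderiv ℝ (fun x => ‖w x‖ ^ p) x).le_opNorm _).trans ?_)
      exact mul_le_mul (norm_fderiv_norm_rpow_le (hw.differentiable one_ne_zero) hp) (hD x hx)
        (norm_nonneg _) (by positivity)
    -- A crude form of Young's inequality: replace the smaller of the two numbers by the larger.
    have e2 : ‖w x‖ ^ (p - 1) * ‖gradient w x‖ ≤ ‖w x‖ ^ p + ‖gradient w x‖ ^ p := by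
      have hm : ∀ a : ℝ, 0 ≤ a → a ^ (p - 1) * a = a ^ p := fun a ha => by
        conv_lhs => rw [← Real.rpow_add_one' ha (by linarith)]
        rw [sub_add_cancel]
      rcases le_total ‖w x‖ ‖gradient w x‖ with hle | hle
      · have : ‖w x‖ ^ (p - 1) ≤ ‖gradient w x‖ ^ (p - 1) :=
          Real.rpow_le_rpow (norm_nonneg _) hle (by linarith)
        have e3 := mul_le_mul_of_nonneg_right this (norm_nonneg (gradient w x))
        rw [hm _ (norm_nonneg _)] at e3
        linarith [Real.rpow_nonneg (norm_nonneg (w x)) p]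
      · have e3 := mul_le_mul_of_nonneg_left hle (Real.rpow_nonneg (norm_nonneg (w x)) (p - 1))
        rw [hm _ (norm_nonneg _)] at e3
        linarith [Real.rpow_nonneg (norm_nonneg (gradient w x)) p]
    have e4 : 0 ≤ (d : ℝ) * ‖gradient w x‖ ^ p := by positivity
    have e5 := mul_le_mul_of_nonneg_left e2 (by positivity : 0 ≤ p * D)
    have e6 : p * ‖w x‖ ^ (p - 1) * ‖gradient w x‖ * D =
      p * D * (‖w x‖ ^ (p - 1) * ‖gradient w x‖) := by ring
    linarith

/-- The trace inequality for functions that are smooth up to the boundary. -/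
theorem exists_eLpNorm_frontier_le (h : UnitRep T s) {p : ℝ} (hp : 1 < p) :
    ∃ C : ENNReal, C ≠ ⊤ ∧ ∀ w : E d → ℝ, ContDiff ℝ 1 w →
      eLpNorm w (ENNReal.ofReal p) ((surf d).restrict (frontier T)) ≤
        C * (eLpNorm w (ENNReal.ofReal p) (volume.restrict (interior T)) +
          eLpNorm (gradient w) (ENNReal.ofReal p) (volume.restrict (interior T))) := by
  obtain ⟨C, hC0, hC⟩ := h.exists_integral_frontier_rpow_le hp
  have hp0 : 0 < p := one_pos.trans hp
  have hP0 : ENNReal.ofReal p ≠ 0 := by simpa using hp0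
  refine ⟨ENNReal.ofReal (C ^ p⁻¹), ENNReal.ofReal_ne_top, fun w hw => ?_⟩
  have hgc : Continuous (gradient w) :=
    (InnerProductSpace.toDual ℝ (E d)).symm.continuous.comp (hw.continuous_fderiv one_ne_zero)
  rw [(h.memLp_frontier_of_continuous hw.continuous _).eLpNorm_eq_integral_rpow_norm hP0
      ENNReal.ofReal_ne_top,
    (h.memLp_interior_of_continuous hw.continuous _).eLpNorm_eq_integral_rpow_norm hP0
      ENNReal.ofReal_ne_top,
    (h.memLp_interior_of_continuous hgc _).eLpNorm_eq_integral_rpow_norm hP0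
      ENNReal.ofReal_ne_top, ENNReal.toReal_ofReal hp0.le]
  set A := ∫ x in interior T, ‖w x‖ ^ p
  set B := ∫ x in interior T, ‖gradient w x‖ ^ p
  have hA : 0 ≤ A := integral_nonneg fun x => by positivity
  have hB : 0 ≤ B := integral_nonneg fun x => by positivity
  rw [← ENNReal.ofReal_add (by positivity) (by positivity), ← ENNReal.ofReal_mul (by positivity)]
  refine ENNReal.ofReal_le_ofReal ?_
  have h0 : 0 ≤ ∫ x in frontier T, ‖w x‖ ^ p ∂surf d := integral_nonneg fun x => by positivity
  refine (Real.rpow_le_rpow h0 (hC w hw) (by positivity)).trans ?_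
  rw [Real.mul_rpow hC0 (by positivity)]
  refine mul_le_mul_of_nonneg_left ?_ (by positivity)
  exact Real.rpow_add_le_add_rpow hA hB (by positivity) (inv_le_one_of_one_le₀ hp.le)

/-- By the trace inequality, the boundary values of smooth approximations converging in `W^{1,p}`
form a Cauchy sequence in `L^p(∂T)`. -/
theorem exists_isTrace (h : UnitRep T s) {p : ℝ} (hp : 1 < p) {u : E d → ℝ}
    (hu : MemW1p p (interior T) u) : ∃ τ, IsTrace p T u τ := by
  obtain ⟨w, hw, h1, h2⟩ := hu.exists_smooth_approx hp.le h.convex h.nonempty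
  obtain ⟨C, hC, hCw⟩ := h.exists_eLpNorm_frontier_le hp
  set P := ENNReal.ofReal p
  have hP1 : 1 ≤ P := by simpa [P] using hp.le
  have : Fact (1 ≤ P) := ⟨hP1⟩
  have hw1 : ∀ n, ContDiff ℝ 1 (w n) := fun n => (hw n).of_le (by exact_mod_cast le_top)
  have hgc : ∀ n, Continuous (gradient (w n)) := fun n =>
    (InnerProductSpace.toDual ℝ (E d)).symm.continuous.comp ((hw1 n).continuous_fderiv one_ne_zero)
  have hmem : ∀ n, MemLp (w n) P ((surf d).restrict (frontier T)) := fun n =>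
    h.memLp_frontier_of_continuous (hw n).continuous _
  set b : ℕ → ENNReal := fun n => C *
    (eLpNorm (fun x => w n x - u x) P (volume.restrict (interior T)) +
      eLpNorm (fun x => gradient (w n) x - weakGrad (interior T) u x) P
        (volume.restrict (interior T))) with hb
  have hb0 : Tendsto b atTop (𝓝 0) := by
    have := ENNReal.Tendsto.const_mul (h1.add h2) (Or.inr hC)
    simpa using this
  have hG := hu.memLp_weakGrad isOpen_interior
  have hle : ∀ n m, eLpNorm (w n - w m) P ((surf d).restrict (frontier T)) ≤ b n + b m := by
    intro n m
    refine (hCw _ ((hw1 n).sub (hw1 m))).trans ?_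
    have hg : gradient (w n - w m) = gradient (w n) - gradient (w m) := by
      ext1 x
      simp only [gradient, Pi.sub_apply]
      rw [fderiv_sub ((hw1 n).differentiable one_ne_zero x)
        ((hw1 m).differentiable one_ne_zero x), map_sub]
    have e1 : eLpNorm (w n - w m) P (volume.restrict (interior T)) ≤
        eLpNorm (fun x => w n x - u x) P (volume.restrict (interior T)) +
        eLpNorm (fun x => w m x - u x) P (volume.restrict (interior T)) := by
      have : w n - w m = (fun x => w n x - u x) - (fun x => w m x - u x) := by
        ext x; simp
      rw [this]
      exact eLpNorm_sub_le ((hw n).continuous.aestronglyMeasurable.sub hu.1.1)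
        ((hw m).continuous.aestronglyMeasurable.sub hu.1.1) hP1
    have e2 : eLpNorm (gradient (w n - w m)) P (volume.restrict (interior T)) ≤
        eLpNorm (fun x => gradient (w n) x - weakGrad (interior T) u x) P
          (volume.restrict (interior T)) +
        eLpNorm (fun x => gradient (w m) x - weakGrad (interior T) u x) P
          (volume.restrict (interior T)) := by
      have : gradient (w n) - gradient (w m) =
          (fun x => gradient (w n) x - weakGrad (interior T) u x) -
          (fun x => gradient (w m) x - weakGrad (interior T) u x) := by
        ext1 x; simp
      rw [hg, this]
      exact eLpNorm_sub_le ((hgc n).aestronglyMeasurable.sub hG.1)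
        ((hgc m).aestronglyMeasurable.sub hG.1) hP1
    refine (mul_le_mul_right (add_le_add e1 e2) C).trans (le_of_eq ?_)
    simp only [hb]
    ring
  have hcau : CauchySeq fun n => (hmem n).toLp (w n) := by
    rw [EMetric.cauchySeq_iff']
    intro ε hε
    obtain ⟨N, hN⟩ := eventually_atTop.1 (hb0.eventually_lt_const (ENNReal.half_pos hε.ne'))
    refine ⟨N, fun n hn => ?_⟩
    rw [Lp.edist_toLp_toLp]
    refine (hle n N).trans_lt ?_
    rw [← ENNReal.add_halves ε]
    exact ENNReal.add_lt_add (hN n hn) (hN N le_rfl)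
  obtain ⟨τ, hτ⟩ := cauchySeq_tendsto_of_complete hcau
  refine ⟨τ, Lp.memLp τ, w, hw, h1, h2, ?_⟩
  rw [tendsto_iff_edist_tendsto_0] at hτ
  refine hτ.congr fun n => ?_
  rw [Lp.edist_def]
  refine eLpNorm_congr_ae ?_
  filter_upwards [(hmem n).coeFn_toLp] with x hx
  rw [Pi.sub_apply, hx]

theorem isTrace_trace (h : UnitRep T s) {p : ℝ} (hp : 1 < p) {u : E d → ℝ}
    (hu : MemW1p p (interior T) u) : IsTrace p T u (trace p T u) := by
  have hex := h.exists_isTrace hp hu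
  rw [trace, dif_pos hex]
  exact hex.choose_spec

end UnitRep

/-- On a finite measure space `L^p` convergence implies `L¹` convergence, and this survives
multiplication by a bounded function. It passes the integration by parts formula from smooth
functions to Sobolev functions. -/
theorem tendsto_integral_mul_of_Lp {α : Type*} [MeasurableSpace α] {μ : Measure α}
    [IsFiniteMeasure μ] {P : ENNReal} (hP : 1 ≤ P) {f : α → ℝ} {F : ℕ → α → ℝ} (hf : MemLp f P μ)
    (hF : ∀ n, MemLp (F n) P μ)
    (hlim : Tendsto (fun n => eLpNorm (fun x => F n x - f x) P μ) atTop (𝓝 0))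
    {b : α → ℝ} (hb : AEStronglyMeasurable b μ) {B : ℝ} (hB : ∀ᵐ x ∂μ, ‖b x‖ ≤ B) :
    Tendsto (fun n => ∫ x, F n x * b x ∂μ) atTop (𝓝 (∫ x, f x * b x ∂μ)) := by
  have hint : ∀ g : α → ℝ, MemLp g P μ → Integrable (fun x => g x * b x) μ := fun g hg =>
    (hg.integrable hP).mul_bdd hb hB
  refine tendsto_integral_of_L1' _ (hint f hf).aestronglyMeasurable
    (Eventually.of_forall fun n => hint _ (hF n)) ?_
  set K : ENNReal := μ univ ^ (1 / (1 : ENNReal).toReal - 1 / P.toReal) with hK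
  have hKtop : K ≠ ⊤ := by
    refine ENNReal.rpow_ne_top_of_nonneg ?_ (measure_ne_top _ _)
    rw [ENNReal.toReal_one, sub_nonneg, one_div_one, one_div]
    by_cases hPt : P = ⊤
    · simp [hPt]
    · refine inv_le_one_of_one_le₀ ?_
      rw [← ENNReal.toReal_one]
      exact (ENNReal.toReal_le_toReal ENNReal.one_ne_top hPt).2 hP
  have h2 : Tendsto (fun n => ENNReal.ofReal B * (eLpNorm (fun x => F n x - f x) P μ * K))
      atTop (𝓝 0) := by
    have := ENNReal.Tendsto.const_mul (a := ENNReal.ofReal B)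
      (ENNReal.Tendsto.mul_const hlim (Or.inr hKtop)) (Or.inr ENNReal.ofReal_ne_top)
    simpa using this
  refine tendsto_of_tendsto_of_tendsto_of_le_of_le tendsto_const_nhds h2
    (fun n => bot_le) fun n => ?_
  have e1 : eLpNorm (fun x => F n x * b x - f x * b x) 1 μ ≤
      ENNReal.ofReal B * eLpNorm (fun x => F n x - f x) 1 μ := by
    refine eLpNorm_le_mul_eLpNorm_of_ae_le_mul ?_ _
    filter_upwards [hB] with x hx
    rw [← sub_mul, norm_mul, mul_comm]
    exact mul_le_mul_of_nonneg_right hx (norm_nonneg _)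
  exact e1.trans (mul_le_mul_right (eLpNorm_le_eLpNorm_mul_rpow_measure_univ hP
    ((hF n).1.sub hf.1)) _)

/-- Integration by parts on a polytope for Sobolev functions. -/
theorem UnitRep.integral_mul_fderiv {T : Set (E d)} {s : Finset (E d × ℝ)} (h : UnitRep T s) {p : ℝ}
    (hp : 1 < p) {u : E d → ℝ} (hu : MemW1p p (interior T) u) {φ : E d → ℝ} (hφ : ContDiff ℝ 1 φ)
    (w : E d) :
    ∫ x in interior T, u x * fderiv ℝ φ x w =
      (∫ x in frontier T, trace p T u x * (⟪outwardNormal T x, w⟫ * φ x) ∂surf d) -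
        ∫ x in interior T, ⟪weakGrad (interior T) u x, w⟫ * φ x := by
  obtain ⟨hτ, W, hW, h1, h2, h3⟩ := h.isTrace_trace hp hu
  have hP1 : 1 ≤ ENNReal.ofReal p := by simpa using hp.le
  have : IsFiniteMeasure (volume.restrict (interior T)) :=
    isFiniteMeasure_restrict.2 h.volume_interior_lt_top.ne
  have : IsFiniteMeasure ((surf d).restrict (frontier T)) :=
    isFiniteMeasure_restrict.2 h.surf_frontier_lt_top.ne
  have hW1 : ∀ n, ContDiff ℝ 1 (W n) := fun n => (hW n).of_le (by exact_mod_cast le_top)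
  have hgc : ∀ n, Continuous (gradient (W n)) := fun n =>
    (InnerProductSpace.toDual ℝ (E d)).symm.continuous.comp ((hW1 n).continuous_fderiv one_ne_zero)
  have hG := hu.memLp_weakGrad isOpen_interior
  have hdφ : Continuous fun x => fderiv ℝ φ x w :=
    (hφ.continuous_fderiv one_ne_zero).clm_apply continuous_const
  obtain ⟨B1, hB1⟩ := h.isCompact.exists_bound_of_continuousOn hdφ.continuousOn
  obtain ⟨B2, hB2⟩ := h.isCompact.exists_bound_of_continuousOn hφ.continuous.continuousOn
  have l1 := tendsto_integral_mul_of_Lp hP1 hu.1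
    (fun n => h.memLp_interior_of_continuous (hW n).continuous _) h1
    hdφ.aestronglyMeasurable (B := B1) ((ae_restrict_iff' isOpen_interior.measurableSet).2
      (Eventually.of_forall fun x hx => hB1 x (interior_subset hx)))
  have l2 := tendsto_integral_mul_of_Lp hP1 hτ
    (fun n => h.memLp_frontier_of_continuous (hW n).continuous _) h3
    (b := fun x => ⟪outwardNormal T x, w⟫ * φ x) (B := ‖w‖ * B2)
    ((h.aestronglyMeasurable_outwardNormal.inner aestronglyMeasurable_const).mul
      hφ.continuous.aestronglyMeasurable) (by
      filter_upwards [h.ae_norm_outwardNormal, ae_restrict_mem isClosed_frontier.measurableSet]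
        with x hx hxT
      rw [norm_mul]
      refine mul_le_mul ((norm_inner_le_norm _ _).trans ?_)
        (hB2 x (h.isClosed.frontier_subset hxT)) (norm_nonneg _) (norm_nonneg _)
      rw [hx, one_mul])
  have l3 := tendsto_integral_mul_of_Lp hP1 (hG.inner_const w)
    (F := fun n x => ⟪gradient (W n) x, w⟫)
    (fun n => (h.memLp_interior_of_continuous (hgc n) _).inner_const w) (by
      have : Tendsto (fun n => ENNReal.ofReal ‖w‖ *
          eLpNorm (fun x => gradient (W n) x - weakGrad (interior T) u x) (ENNReal.ofReal p)
            (volume.restrict (interior T))) atTop (𝓝 0) := by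
        have h4 := ENNReal.Tendsto.const_mul (a := ENNReal.ofReal ‖w‖) h2
          (Or.inr ENNReal.ofReal_ne_top)
        rwa [mul_zero] at h4
      refine tendsto_of_tendsto_of_tendsto_of_le_of_le tendsto_const_nhds this
        (fun n => bot_le) fun n => ?_
      refine eLpNorm_le_mul_eLpNorm_of_ae_le_mul (Eventually.of_forall fun x => ?_) _
      rw [← inner_sub_left, mul_comm]
      exact norm_inner_le_norm _ _)
    hφ.continuous.aestronglyMeasurable (B := B2) ((ae_restrict_iff' isOpen_interior.measurableSet).2
      (Eventually.of_forall fun x hx => hB2 x (interior_subset hx)))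
  refine tendsto_nhds_unique l1 ((l2.sub l3).congr fun n => ?_)
  have hprod := h.integral_fderiv ((hW1 n).mul hφ) w
  have hg : ∀ x, ⟪gradient (W n) x, w⟫ = fderiv ℝ (W n) x w := fun x => by
    rw [gradient, InnerProductSpace.toDual_symm_apply]
  have e1 : ∀ x, fderiv ℝ (fun x => W n x * φ x) x w =
      W n x * fderiv ℝ φ x w + ⟪gradient (W n) x, w⟫ * φ x := by
    intro x
    have e2 : HasFDerivAt (fun x => W n x * φ x) _ x :=
      ((hW1 n).differentiable one_ne_zero x).hasFDerivAt.mul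
        (hφ.differentiable one_ne_zero x).hasFDerivAt
    rw [e2.fderiv, hg]
    simp [mul_comm]
  simp only [e1] at hprod
  have hi1 : IntegrableOn (fun x => W n x * fderiv ℝ φ x w) (interior T) :=
    h.integrableOn_interior_of_continuous ((hW n).continuous.mul hdφ)
  have hi2 : IntegrableOn (fun x => ⟪gradient (W n) x, w⟫ * φ x) (interior T) :=
    h.integrableOn_interior_of_continuous (((hgc n).inner continuous_const).mul hφ.continuous)
  rw [integral_add hi1 hi2] at hprod
  have e2 : ∫ x in frontier T, W n x * φ x * ⟪outwardNormal T x, w⟫ ∂surf d =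
      ∫ x in frontier T, W n x * (⟪outwardNormal T x, w⟫ * φ x) ∂surf d :=
    integral_congr_ae (Eventually.of_forall fun x => by ring)
  linarith

end DGFE

namespace DGFE

variable {d : ℕ}

/-! ### Meshes -/

/-- Near the boundary point `x`, the set `T` is the half-space with outward unit normal `ν`. -/
def IsFlatAt (T : Set (E d)) (x ν : E d) : Prop :=
  ‖ν‖ = 1 ∧ ∀ᶠ y in 𝓝 x, (y ∈ T ↔ ⟪ν, y - x⟫ ≤ 0)

theorem UnitRep.ae_isFlatAt {T : Set (E d)} {s : Finset (E d × ℝ)} (h : UnitRep T s) :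
    ∀ᵐ x ∂surf d, x ∈ frontier T → ∃ ν, IsFlatAt T x ν := by
  filter_upwards [(ae_restrict_iff' isClosed_frontier.measurableSet).1 h.ae_frontier] with x hx hxT
  obtain ⟨a, ha, hxa⟩ := hx hxT
  exact ⟨a.1, h.norm a ha, h.eventually_mem_iff ha hxa⟩

theorem IsFlatAt.eventually_interior {T : Set (E d)} {x ν : E d} (h : IsFlatAt T x ν) :
    ∀ᶠ y in 𝓝 x, ⟪ν, y - x⟫ < 0 → y ∈ interior T := by
  filter_upwards [h.2.eventually_nhds] with y hy hlt
  rw [mem_interior_iff_mem_nhds]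
  have h1 : ∀ᶠ z in 𝓝 y, ⟪ν, z - x⟫ < 0 :=
    (isOpen_lt (by fun_prop : Continuous fun z : E d => ⟪ν, z - x⟫) continuous_const).mem_nhds hlt
  filter_upwards [hy, h1] with z hz hz1
  exact hz.2 hz1.le

/-- A direction pointing strictly into both half-spaces would lead from `x` into both interiors. So
`ν'` is nonnegative on the open half-space of `ν`, by continuity on the closed one, and a half-space
determines its unit normal. -/
theorem IsFlatAt.eq_neg {T T' : Set (E d)} {x ν ν' : E d} (h : IsFlatAt T x ν)
    (h' : IsFlatAt T' x ν') (hd : Disjoint (interior T) (interior T')) : ν' = -ν := by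
  have key : ∀ w, ⟪ν, w⟫ < 0 → 0 ≤ ⟪ν', w⟫ := by
    intro w hw
    by_contra! hw'
    have h0 : Tendsto (fun t : ℝ => x + t • w) (𝓝[>] 0) (𝓝 x) := by
      have : Tendsto (fun t : ℝ => x + t • w) (𝓝 0) (𝓝 (x + (0 : ℝ) • w)) :=
        Continuous.tendsto (by fun_prop) _
      rw [zero_smul, add_zero] at this
      exact this.mono_left nhdsWithin_le_nhds
    obtain ⟨t, ⟨h1, h2⟩, ht⟩ := ((h0.eventually (h.eventually_interior.and
      h'.eventually_interior)).and self_mem_nhdsWithin).exists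
    simp only [add_sub_cancel_left, real_inner_smul_right] at h1 h2
    exact Set.disjoint_left.1 hd (h1 (mul_neg_of_pos_of_neg ht hw))
      (h2 (mul_neg_of_pos_of_neg ht hw'))
  have h1 : -ν' = ν := by
    refine eq_of_halfSpace_le h.1 (by rw [norm_neg, h'.1]) fun w hw => ?_
    rw [inner_neg_left, neg_nonpos]
    have h0 : Tendsto (fun t : ℝ => ⟪ν', w - t • ν⟫) (𝓝[>] 0) (𝓝 ⟪ν', w⟫) := by
      have : Tendsto (fun t : ℝ => ⟪ν', w - t • ν⟫) (𝓝 0) (𝓝 ⟪ν', w - (0 : ℝ) • ν⟫) :=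
        Continuous.tendsto (by fun_prop) _
      rw [zero_smul, sub_zero] at this
      exact this.mono_left nhdsWithin_le_nhds
    refine ge_of_tendsto h0 ?_
    filter_upwards [self_mem_nhdsWithin] with t ht
    apply key
    rw [inner_sub_right, real_inner_smul_right, real_inner_self_eq_norm_sq, h.1]
    have : (0 : ℝ) < t := ht
    linarith
  rw [← h1, neg_neg]

namespace Mesh

variable {Ω : Set (E d)} (M : Mesh Ω)

theorem exists_unitRep (i : Fin M.N) : ∃ s, UnitRep (M.T i) s := (M.polytope i).exists_unitRep

theorem isClosed_T (i : Fin M.N) : IsClosed (M.T i) := (M.exists_unitRep i).choose_spec.isClosed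

theorem convex_T (i : Fin M.N) : Convex ℝ (M.T i) := (M.exists_unitRep i).choose_spec.convex

theorem closure_interior_T (i : Fin M.N) : closure (interior (M.T i)) = M.T i := by
  rw [(M.convex_T i).closure_interior_eq_closure_of_nonempty_interior (M.polytope i).2.2,
    (M.isClosed_T i).closure_eq]

theorem frontier_subset_T (i : Fin M.N) : frontier (M.T i) ⊆ M.T i :=
  (M.isClosed_T i).frontier_subset

variable {M}

/-- An element is the closure of its interior, so an open set that misses the interior misses the
element. -/
theorem disjoint_interior_T {i j : Fin M.N} (hij : i ≠ j) : Disjoint (interior (M.T i)) (M.T j) := by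
  rw [← M.closure_interior_T j]
  exact (M.disjoint i j hij).closure_right isOpen_interior

theorem mem_frontier_of_mem {i j : Fin M.N} (hij : i ≠ j) {x : E d} (hi : x ∈ M.T i)
    (hj : x ∈ M.T j) : x ∈ frontier (M.T j) := by
  rw [(M.isClosed_T j).frontier_eq]
  exact ⟨hj, fun h => Set.disjoint_left.1 (disjoint_interior_T hij.symm) h hi⟩

theorem T_subset_closure (i : Fin M.N) : M.T i ⊆ closure Ω := M.cover ▸ subset_iUnion M.T i

theorem outwardNormal_eq_of_isFlatAt {i : Fin M.N} {x ν : E d} (h : IsFlatAt (M.T i) x ν) :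
    outwardNormal (M.T i) x = ν := outwardNormal_eq (M.convex_T i) h.1 h.2

theorem eventually_mem_union {i j : Fin M.N} (hij : i ≠ j) {x ν ν' : E d}
    (h : IsFlatAt (M.T i) x ν) (h' : IsFlatAt (M.T j) x ν') :
    ∀ᶠ y in 𝓝 x, y ∈ M.T i ∨ y ∈ M.T j := by
  have hν := h.eq_neg h' (M.disjoint i j hij)
  filter_upwards [h.2, h'.2] with y hy hy'
  rw [hy, hy', hν, inner_neg_left, neg_nonpos]
  exact le_total _ _

/-- Two opposite half-spaces fill a neighbourhood of `x`, which therefore lies in `closure Ω`. As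
`Ω` has no slits, `x` is a point of the open set `Ω`. -/
theorem notMem_frontier_of_isFlatAt (hΩo : IsOpen Ω) (hΩ : interior (closure Ω) = Ω) {i j : Fin M.N}
    (hij : i ≠ j) {x ν ν' : E d} (h : IsFlatAt (M.T i) x ν) (h' : IsFlatAt (M.T j) x ν') :
    x ∉ frontier Ω := by
  rw [hΩo.frontier_eq]
  refine fun hx => hx.2 ?_
  rw [← hΩ, mem_interior_iff_mem_nhds]
  filter_upwards [eventually_mem_union hij h h'] with y hy
  exact hy.elim (fun h => T_subset_closure i h) fun h => T_subset_closure j h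

/-- The two elements fill a neighbourhood of `x` and leave no room for the interior of a third. -/
theorem notMem_of_isFlatAt {i j k : Fin M.N} (hij : i ≠ j) (hki : k ≠ i) (hkj : k ≠ j)
    {x ν ν' : E d} (h : IsFlatAt (M.T i) x ν) (h' : IsFlatAt (M.T j) x ν') : x ∉ M.T k := by
  intro hx
  rw [← M.closure_interior_T k] at hx
  obtain ⟨y, hy, hyk⟩ := ((mem_closure_iff_frequently.1 hx).and_eventually
    (eventually_mem_union hij h h')).exists
  exact hyk.elim (fun h => Set.disjoint_left.1 (disjoint_interior_T hki) hy h)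
    fun h => Set.disjoint_left.1 (disjoint_interior_T hkj) hy h

/-- Points outside `M.T i` accumulate at `x`; near `x` they lie in `Ω`, hence in the other elements,
whose finite union is closed. -/
theorem exists_mem_of_notMem_frontier (hΩo : IsOpen Ω) {i : Fin M.N} {x : E d}
    (hx : x ∈ frontier (M.T i)) (hxΩ : x ∉ frontier Ω) : ∃ j, j ≠ i ∧ x ∈ frontier (M.T j) := by
  have hxT := M.frontier_subset_T i hx
  have hxΩ' : x ∈ Ω := by
    rw [hΩo.frontier_eq] at hxΩ
    by_contra h
    exact hxΩ ⟨T_subset_closure i hxT, h⟩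
  have hcl : IsClosed (⋃ j ∈ {j | j ≠ i}, M.T j) :=
    (Set.toFinite _).isClosed_biUnion fun j _ => M.isClosed_T j
  have hmem : x ∈ ⋃ j ∈ {j | j ≠ i}, M.T j := by
    rw [← hcl.closure_eq, mem_closure_iff_frequently]
    have h1 : x ∈ closure (M.T i)ᶜ := by
      rw [frontier_eq_closure_inter_closure] at hx
      exact hx.2
    refine ((mem_closure_iff_frequently.1 h1).and_eventually (hΩo.mem_nhds hxΩ')).mono ?_
    rintro y ⟨hy, hyΩ⟩
    have hyc : y ∈ ⋃ j, M.T j := by rw [M.cover]; exact subset_closure hyΩ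
    obtain ⟨j, hj⟩ := mem_iUnion.1 hyc
    exact mem_biUnion (show j ≠ i by rintro rfl; exact hy hj) hj
  obtain ⟨j, hj, hxj⟩ := mem_iUnion₂.1 hmem
  exact ⟨j, hj, mem_frontier_of_mem (Ne.symm hj) hxT hxj⟩

theorem face_swap (i j : Fin M.N) : M.face (i, j) = M.face (j, i) := inter_comm _ _

theorem isClosed_face (e : Fin M.N × Fin M.N) : IsClosed (M.face e) :=
  isClosed_frontier.inter isClosed_frontier

/-- The structure of the boundary of an element at almost every point: either the point lies on
the boundary of the domain, or it lies on exactly one further element, on which the outward normal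
is the opposite one. -/
theorem ae_boundary (hΩo : IsOpen Ω) (hΩ : interior (closure Ω) = Ω) (i : Fin M.N) :
    ∀ᵐ x ∂(surf d).restrict (frontier (M.T i)),
      (x ∈ frontier Ω ∧ ∀ j, j ≠ i → x ∉ frontier (M.T j)) ∨
      (x ∉ frontier Ω ∧ ∃ j, j ≠ i ∧ x ∈ frontier (M.T j) ∧
        (∀ k, k ≠ i → k ≠ j → x ∉ frontier (M.T k)) ∧ 0 < surf d (M.face (i, j)) ∧
        outwardNormal (M.T j) x = -outwardNormal (M.T i) x) := by
  have h1 : ∀ᵐ x ∂surf d, ∀ j, x ∈ frontier (M.T j) → ∃ ν, IsFlatAt (M.T j) x ν :=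
    ae_all_iff.2 fun j => (M.exists_unitRep j).choose_spec.ae_isFlatAt
  -- Contacts of measure zero are not interior faces; the finitely many of them are discarded here.
  have h2 : ∀ᵐ x ∂surf d, ∀ j, surf d (M.face (i, j)) = 0 → x ∉ M.face (i, j) := by
    refine ae_all_iff.2 fun j => ?_
    by_cases h0 : surf d (M.face (i, j)) = 0
    · filter_upwards [measure_eq_zero_iff_ae_notMem.1 h0] with x hx _
      exact hx
    · exact Eventually.of_forall fun x h => absurd h h0
  rw [ae_restrict_iff' isClosed_frontier.measurableSet]
  filter_upwards [h1, h2] with x hx hx2 hxi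
  obtain ⟨ν, hν⟩ := hx i hxi
  by_cases hxΩ : x ∈ frontier Ω
  · refine Or.inl ⟨hxΩ, fun j hj hxj => ?_⟩
    obtain ⟨ν', hν'⟩ := hx j hxj
    exact notMem_frontier_of_isFlatAt hΩo hΩ hj.symm hν hν' hxΩ
  · obtain ⟨j, hj, hxj⟩ := exists_mem_of_notMem_frontier hΩo hxi hxΩ
    obtain ⟨ν', hν'⟩ := hx j hxj
    refine Or.inr ⟨hxΩ, j, hj, hxj, fun k hki hkj hk => ?_, ?_, ?_⟩
    · exact notMem_of_isFlatAt hj.symm hki hkj hν hν' (M.frontier_subset_T k hk)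
    · exact pos_iff_ne_zero.2 fun h0 => hx2 j h0 ⟨hxj, hxi⟩
    · rw [outwardNormal_eq_of_isFlatAt hν, outwardNormal_eq_of_isFlatAt hν',
        hν.eq_neg hν' (M.disjoint i j hj.symm)]

/-! ### Splitting an element boundary into faces -/

variable (M) in
/-- The interior faces of the element `i`. -/
noncomputable def facesOf (i : Fin M.N) : Finset (Fin M.N × Fin M.N) :=
  M.interiorFaces.filter fun e => e.1 = i ∨ e.2 = i

theorem mem_interiorFaces {e : Fin M.N × Fin M.N} :
    e ∈ M.interiorFaces ↔ e.1 < e.2 ∧ 0 < surf d (M.face e) := by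
  classical
  simp [interiorFaces]

theorem mem_facesOf {i : Fin M.N} {e : Fin M.N × Fin M.N} :
    e ∈ M.facesOf i ↔ (e.1 < e.2 ∧ 0 < surf d (M.face e)) ∧ (e.1 = i ∨ e.2 = i) := by
  rw [facesOf, Finset.mem_filter, mem_interiorFaces]

theorem face_subset_of_mem {i : Fin M.N} {e : Fin M.N × Fin M.N} (he : e.1 = i ∨ e.2 = i) :
    M.face e ⊆ frontier (M.T i) := by
  rcases he with rfl | rfl
  · exact inter_subset_right
  · exact inter_subset_left

/-- Almost everywhere exactly one of the indicators is nonzero. A neighbour `j` enters only through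
the increasingly ordered one of the pairs `(i, j)` and `(j, i)`, so no face is counted twice. -/
theorem ae_sum_indicator (hΩo : IsOpen Ω) (hΩ : interior (closure Ω) = Ω) (i : Fin M.N)
    (f : E d → ℝ) :
    ∀ᵐ x ∂(surf d).restrict (frontier (M.T i)),
      f x = ∑ e ∈ M.facesOf i, (M.face e).indicator f x + (frontier Ω).indicator f x := by
  filter_upwards [ae_boundary hΩo hΩ i, ae_restrict_mem isClosed_frontier.measurableSet]
    with x hx hxi
  rcases hx with ⟨hxΩ, hj⟩ | ⟨hxΩ, j, hji, hxj, hk, hpos, -⟩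
  · rw [indicator_of_mem hxΩ, Finset.sum_eq_zero, zero_add]
    intro e he
    obtain ⟨⟨hlt, -⟩, h⟩ := mem_facesOf.1 he
    refine indicator_of_notMem (fun hxe => ?_) _
    rcases h with rfl | rfl
    · exact hj e.2 hlt.ne' hxe.1
    · exact hj e.1 hlt.ne hxe.2
  · rw [indicator_of_notMem hxΩ, add_zero]
    have key : ∀ e₀ : Fin M.N × Fin M.N, e₀ = (i, j) ∨ e₀ = (j, i) → e₀.1 < e₀.2 →
        f x = ∑ e ∈ M.facesOf i, (M.face e).indicator f x := by
      intro e₀ he₀ hlt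
      have hface : M.face e₀ = M.face (i, j) := by
        rcases he₀ with rfl | rfl
        · rfl
        · exact face_swap _ _
      have hmem : e₀ ∈ M.facesOf i := by
        refine mem_facesOf.2 ⟨⟨hlt, hface ▸ hpos⟩, ?_⟩
        rcases he₀ with rfl | rfl <;> simp
      rw [Finset.sum_eq_single_of_mem e₀ hmem, indicator_of_mem]
      · rw [hface]; exact ⟨hxj, hxi⟩
      · intro e he hne
        refine indicator_of_notMem (fun hxe => hne ?_) _
        obtain ⟨⟨hlt', -⟩, h⟩ := mem_facesOf.1 he
        rcases h with h | h
        · have h2 : e.2 = j := by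
            by_contra h2
            exact hk e.2 (h ▸ hlt'.ne') h2 hxe.1
          have he' : e = (i, j) := Prod.ext h h2
          rcases he₀ with h0 | h0
          · rw [he', h0]
          · rw [he'] at hlt'
            rw [h0] at hlt
            exact absurd hlt' hlt.not_gt
        · have h2 : e.1 = j := by
            by_contra h2
            exact hk e.1 (h ▸ hlt'.ne) h2 hxe.2
          have he' : e = (j, i) := Prod.ext h2 h
          rcases he₀ with h0 | h0
          · rw [he'] at hlt'
            rw [h0] at hlt
            exact absurd hlt' hlt.not_gt
          · rw [he', h0]
    rcases lt_or_gt_of_ne hji with h | h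
    · exact key (j, i) (Or.inr rfl) h
    · exact key (i, j) (Or.inl rfl) h

/-- The boundary integral over an element is the sum of those over its faces. -/
theorem integral_frontier_eq (hΩo : IsOpen Ω) (hΩ : interior (closure Ω) = Ω) (i : Fin M.N)
    {f : E d → ℝ} (hf : IntegrableOn f (frontier (M.T i)) (surf d)) :
    ∫ x in frontier (M.T i), f x ∂surf d =
      ∑ e ∈ M.facesOf i, ∫ x in M.face e, f x ∂surf d +
        ∫ x in frontier (M.T i) ∩ frontier Ω, f x ∂surf d := by
  rw [integral_congr_ae (ae_sum_indicator hΩo hΩ i f), integral_add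
    (integrable_finsetSum _ fun e _ => hf.indicator (isClosed_face e).measurableSet)
    (hf.indicator isClosed_frontier.measurableSet),
    integral_finsetSum _ fun e _ => hf.indicator (isClosed_face e).measurableSet,
    setIntegral_indicator isClosed_frontier.measurableSet]
  congr 1
  refine Finset.sum_congr rfl fun e he => ?_
  rw [setIntegral_indicator (isClosed_face e).measurableSet,
    inter_eq_right.2 (face_subset_of_mem (mem_facesOf.1 he).2)]

theorem surf_face_lt_top (e : Fin M.N × Fin M.N) : surf d (M.face e) < ⊤ :=
  (measure_mono inter_subset_left).trans_lt
    (M.exists_unitRep e.2).choose_spec.surf_frontier_lt_top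

theorem sum_surf_face_le (hΩo : IsOpen Ω) (hΩ : interior (closure Ω) = Ω) (i : Fin M.N) :
    ∑ e ∈ M.facesOf i, (surf d).real (M.face e) ≤ (surf d).real (frontier (M.T i)) := by
  have hfin := (M.exists_unitRep i).choose_spec.surf_frontier_lt_top
  have h := integral_frontier_eq hΩo hΩ i (f := fun _ => 1)
    (integrableOn_const hfin.ne)
  simp only [integral_const, measureReal_restrict_apply_univ, smul_eq_mul, mul_one] at h
  rw [h]
  exact le_add_of_nonneg_right measureReal_nonneg

/-- The face normal is taken from `T⁺ = M.T e.2`; this is how it looks from `T⁻`. -/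
theorem ae_normal_of_mem (hΩo : IsOpen Ω) (hΩ : interior (closure Ω) = Ω) {e : Fin M.N × Fin M.N}
    (he : e.1 < e.2) :
    ∀ᵐ x ∂(surf d).restrict (M.face e), M.normal e x = -outwardNormal (M.T e.1) x := by
  have h1 := ae_restrict_of_ae_restrict_of_subset
    (face_subset_of_mem (Or.inl rfl) : M.face e ⊆ frontier (M.T e.1)) (ae_boundary hΩo hΩ e.1)
  filter_upwards [h1, ae_restrict_mem (isClosed_face e).measurableSet] with x hx hxe
  rcases hx with ⟨hxΩ, hj⟩ | ⟨hxΩ, j, hji, hxj, hk, hpos, hn⟩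
  · exact absurd hxe.1 (hj e.2 he.ne')
  · have : e.2 = j := by
      by_contra h
      exact hk e.2 he.ne' h hxe.1
    rw [normal, this, hn]

end Mesh

end DGFE

namespace DGFE

variable {d : ℕ}

/-! ### Polynomials -/

theorem pev_C (a : ℝ) : pev (MvPolynomial.C a : MvPolynomial (Fin d) ℝ) = fun _ => a := by
  ext x; simp [pev]

theorem pev_add (P Q : MvPolynomial (Fin d) ℝ) : pev (P + Q) = fun x => pev P x + pev Q x := by
  ext x; simp [pev]

theorem pev_mul_X (P : MvPolynomial (Fin d) ℝ) (l : Fin d) :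
    pev (P * MvPolynomial.X l) = fun x => pev P x * x l := by
  ext x; simp [pev]

theorem contDiff_pev (P : MvPolynomial (Fin d) ℝ) {n : WithTop ℕ∞} : ContDiff ℝ n (pev P) := by
  induction P using MvPolynomial.induction_on with
  | C a => rw [pev_C]; exact contDiff_const
  | add P Q hP hQ => rw [pev_add]; exact hP.add hQ
  | mul_X P l hP => rw [pev_mul_X]; exact hP.mul (contDiff_piLp_apply (p := 2) (i := l))

theorem continuous_pev (P : MvPolynomial (Fin d) ℝ) : Continuous (pev P) :=
  (contDiff_pev P (n := 0)).continuous

theorem fderiv_pev (P : MvPolynomial (Fin d) ℝ) (l : Fin d) (x : E d) :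
    fderiv ℝ (pev P) x (EuclideanSpace.single l 1) = pev (MvPolynomial.pderiv l P) x := by
  have hdiff : ∀ P : MvPolynomial (Fin d) ℝ, HasFDerivAt (pev P) (fderiv ℝ (pev P) x) x := fun P =>
    ((contDiff_pev P (n := 1)).differentiable one_ne_zero x).hasFDerivAt
  induction P using MvPolynomial.induction_on with
  | C a => rw [pev_C]; simp [pev]
  | add P Q hP hQ =>
    have h : HasFDerivAt (fun x => pev P x + pev Q x) _ x := (hdiff P).add (hdiff Q)
    rw [pev_add, h.fderiv, map_add, pev_add, _root_.add_apply, hP, hQ]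
  | mul_X P m hP =>
    have h : HasFDerivAt (fun x : E d => pev P x * x m) _ x :=
      (hdiff P).mul (EuclideanSpace.proj (𝕜 := ℝ) m : E d →L[ℝ] ℝ).hasFDerivAt
    rw [pev_mul_X, h.fderiv, Derivation.leibniz, MvPolynomial.pderiv_X]
    simp only [_root_.add_apply, _root_.smul_apply, hP, smul_eq_mul]
    by_cases hml : m = l
    · subst hml; simp [pev]
    · simp [pev, hml]

/-- Substituting polynomials of degree at most one does not increase the total degree. -/
theorem totalDegree_aeval_le (P : MvPolynomial (Fin d) ℝ) (f : Fin d → MvPolynomial (Fin d) ℝ)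
    (hf : ∀ l, (f l).totalDegree ≤ 1) : (MvPolynomial.aeval f P).totalDegree ≤ P.totalDegree := by
  rw [MvPolynomial.aeval_def, MvPolynomial.eval₂_eq']
  refine MvPolynomial.totalDegree_finsetSum_le fun m hm => ?_
  refine (MvPolynomial.totalDegree_mul _ _).trans ?_
  rw [MvPolynomial.algebraMap_eq, MvPolynomial.totalDegree_C, zero_add]
  refine (MvPolynomial.totalDegree_finsetProd _ _).trans ?_
  refine le_trans (Finset.sum_le_sum fun l _ => (MvPolynomial.totalDegree_pow _ _).trans
    (Nat.mul_le_mul_left _ (hf l))) ?_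
  have := MvPolynomial.le_totalDegree hm
  rw [Finsupp.sum_fintype _ _ fun _ => rfl] at this
  simpa using this

theorem pev_aeval (P : MvPolynomial (Fin d) ℝ) (f : Fin d → MvPolynomial (Fin d) ℝ) (y : E d) :
    pev (MvPolynomial.aeval f P) y = pev P (WithLp.toLp 2 fun l => pev (f l) y) := by
  induction P using MvPolynomial.induction_on with
  | C a => simp [pev]
  | add P Q hP hQ => simp only [map_add, pev_add, hP, hQ]
  | mul_X P l hP =>
    simp only [pev_mul_X, ← hP, map_mul, MvPolynomial.aeval_X]
    simp [pev]

/-- Used to pull a polynomial back from an element of size `h` to a reference configuration of size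
one. -/
theorem exists_totalDegree_le_pev_affine (P : MvPolynomial (Fin d) ℝ) (c : E d) (h : ℝ) :
    ∃ Q : MvPolynomial (Fin d) ℝ, Q.totalDegree ≤ P.totalDegree ∧
      ∀ y, pev Q y = pev P (c + h • y) := by
  refine ⟨MvPolynomial.aeval (fun l => MvPolynomial.C (c l) + MvPolynomial.C h * MvPolynomial.X l) P,
    totalDegree_aeval_le _ _ fun l => ?_, fun y => ?_⟩
  · refine (MvPolynomial.totalDegree_add _ _).trans (max_le (by simp) ?_)
    refine (MvPolynomial.totalDegree_mul _ _).trans ?_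
    simp
  · rw [pev_aeval]
    congr 1
    ext l
    simp [pev]

/-! ### Norm equivalence and the inverse estimate -/

theorem eq_zero_of_pev_eq_zero_on_ball {P : MvPolynomial (Fin d) ℝ} {σ : ℝ} (hσ : 0 < σ)
    (h : ∀ x ∈ Metric.ball (0 : E d) σ, pev P x = 0) : P = 0 := by
  have hopen : IsOpen ((fun f : Fin d → ℝ => (WithLp.toLp 2 f : E d)) ⁻¹' Metric.ball 0 σ) :=
    Metric.isOpen_ball.preimage (PiLp.continuous_toLp 2 _)
  have h0 : (0 : Fin d → ℝ) ∈ (fun f : Fin d → ℝ => (WithLp.toLp 2 f : E d)) ⁻¹' Metric.ball 0 σ := by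
    simpa using hσ
  obtain ⟨ε, hε, hsub⟩ := Metric.isOpen_iff.1 hopen 0 h0
  -- The ball contains a cube, and a polynomial vanishing on a product of infinite sets is zero.
  refine MvPolynomial.funext_set (fun _ => Ioo (-ε) ε) (fun _ => Ioo_infinite (by linarith))
    fun f hf => ?_
  rw [map_zero]
  refine h (WithLp.toLp 2 f) (hsub ?_)
  rw [mem_ball_zero_iff, pi_norm_lt_iff hε]
  intro l
  have := hf l (mem_univ l)
  rw [Real.norm_eq_abs, abs_lt]
  exact this

/-- `A` factors through the finite-dimensional range of `J`, on which every linear map is bounded.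
-/
theorem exists_norm_le_of_injective {V F G : Type*} [AddCommGroup V] [Module ℝ V]
    [FiniteDimensional ℝ V] [NormedAddCommGroup F] [NormedSpace ℝ F] [NormedAddCommGroup G]
    [NormedSpace ℝ G] (A : V →ₗ[ℝ] F) (J : V →ₗ[ℝ] G) (hJ : Function.Injective J) :
    ∃ K, 0 ≤ K ∧ ∀ v, ‖A v‖ ≤ K * ‖J v‖ := by
  let e := LinearEquiv.ofInjective J hJ
  let L : LinearMap.range J →L[ℝ] F := (A ∘ₗ e.symm.toLinearMap).toContinuousLinearMap
  refine ⟨‖L‖, L.opNorm_nonneg, fun v => ?_⟩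
  have h1 : L (e v) = A v := by simp [L]
  rw [← h1]
  exact L.le_opNorm (e v)

theorem pev_smul (a : ℝ) (P : MvPolynomial (Fin d) ℝ) : pev (a • P) = a • pev P := by
  ext x; simp [pev, MvPolynomial.smul_eval]

theorem memLp_pev_ball (P : MvPolynomial (Fin d) ℝ) (σ : ℝ) :
    MemLp (pev P) 2 (volume.restrict (Metric.ball (0 : E d) σ)) := by
  have hfin : IsFiniteMeasure (volume.restrict (Metric.ball (0 : E d) σ)) :=
    isFiniteMeasure_restrict.2 measure_ball_lt_top.ne
  obtain ⟨B, hB⟩ := (isCompact_closedBall (0 : E d) σ).exists_bound_of_continuousOn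
    (continuous_pev P).continuousOn
  exact MemLp.of_bound (continuous_pev P).aestronglyMeasurable B
    ((ae_restrict_iff' measurableSet_ball).2 (Eventually.of_forall fun x hx =>
      hB x (Metric.ball_subset_closedBall hx)))

/-- Polynomials as elements of `L²` of a ball. -/
noncomputable def polyToL2 (d k : ℕ) (σ : ℝ) : MvPolynomial.restrictTotalDegree (Fin d) ℝ k →ₗ[ℝ]
    Lp ℝ 2 ((volume : Measure (E d)).restrict (Metric.ball 0 σ)) where
  toFun P := (memLp_pev_ball P.1 σ).toLp _
  map_add' P Q := by
    rw [← MemLp.toLp_add]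
    exact MemLp.toLp_congr _ _ (Eventually.of_forall fun x => by
      rw [Submodule.coe_add, pev_add, Pi.add_apply])
  map_smul' a P := by
    rw [RingHom.id_apply, ← MemLp.toLp_const_smul]
    exact MemLp.toLp_congr _ _ (Eventually.of_forall fun x => by
      rw [Submodule.coe_smul, pev_smul])

/-- Polynomials as continuous functions on the closed unit ball. -/
noncomputable def polyToC (d k : ℕ) : MvPolynomial.restrictTotalDegree (Fin d) ℝ k →ₗ[ℝ]
    C(Metric.closedBall (0 : E d) 1, ℝ) where
  toFun P := ⟨fun y => pev P.1 y, (continuous_pev P.1).comp continuous_subtype_val⟩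
  map_add' P Q := by ext y; simp [pev_add]
  map_smul' a P := by ext y; simp [pev_smul]

theorem injective_polyToL2 (d k : ℕ) {σ : ℝ} (hσ : 0 < σ) : Function.Injective (polyToL2 d k σ) := by
  rw [← LinearMap.ker_eq_bot, LinearMap.ker_eq_bot']
  intro P hP
  have e1 : (memLp_pev_ball P.1 σ).toLp _ = 0 := hP
  have h1 := (memLp_pev_ball P.1 σ).coeFn_toLp
  rw [e1] at h1
  have h2 := Measure.eqOn_open_of_ae_eq (h1.symm.trans (Lp.coeFn_zero ℝ 2 _)) Metric.isOpen_ball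
    (continuous_pev P.1).continuousOn continuousOn_const
  exact Subtype.ext (eq_zero_of_pev_eq_zero_on_ball hσ h2)

theorem norm_polyToL2_sq (d k : ℕ) (σ : ℝ) (P : MvPolynomial.restrictTotalDegree (Fin d) ℝ k) :
    ‖polyToL2 d k σ P‖ ^ 2 = ∫ x in Metric.ball (0 : E d) σ, pev P.1 x ^ 2 := by
  have e1 : ‖polyToL2 d k σ P‖ = (eLpNorm (pev P.1) 2 (volume.restrict (Metric.ball 0 σ))).toReal :=
    Lp.norm_toLp _ (memLp_pev_ball P.1 σ)
  have e0 : 0 ≤ ∫ x in Metric.ball (0 : E d) σ, ‖pev P.1 x‖ ^ (2 : ℝ) :=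
    integral_nonneg fun x => by positivity
  rw [e1, (memLp_pev_ball P.1 σ).eLpNorm_eq_integral_rpow_norm (by norm_num) (by norm_num),
    ENNReal.toReal_ofReal (by positivity), ENNReal.toReal_ofNat, ← Real.rpow_natCast,
    ← Real.rpow_mul e0]
  norm_num

/-- Norm equivalence on polynomials: the maximum on the unit ball is bounded by the `L²` norm on a
smaller ball. -/
theorem exists_sq_pev_le_integral (d k : ℕ) {σ : ℝ} (hσ : 0 < σ) :
    ∃ K : ℝ, 0 < K ∧ ∀ P : MvPolynomial (Fin d) ℝ, P.totalDegree ≤ k →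
      ∀ y ∈ Metric.closedBall (0 : E d) 1, pev P y ^ 2 ≤
        K * ∫ x in Metric.ball (0 : E d) σ, pev P x ^ 2 := by
  obtain ⟨K, hK, h⟩ := exists_norm_le_of_injective (polyToC d k) (polyToL2 d k σ)
    (injective_polyToL2 d k hσ)
  refine ⟨K ^ 2 + 1, by positivity, fun P hP y hy => ?_⟩
  have hv := h ⟨P, (MvPolynomial.mem_restrictTotalDegree _ _ _).2 hP⟩
  rw [← norm_polyToL2_sq d k σ ⟨P, (MvPolynomial.mem_restrictTotalDegree _ _ _).2 hP⟩, ← sq_abs]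
  set v : MvPolynomial.restrictTotalDegree (Fin d) ℝ k :=
    ⟨P, (MvPolynomial.mem_restrictTotalDegree _ _ _).2 hP⟩
  have h2 : |pev P y| ≤ K * ‖polyToL2 d k σ v‖ :=
    ((polyToC d k v).norm_coe_le_norm ⟨y, hy⟩).trans hv
  have h4 := pow_le_pow_left₀ (abs_nonneg _) h2 2
  nlinarith [sq_nonneg ‖polyToL2 d k σ v‖]

open scoped Pointwise in
/-- Inverse estimate for polynomials on elements of bounded chunkiness. -/
theorem exists_sq_pev_mul_volume_le (d k : ℕ) {σ : ℝ} (hσ : 0 < σ) :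
    ∃ K : ℝ, 0 < K ∧ ∀ (T : Set (E d)) (s : Finset (E d × ℝ)), UnitRep T s → ∀ (c : E d) (h : ℝ),
      0 < h → Metric.closedBall c (σ * h) ⊆ T → T ⊆ Metric.closedBall c h →
      ∀ P : MvPolynomial (Fin d) ℝ, P.totalDegree ≤ k → ∀ x ∈ T,
        pev P x ^ 2 * volume.real (interior T) ≤ K * ∫ y in interior T, pev P y ^ 2 := by
  obtain ⟨K, hK, hKP⟩ := exists_sq_pev_le_integral d k hσ
  set b := volume.real (Metric.closedBall (0 : E d) 1) with hb
  have hb0 : 0 ≤ b := measureReal_nonneg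
  refine ⟨K * b + 1, by positivity, fun T s hT c h hh hin hout P hP x hx => ?_⟩
  -- In the coordinate `(x - c) / h` the element lies between the balls of radius `σ` and `1`,
  -- whatever its shape. The factor `h ^ d` gained from its volume cancels the Jacobian.
  obtain ⟨Q, hQ, hQP⟩ := exists_totalDegree_le_pev_affine P c h
  have h1 := hKP Q (hQ.trans hP) (h⁻¹ • (x - c)) (by
    rw [mem_closedBall_zero_iff, norm_smul, norm_inv, Real.norm_eq_abs, abs_of_pos hh,
      inv_mul_le_iff₀ hh, mul_one]
    exact mem_closedBall_iff_norm.1 (hout hx))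
  rw [hQP, smul_smul, mul_inv_cancel₀ hh.ne', one_smul, add_sub_cancel] at h1
  have hnn : 0 ≤ ∫ y in interior T, pev P y ^ 2 := integral_nonneg fun y => sq_nonneg _
  have h2 : ∫ y in Metric.ball (0 : E d) σ, pev Q y ^ 2 ≤
      (h ^ d)⁻¹ * ∫ y in interior T, pev P y ^ 2 := by
    simp only [hQP]
    rw [Measure.setIntegral_comp_smul_of_pos volume (fun z => pev P (c + z) ^ 2) _ hh,
      finrank_euclideanSpace_fin, smul_eq_mul]
    refine mul_le_mul_of_nonneg_left ?_ (by positivity)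
    rw [← integral_indicator (measurableSet_ball.const_smul₀ h),
      ← integral_indicator isOpen_interior.measurableSet,
      ← integral_add_left_eq_self (fun y => (interior T).indicator (fun y => pev P y ^ 2) y) c]
    have hint : Integrable ((interior T).indicator fun y => pev P y ^ 2) :=
      (hT.integrableOn_interior_of_continuous ((continuous_pev P).pow 2)).integrable_indicator
        isOpen_interior.measurableSet
    refine integral_mono_of_nonneg (Eventually.of_forall fun z =>
      indicator_nonneg (fun _ _ => sq_nonneg _) _) (hint.comp_add_left c)
      (Eventually.of_forall fun z => ?_)
    by_cases hz : z ∈ h • Metric.ball (0 : E d) σ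
    · rw [indicator_of_mem hz]
      have : c + z ∈ interior T := by
        rw [smul_ball hh.ne', smul_zero, Real.norm_eq_abs, abs_of_pos hh,
          mem_ball_zero_iff] at hz
        refine interior_mono hin (Metric.ball_subset_interior_closedBall ?_)
        rw [mem_ball_iff_norm, add_sub_cancel_left, mul_comm]
        exact hz
      simp only [indicator_of_mem this, le_refl]
    · rw [indicator_of_notMem hz]
      exact indicator_nonneg (fun _ _ => sq_nonneg _) _
  have h3 : volume.real (interior T) ≤ h ^ d * b := by
    refine (measureReal_mono (interior_subset.trans hout)
      (isCompact_closedBall _ _).measure_lt_top.ne).trans (le_of_eq ?_)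
    rw [Measure.addHaar_real_closedBall' _ _ hh.le, finrank_euclideanSpace_fin]
  calc pev P x ^ 2 * volume.real (interior T)
      ≤ (K * ((h ^ d)⁻¹ * ∫ y in interior T, pev P y ^ 2)) * (h ^ d * b) :=
        mul_le_mul (h1.trans (mul_le_mul_of_nonneg_left h2 hK.le)) h3 measureReal_nonneg
          (by positivity)
    _ = K * b * ∫ y in interior T, pev P y ^ 2 := by
        have : h ^ d ≠ 0 := by positivity
        field_simp
    _ ≤ (K * b + 1) * ∫ y in interior T, pev P y ^ 2 :=
        mul_le_mul_of_nonneg_right (by linarith) hnn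

end DGFE

namespace DGFE

variable {d : ℕ}

/-! ### The discrete functional on one element -/

namespace Mesh

variable {Ω : Set (E d)} {M : Mesh Ω} {p : ℝ} {v : Fin M.N → E d → ℝ}

theorem memLp_trace (hp : 1 < p) (hv : M.MemBroken p v) (i : Fin M.N) :
    MemLp (trace p (M.T i) (v i)) (ENNReal.ofReal p) ((surf d).restrict (frontier (M.T i))) :=
  ((M.exists_unitRep i).choose_spec.isTrace_trace hp (hv i)).1

theorem memLp_trace_face (hp : 1 < p) (hv : M.MemBroken p v) {i : Fin M.N}
    {e : Fin M.N × Fin M.N} (he : e.1 = i ∨ e.2 = i) :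
    MemLp (trace p (M.T i) (v i)) (ENNReal.ofReal p) ((surf d).restrict (M.face e)) :=
  (memLp_trace hp hv i).mono_measure (Measure.restrict_mono (face_subset_of_mem he) le_rfl)

theorem memLp_jump (hp : 1 < p) (hv : M.MemBroken p v) (e : Fin M.N × Fin M.N) :
    MemLp (M.jump (M.traces p v) e) (ENNReal.ofReal p) ((surf d).restrict (M.face e)) :=
  (memLp_trace_face hp hv (Or.inr rfl)).sub (memLp_trace_face hp hv (Or.inl rfl))

theorem integrableOn_of_memLp_face (hp : 1 < p) {e : Fin M.N × Fin M.N} {f : E d → ℝ}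
    (hf : MemLp f (ENNReal.ofReal p) ((surf d).restrict (M.face e))) :
    IntegrableOn f (M.face e) (surf d) := by
  have : IsFiniteMeasure ((surf d).restrict (M.face e)) :=
    isFiniteMeasure_restrict.2 (surf_face_lt_top e).ne
  exact hf.integrable (by simpa using hp.le)

theorem ae_abs_outwardNormal_le (i : Fin M.N) (l : Fin d) :
    ∀ᵐ x ∂(surf d).restrict (frontier (M.T i)), |outwardNormal (M.T i) x l| ≤ 1 := by
  filter_upwards [(M.exists_unitRep i).choose_spec.ae_norm_outwardNormal] with x hx
  rw [← hx]
  exact PiLp.norm_apply_le (p := 2) (outwardNormal (M.T i) x) l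

theorem aestronglyMeasurable_outwardNormal_apply (i : Fin M.N) (l : Fin d) :
    AEStronglyMeasurable (fun x => outwardNormal (M.T i) x l)
      ((surf d).restrict (frontier (M.T i))) :=
  (EuclideanSpace.proj (𝕜 := ℝ) l : E d →L[ℝ] ℝ).continuous.comp_aestronglyMeasurable
    (M.exists_unitRep i).choose_spec.aestronglyMeasurable_outwardNormal

theorem abs_sgn (ξ : ℝ) : |sgn ξ| = 1 := by
  unfold sgn
  split_ifs <;> simp

theorem measurable_sgn : Measurable sgn :=
  Measurable.ite measurableSet_Ici measurable_const measurable_const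

/-- The trace operators differ from the trace on either side by a multiple of the jump. -/
theorem exists_traceOp_eq (s : ℝ) (hs : |s| ≤ 1) (l : Fin d) {i : Fin M.N}
    {e : Fin M.N × Fin M.N} (he : e.1 = i ∨ e.2 = i) :
    ∃ m : E d → ℝ, AEStronglyMeasurable m ((surf d).restrict (M.face e)) ∧ (∀ x, |m x| ≤ 1) ∧
      ∀ x, M.traceOp p s l v e x =
        trace p (M.T i) (v i) x + m x * M.jump (M.traces p v) e x := by
  have hmeas : AEStronglyMeasurable (fun x => sgn (M.normal e x l))
      ((surf d).restrict (M.face e)) :=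
    ((measurable_sgn.comp_aemeasurable
      (aestronglyMeasurable_outwardNormal_apply e.2 l).aemeasurable).aestronglyMeasurable).mono_measure
      (Measure.restrict_mono (face_subset_of_mem (Or.inr rfl)) le_rfl)
  have hb : ∀ x, |s * sgn (M.normal e x l)| ≤ 1 := fun x => by
    rw [abs_mul, abs_sgn, mul_one]; exact hs
  rcases he with rfl | rfl
  -- Seen from `T⁻` the average is the trace plus half the jump; seen from `T⁺`, minus half the
  -- jump.
  · refine ⟨fun x => 1 / 2 + 1 / 2 * (s * sgn (M.normal e x l)),
      (((hmeas.const_mul s).const_mul (1 / 2)).const_add (1 / 2)), fun x => ?_, fun x => ?_⟩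
    · have := abs_le.1 (hb x)
      rw [abs_le]; constructor <;> linarith
    · simp only [traceOp, average, jump, traces]; ring
  · refine ⟨fun x => -(1 / 2) + 1 / 2 * (s * sgn (M.normal e x l)),
      (((hmeas.const_mul s).const_mul (1 / 2)).const_add (-(1 / 2))), fun x => ?_, fun x => ?_⟩
    · have := abs_le.1 (hb x)
      rw [abs_le]; constructor <;> linarith
    · simp only [traceOp, average, jump, traces]; ring

/-- The functional for a test function supported on one element. -/
theorem derivFunctional_single (hΩo : IsOpen Ω) (hΩ : interior (closure Ω) = Ω) (s : ℝ) (l : Fin d)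
    (i : Fin M.N) (g : MvPolynomial (Fin d) ℝ) :
    M.derivFunctional p s l v (Function.update 0 i g) =
      ((∑ e ∈ M.facesOf i, ∫ x in M.face e,
        M.traceOp p s l v e x * (outwardNormal (M.T i) x l * pev g x) ∂surf d) +
      ∫ x in frontier (M.T i) ∩ frontier Ω,
        trace p (M.T i) (v i) x * (outwardNormal (M.T i) x l * pev g x) ∂surf d) -
      ∫ x in interior (M.T i), v i x * pev (MvPolynomial.pderiv l g) x := by
  have h0 : ∀ x : E d, pev (0 : MvPolynomial (Fin d) ℝ) x = 0 := fun x => by simp [pev]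
  unfold derivFunctional
  congr 1
  · congr 1
    · rw [facesOf, Finset.sum_filter]
      refine Finset.sum_congr rfl fun e he => ?_
      have hlt := (mem_interiorFaces.1 he).1
      split_ifs with hi
      · rcases hi with rfl | rfl
        -- On `T⁻` the face normal is opposite to the outward one, and the jump of the test function
        -- is `-g`; the signs cancel.
        · refine integral_congr_ae ?_
          filter_upwards [ae_normal_of_mem hΩo hΩ hlt] with x hx
          rw [hx]
          simp only [jump, Function.update_self, Function.update_of_ne hlt.ne', Pi.zero_apply, h0,
            PiLp.neg_apply]
          ring
        · refine integral_congr_ae (Eventually.of_forall fun x => ?_)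
          simp only [jump, Function.update_self, Function.update_of_ne hlt.ne, Pi.zero_apply, h0,
            normal]
          ring
      · push Not at hi
        simp only [jump, Function.update_of_ne hi.1, Function.update_of_ne hi.2, Pi.zero_apply, h0,
          sub_self, mul_zero, integral_zero]
    · rw [Finset.sum_eq_single i]
      · simp only [Function.update_self, mul_assoc]
      · intro j _ hj
        simp only [Function.update_of_ne hj, Pi.zero_apply, h0, mul_zero, integral_zero]
      · simp
  · rw [Finset.sum_eq_single i]
    · simp only [Function.update_self]
    · intro j _ hj
      simp only [Function.update_of_ne hj, Pi.zero_apply, map_zero, h0, mul_zero, integral_zero]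
    · simp

/-! ### Pointwise bounds for the numerical derivatives -/

variable (M) in
/-- The local part of the broken `W^{1,1}` seminorm. -/
noncomputable def localVariation (p : ℝ) (v : Fin M.N → E d → ℝ) (i : Fin M.N) : ℝ :=
  (∑ e ∈ M.facesOf i, ∫ x in M.face e, |M.jump (M.traces p v) e x| ∂surf d) +
    ∫ x in interior (M.T i), ‖weakGrad (interior (M.T i)) (v i) x‖

theorem integrableOn_weakGrad (hp : 1 < p) (hv : M.MemBroken p v) (i : Fin M.N) :
    IntegrableOn (weakGrad (interior (M.T i)) (v i)) (interior (M.T i)) := by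
  have : IsFiniteMeasure (volume.restrict (interior (M.T i))) :=
    isFiniteMeasure_restrict.2 (M.exists_unitRep i).choose_spec.volume_interior_lt_top.ne
  exact ((hv i).memLp_weakGrad isOpen_interior).integrable (by simpa using hp.le)

/-- After integration by parts the traces of `v` cancel on `∂Ω` and, up to a bounded multiple of the
jump, on the interior faces. Only jumps and the gradient remain, each against a factor of size at
most `B`. -/
theorem abs_derivFunctional_single_le (hΩo : IsOpen Ω) (hΩ : interior (closure Ω) = Ω) (hp : 1 < p)
    (hv : M.MemBroken p v) {s : ℝ} (hs : |s| ≤ 1) (l : Fin d) (i : Fin M.N)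
    (g : MvPolynomial (Fin d) ℝ) {B : ℝ} (hB : ∀ x ∈ M.T i, |pev g x| ≤ B) :
    |M.derivFunctional p s l v (Function.update 0 i g)| ≤ B * M.localVariation p v i := by
  obtain ⟨S, hS⟩ := M.exists_unitRep i
  set τ := trace p (M.T i) (v i) with hτ
  set G := weakGrad (interior (M.T i)) (v i) with hG
  set ψ : E d → ℝ := fun x => outwardNormal (M.T i) x l * pev g x with hψ
  have hB0 : 0 ≤ B := by
    obtain ⟨z, hz⟩ := hS.nonempty
    exact (abs_nonneg _).trans (hB z (interior_subset hz))
  have hψm : AEStronglyMeasurable ψ ((surf d).restrict (frontier (M.T i))) :=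
    (aestronglyMeasurable_outwardNormal_apply i l).mul (continuous_pev g).aestronglyMeasurable
  have hψB : ∀ᵐ x ∂(surf d).restrict (frontier (M.T i)), ‖ψ x‖ ≤ B := by
    filter_upwards [ae_abs_outwardNormal_le i l, ae_restrict_mem isClosed_frontier.measurableSet]
      with x hx hxT
    rw [Real.norm_eq_abs, hψ, abs_mul]
    calc _ ≤ 1 * B := mul_le_mul hx (hB x (M.frontier_subset_T i hxT)) (abs_nonneg _) zero_le_one
      _ = B := one_mul B
  have : IsFiniteMeasure ((surf d).restrict (frontier (M.T i))) :=
    isFiniteMeasure_restrict.2 hS.surf_frontier_lt_top.ne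
  have hτi : IntegrableOn (fun x => τ x * ψ x) (frontier (M.T i)) (surf d) :=
    ((memLp_trace hp hv i).integrable (by simpa using hp.le)).mul_bdd hψm hψB
  have hibp := hS.integral_mul_fderiv hp (hv i) (contDiff_pev g) (EuclideanSpace.single l 1)
  have e1 : ∀ x, ⟪outwardNormal (M.T i) x, EuclideanSpace.single l 1⟫ = outwardNormal (M.T i) x l :=
    fun x => by simp [EuclideanSpace.inner_single_right]
  have e2 : ∀ x, ⟪G x, EuclideanSpace.single l 1⟫ = G x l :=
    fun x => by simp [EuclideanSpace.inner_single_right]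
  simp only [fderiv_pev, e1, ← hG, ← hτ, e2] at hibp
  rw [integral_frontier_eq hΩo hΩ i hτi] at hibp
  rw [derivFunctional_single hΩo hΩ, hibp]
  -- `R e` is the jump remainder on the face; the other part cancels against the boundary term of
  -- the integration by parts.
  have key : ∀ e ∈ M.facesOf i,
      ∃ R : ℝ, ∫ x in M.face e, M.traceOp p s l v e x * ψ x ∂surf d =
        ∫ x in M.face e, τ x * ψ x ∂surf d + R ∧
        |R| ≤ B * ∫ x in M.face e, |M.jump (M.traces p v) e x| ∂surf d := by
    intro e he
    have hei := (mem_facesOf.1 he).2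
    have hsub := face_subset_of_mem (M := M) hei
    obtain ⟨m, hm, hm1, hmeq⟩ := exists_traceOp_eq (p := p) (v := v) s hs l hei
    have hj := integrableOn_of_memLp_face hp (memLp_jump hp hv e)
    have hψmf := hψm.mono_measure (Measure.restrict_mono hsub le_rfl)
    have hψBf := ae_restrict_of_ae_restrict_of_subset hsub hψB
    have hmψ : ∀ᵐ x ∂(surf d).restrict (M.face e), ‖m x * ψ x‖ ≤ B := by
      filter_upwards [hψBf] with x hx
      rw [norm_mul]
      calc _ ≤ 1 * B := mul_le_mul (hm1 x) hx (norm_nonneg _) zero_le_one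
        _ = B := one_mul B
    have hint : IntegrableOn (fun x => M.jump (M.traces p v) e x * (m x * ψ x)) (M.face e)
        (surf d) := hj.mul_bdd (hm.mul hψmf) hmψ
    refine ⟨∫ x in M.face e, M.jump (M.traces p v) e x * (m x * ψ x) ∂surf d, ?_, ?_⟩
    · rw [← integral_add (hτi.mono_set hsub) hint]
      refine integral_congr_ae (Eventually.of_forall fun x => ?_)
      simp only [hmeq x]
      ring
    · rw [← integral_const_mul, ← Real.norm_eq_abs]
      refine norm_integral_le_of_norm_le (hj.abs.const_mul B) ?_
      filter_upwards [hmψ] with x hx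
      rw [norm_mul, mul_comm, Real.norm_eq_abs (M.jump (M.traces p v) e x)]
      exact mul_le_mul_of_nonneg_right hx (abs_nonneg _)
  choose! R hR1 hR2 using key
  rw [Finset.sum_congr rfl hR1, Finset.sum_add_distrib]
  have hGl : |∫ x in interior (M.T i), G x l * pev g x| ≤
      B * ∫ x in interior (M.T i), ‖G x‖ := by
    rw [← integral_const_mul, ← Real.norm_eq_abs]
    refine norm_integral_le_of_norm_le ((integrableOn_weakGrad hp hv i).norm.const_mul B) ?_
    refine (ae_restrict_iff' isOpen_interior.measurableSet).2 (Eventually.of_forall fun x hx => ?_)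
    rw [norm_mul, mul_comm]
    exact mul_le_mul (hB x (interior_subset hx)) (PiLp.norm_apply_le (p := 2) (G x) l)
      (norm_nonneg _) hB0
  have hRs : |∑ e ∈ M.facesOf i, R e| ≤
      B * ∑ e ∈ M.facesOf i, ∫ x in M.face e, |M.jump (M.traces p v) e x| ∂surf d := by
    rw [Finset.mul_sum]
    exact (Finset.abs_sum_le_sum_abs _ _).trans (Finset.sum_le_sum hR2)
  rw [localVariation, mul_add]
  refine le_trans (le_of_eq ?_) ((abs_add_le _ _).trans (add_le_add hRs hGl))
  congr 1
  ring

theorem diam_pos (hd : 1 ≤ d) (i : Fin M.N) : 0 < Metric.diam (M.T i) := by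
  obtain ⟨S, hS⟩ := M.exists_unitRep i
  obtain ⟨z, hz⟩ := hS.nonempty
  obtain ⟨t, ht, htz⟩ := exists_pos_add_smul_mem hz
    (EuclideanSpace.single (⟨0, hd⟩ : Fin d) (1 : ℝ))
  refine Metric.diam_pos ⟨z, interior_subset hz, _, htz, fun h => ?_⟩ hS.bounded
  have h1 : t • EuclideanSpace.single (⟨0, hd⟩ : Fin d) (1 : ℝ) = 0 := by simpa using h
  rw [smul_eq_zero] at h1
  rcases h1 with h1 | h1
  · exact ht.ne' h1
  · simp at h1

theorem volume_pos (i : Fin M.N) : 0 < volume.real (interior (M.T i)) :=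
  ENNReal.toReal_pos (isOpen_interior.measure_pos volume (M.polytope i).2.2).ne'
    (M.exists_unitRep i).choose_spec.volume_interior_lt_top.ne

/-- Pointwise bound of a numerical derivative on an element. -/
theorem exists_abs_numDeriv_mul_volume_le (hd : 1 ≤ d) (k : ℕ) {σ : ℝ} (hσ : 0 < σ) :
    ∃ K : ℝ, 0 < K ∧ ∀ (Ω : Set (E d)), IsOpen Ω → interior (closure Ω) = Ω → ∀ (M : Mesh Ω),
      M.ShapeRegular σ → ∀ p : ℝ, 1 < p → ∀ v : Fin M.N → E d → ℝ, M.MemBroken p v →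
      ∀ s : ℝ, |s| ≤ 1 → ∀ (l : Fin d) (i : Fin M.N), ∀ x ∈ M.T i,
        |pev (M.numDeriv p k s l v i) x| * volume.real (interior (M.T i)) ≤
          K * M.localVariation p v i := by
  obtain ⟨K, hK, hKP⟩ := exists_sq_pev_mul_volume_le d k hσ
  refine ⟨K, hK, fun Ω hΩo hΩ M hM p hp v hv s hs l i x hx => ?_⟩
  have hA : 0 ≤ M.localVariation p v i :=
    add_nonneg (Finset.sum_nonneg fun e _ => integral_nonneg fun x => abs_nonneg _)
      (integral_nonneg fun x => norm_nonneg _)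
  unfold numDeriv
  split_ifs with hex
  · obtain ⟨hg, hgφ⟩ := hex.choose_spec
    set g := hex.choose
    obtain ⟨S, hS⟩ := M.exists_unitRep i
    -- The inverse estimate is applied at a maximum point `z`, so that the same `B` occurs squared
    -- on the left and once on the right.
    obtain ⟨z, hzT, hz⟩ := hS.isCompact.exists_isMaxOn ⟨x, hx⟩
      (continuous_pev (g i)).abs.continuousOn
    set B := |pev (g i) z|
    have hB : ∀ y ∈ M.T i, |pev (g i) y| ≤ B := fun y hy => hz hy
    have htest := hgφ (Function.update 0 i (g i)) fun j => by
      by_cases hj : j = i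
      · subst hj; simpa using hg j
      · simp [Function.update_of_ne hj]
    have hsum : ∑ j, ∫ x in interior (M.T j), pev (g j) x *
        pev ((Function.update 0 i (g i) : Fin M.N → MvPolynomial (Fin d) ℝ) j) x =
        ∫ x in interior (M.T i), pev (g i) x ^ 2 := by
      rw [Finset.sum_eq_single i]
      · simp only [Function.update_self, sq]
      · intro j _ hj
        simp [Function.update_of_ne hj, pev]
      · simp
    rw [hsum] at htest
    have hle := abs_derivFunctional_single_le hΩo hΩ hp hv hs l i (g i) hB
    rw [← htest] at hle
    obtain ⟨c, hc⟩ := hM i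
    have hh := diam_pos (M := M) hd i
    have hcT : c ∈ M.T i := hc (Metric.mem_closedBall_self (by positivity))
    have hinv := hKP (M.T i) S hS c _ hh hc
      (fun y hy => Metric.dist_le_diam_of_mem hS.bounded hy hcT) (g i) (hg i) z hzT
    have hmain : B * (B * volume.real (interior (M.T i))) ≤ B * (K * M.localVariation p v i) := by
      calc _ = pev (g i) z ^ 2 * volume.real (interior (M.T i)) := by
            rw [← sq_abs]; ring
        _ ≤ K * (B * M.localVariation p v i) :=
            hinv.trans (mul_le_mul_of_nonneg_left ((le_abs_self _).trans hle) hK.le)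
        _ = _ := by ring
    refine (mul_le_mul_of_nonneg_right (hB x hx) measureReal_nonneg).trans ?_
    -- One factor `B` is divided out; for `B = 0` the claim is trivial.
    rcases (abs_nonneg (pev (g i) z)).eq_or_lt with h0 | h0
    · change 0 = B at h0
      rw [← h0, zero_mul]
      positivity
    · exact le_of_mul_le_mul_left hmain h0
  -- Without a representative, `numDeriv` takes its default value zero, for which the bound is
  -- clear.
  · simp only [Pi.zero_apply, pev, map_zero, abs_zero, zero_mul]
    positivity

end Mesh

end DGFE

namespace DGFE

/-! ### Hölder estimates -/

theorem integral_le_rpow_mul_rpow {α : Type*} [MeasurableSpace α] {μ : Measure α}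
    [IsFiniteMeasure μ] {p q : ℝ} (hpq : p.HolderConjugate q) {f : α → ℝ} (hf0 : ∀ x, 0 ≤ f x)
    (hf : MemLp f (ENNReal.ofReal p) μ) :
    ∫ x, f x ∂μ ≤ (∫ x, f x ^ p ∂μ) ^ (1 / p) * μ.real univ ^ (1 / q) := by
  simpa using integral_mul_le_Lp_mul_Lq_of_nonneg hpq (Eventually.of_forall hf0)
    (Eventually.of_forall fun _ => zero_le_one) hf (memLp_const (1 : ℝ))

/-- Discrete Hölder with `p / q = p - 1`. Only the total measure of the faces enters, not their
number, which is not bounded for general polytopes. -/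
theorem sum_rpow_le_rpow_mul_sum {ι : Type*} (s : Finset ι) {p q : ℝ} (hpq : p.HolderConjugate q)
    {a b m : ι → ℝ} (ha : ∀ e ∈ s, 0 ≤ a e) (hb : ∀ e ∈ s, 0 ≤ b e) (hm : ∀ e ∈ s, 0 ≤ m e)
    (h : ∀ e ∈ s, a e ≤ b e ^ (1 / p) * m e ^ (1 / q)) :
    (∑ e ∈ s, a e) ^ p ≤ (∑ e ∈ s, m e) ^ (p - 1) * ∑ e ∈ s, b e := by
  have hp := hpq.pos
  have hq := hpq.symm.pos
  have hroot : ∀ {r x : ℝ}, 0 < r → 0 ≤ x → (x ^ (1 / r)) ^ r = x := fun hr hx => by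
    rw [← Real.rpow_mul hx, one_div_mul_cancel hr.ne', Real.rpow_one]
  have hle : ∑ e ∈ s, a e ≤ (∑ e ∈ s, b e) ^ (1 / p) * (∑ e ∈ s, m e) ^ (1 / q) := by
    refine (Finset.sum_le_sum h).trans ?_
    refine (Real.inner_le_Lp_mul_Lq_of_nonneg s hpq
      (fun e he => Real.rpow_nonneg (hb e he) _) fun e he => Real.rpow_nonneg (hm e he) _).trans_eq ?_
    rw [Finset.sum_congr rfl fun e he => hroot hp (hb e he),
      Finset.sum_congr rfl fun e he => hroot hq (hm e he)]
  have hB := Finset.sum_nonneg hb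
  have hM := Finset.sum_nonneg hm
  refine (Real.rpow_le_rpow (Finset.sum_nonneg ha) hle hp.le).trans_eq ?_
  rw [Real.mul_rpow (Real.rpow_nonneg hB _) (Real.rpow_nonneg hM _), hroot hp hB,
    ← Real.rpow_mul hM, mul_comm, one_div, inv_mul_eq_div, hpq.div_conj_eq_sub_one]

theorem add_rpow_le_two_rpow_mul {x y p : ℝ} (hx : 0 ≤ x) (hy : 0 ≤ y) (hp : 1 ≤ p) :
    (x + y) ^ p ≤ 2 ^ (p - 1) * (x ^ p + y ^ p) := by
  lift x to NNReal using hx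
  lift y to NNReal using hy
  exact_mod_cast NNReal.rpow_add_le_mul_rpow_add_rpow x y hp

/-- For `d ≥ 2` single points are null for the surface measure. Interior faces therefore have
positive diameter, so that `h_e^(1-p)` is a genuine power. -/
theorem nontrivial_of_surf_pos {d : ℕ} (hd : d ≠ 1) (hd1 : 1 ≤ d) {A : Set (E d)}
    (hA : 0 < surf d A) : A.Nontrivial := by
  by_contra h
  have hd0 : (0 : ℝ) < (d - 1 : ℕ) := by
    have : 0 < d - 1 := by omega
    exact_mod_cast this
  have := Measure.nullSingletonClass_hausdorff (E d) hd0
  refine hA.ne' ?_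
  rw [surf, Measure.euclideanHausdorffMeasure_def, Measure.smul_apply,
    (not_nontrivial_iff.1 h).measure_zero, smul_zero]

variable {d : ℕ}

namespace Mesh

variable {Ω : Set (E d)} {M : Mesh Ω} {p : ℝ} {v : Fin M.N → E d → ℝ}

theorem faceSize_pos (hd : 1 ≤ d) {e : Fin M.N × Fin M.N} (he : e ∈ M.interiorFaces) :
    0 < M.faceSize e := by
  unfold faceSize
  split_ifs with h
  · exact lt_max_of_lt_left (diam_pos hd _)
  · obtain ⟨S, hS⟩ := M.exists_unitRep e.2
    exact Metric.diam_pos (nontrivial_of_surf_pos h hd (mem_interiorFaces.1 he).2)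
      (hS.bounded.subset (inter_subset_left.trans (M.frontier_subset_T e.2)))

/-- In dimension one the neighbour's length is compared by quasi-uniformity; otherwise the face lies
in the element, and the case `i = j` of quasi-uniformity supplies the factor `κ`. -/
theorem faceSize_le {κ : ℝ} (hM : M.QuasiUniform κ) {i : Fin M.N} {e : Fin M.N × Fin M.N}
    (he : e.1 = i ∨ e.2 = i) : M.faceSize e ≤ κ * Metric.diam (M.T i) := by
  unfold faceSize
  split_ifs with h
  · exact max_le (hM _ _) (hM _ _)
  · obtain ⟨S, hS⟩ := M.exists_unitRep i
    exact (Metric.diam_mono ((face_subset_of_mem he).trans (M.frontier_subset_T i))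
      hS.bounded).trans (hM i i)

theorem localVariation_rpow_le (hΩo : IsOpen Ω) (hΩ : interior (closure Ω) = Ω) (hp : 1 < p)
    (hv : M.MemBroken p v) (i : Fin M.N) :
    M.localVariation p v i ^ p ≤ 2 ^ (p - 1) *
      ((surf d).real (frontier (M.T i)) ^ (p - 1) *
          (∑ e ∈ M.facesOf i, ∫ x in M.face e, |M.jump (M.traces p v) e x| ^ p ∂surf d) +
        volume.real (interior (M.T i)) ^ (p - 1) *
          ∫ x in interior (M.T i), ‖weakGrad (interior (M.T i)) (v i) x‖ ^ p) := by
  have hpq := Real.HolderConjugate.conjExponent hp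
  have hX : ∀ e ∈ M.facesOf i, 0 ≤ ∫ x in M.face e, |M.jump (M.traces p v) e x| ∂surf d :=
    fun e _ => integral_nonneg fun x => abs_nonneg _
  have hXp : ∀ e ∈ M.facesOf i, 0 ≤ ∫ x in M.face e, |M.jump (M.traces p v) e x| ^ p ∂surf d :=
    fun e _ => integral_nonneg fun x => Real.rpow_nonneg (abs_nonneg _) _
  have hY : 0 ≤ ∫ x in interior (M.T i), ‖weakGrad (interior (M.T i)) (v i) x‖ :=
    integral_nonneg fun x => norm_nonneg _
  refine (add_rpow_le_two_rpow_mul (Finset.sum_nonneg hX) hY hp.le).trans ?_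
  refine mul_le_mul_of_nonneg_left (add_le_add ?_ ?_) (by positivity)
  · refine (sum_rpow_le_rpow_mul_sum (M.facesOf i) hpq hX hXp (m := fun e => (surf d).real (M.face e))
      (fun e _ => measureReal_nonneg) fun e _ => ?_).trans ?_
    · have : IsFiniteMeasure ((surf d).restrict (M.face e)) :=
        isFiniteMeasure_restrict.2 (surf_face_lt_top e).ne
      simpa using integral_le_rpow_mul_rpow hpq (fun x => abs_nonneg _) (memLp_jump hp hv e).abs
    · exact mul_le_mul_of_nonneg_right (Real.rpow_le_rpow
        (Finset.sum_nonneg fun e _ => measureReal_nonneg) (sum_surf_face_le hΩo hΩ i)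
        (by linarith)) (Finset.sum_nonneg hXp)
  · have : IsFiniteMeasure (volume.restrict (interior (M.T i))) :=
      isFiniteMeasure_restrict.2 (M.exists_unitRep i).choose_spec.volume_interior_lt_top.ne
    -- The volume term is the case of a sum with a single summand.
    have h := sum_rpow_le_rpow_mul_sum (Finset.univ : Finset Unit) hpq
      (a := fun _ => ∫ x in interior (M.T i), ‖weakGrad (interior (M.T i)) (v i) x‖)
      (b := fun _ => ∫ x in interior (M.T i), ‖weakGrad (interior (M.T i)) (v i) x‖ ^ p)
      (m := fun _ => volume.real (interior (M.T i))) (fun _ _ => hY)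
      (fun _ _ => integral_nonneg fun x => Real.rpow_nonneg (norm_nonneg _) _)
      (fun _ _ => measureReal_nonneg) fun _ _ => by
        simpa using integral_le_rpow_mul_rpow hpq (fun x => norm_nonneg _)
          ((hv i).memLp_weakGrad isOpen_interior).norm
    simpa using h

theorem norm_numGrad_le {k : ℕ} {i : Fin M.N} {x : E d} {B : ℝ}
    (h : ∀ s : ℝ, |s| ≤ 1 → ∀ l, |pev (M.numDeriv p k s l v i) x| ≤ B) :
    ‖M.numGrad p k v i x‖ ≤ d * B := by
  have hl : ∀ l, ‖M.numGrad p k v i x l‖ ≤ B := fun l => by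
    have h1 := abs_le.1 (h 1 (by simp) l)
    have h2 := abs_le.1 (h (-1) (by simp) l)
    rw [Real.norm_eq_abs, abs_le]
    simp only [numGrad]
    constructor <;> linarith
  calc ‖M.numGrad p k v i x‖
      ≤ ∑ l, ‖M.numGrad p k v i x l‖ := by
        rw [EuclideanSpace.norm_eq]
        refine Real.sqrt_le_iff.2 ⟨Finset.sum_nonneg fun _ _ => norm_nonneg _, ?_⟩
        exact Finset.sum_sq_le_sq_sum_of_nonneg fun _ _ => norm_nonneg _
    _ ≤ ∑ _l : Fin d, B := Finset.sum_le_sum fun l _ => hl l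
    _ = d * B := by simp

/-- The `L^p` bound of the numerical gradient on an element. -/
theorem exists_integral_numGrad_le (hd : 1 ≤ d) (k : ℕ) (hp : 1 < p) {σ κ γ₀ : ℝ} (hσ : 0 < σ)
    (hκ : 0 < κ) (hγ₀ : 0 < γ₀) :
    ∃ C : ℝ, 0 < C ∧ ∀ (Ω : Set (E d)), IsOpen Ω → interior (closure Ω) = Ω → ∀ (M : Mesh Ω),
      M.ShapeRegular σ → M.QuasiUniform κ →
      ∀ γ : Fin M.N × Fin M.N → ℝ, (∀ e ∈ M.interiorFaces, γ₀ ≤ γ e) →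
      ∀ v : Fin M.N → E d → ℝ, M.MemBroken p v → ∀ i : Fin M.N,
        ∫ x in interior (M.T i), ‖M.numGrad p k v i x‖ ^ p ≤
          C * (∑ e ∈ M.facesOf i, (∫ x in M.face e,
              γ e * M.faceSize e ^ (1 - p) * |M.jump (M.traces p v) e x| ^ p ∂surf d) +
            ∫ x in interior (M.T i), ‖weakGrad (interior (M.T i)) (v i) x‖ ^ p) := by
  obtain ⟨K, hK, hKP⟩ := exists_abs_numDeriv_mul_volume_le hd k hσ
  have hd0 : (0 : ℝ) < d := by exact_mod_cast hd
  -- The ratio of surface to volume is at most `d / (σ h_T)`, hence at most `d κ / (σ h_e)`; the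
  -- factor `γ₀⁻¹` pays for inserting `γ e`.
  set L : ℝ := (d * κ / σ) ^ (p - 1) * γ₀⁻¹ with hL
  have hL0 : 0 < L := by positivity
  have hdK : 0 < (d * K) ^ p * 2 ^ (p - 1) := by positivity
  refine ⟨(d * K) ^ p * 2 ^ (p - 1) * (L + 1), by positivity,
    fun Ω hΩo hΩ M hM hQ γ hγ v hv i => ?_⟩
  obtain ⟨S, hS⟩ := M.exists_unitRep i
  set t := volume.real (interior (M.T i)) with ht
  set A := M.localVariation p v i with hAdef
  set 𝒢 := ∫ x in interior (M.T i), ‖weakGrad (interior (M.T i)) (v i) x‖ ^ p with h𝒢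
  set J : Fin M.N × Fin M.N → ℝ := fun e =>
    ∫ x in M.face e, |M.jump (M.traces p v) e x| ^ p ∂surf d with hJ
  have ht0 : 0 < t := volume_pos i
  have hh := diam_pos (M := M) hd i
  have hA : 0 ≤ A :=
    add_nonneg (Finset.sum_nonneg fun e _ => integral_nonneg fun x => abs_nonneg _)
      (integral_nonneg fun x => norm_nonneg _)
  have hJ0 : ∀ e, 0 ≤ J e := fun e => integral_nonneg fun x => Real.rpow_nonneg (abs_nonneg _) _
  have h𝒢0 : 0 ≤ 𝒢 := integral_nonneg fun x => Real.rpow_nonneg (norm_nonneg _) _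
  have hp1 : 0 < p - 1 := sub_pos.2 hp
  have hpt : ∀ x ∈ interior (M.T i), ‖‖M.numGrad p k v i x‖ ^ p‖ ≤ (d * (K * A / t)) ^ p := by
    intro x hx
    rw [Real.norm_of_nonneg (Real.rpow_nonneg (norm_nonneg _) _)]
    refine Real.rpow_le_rpow (norm_nonneg _) (norm_numGrad_le fun s hs l => ?_) (by linarith)
    rw [le_div_iff₀ ht0]
    exact hKP Ω hΩo hΩ M hM p hp v hv s hs l i x (interior_subset hx)
  have hint := (le_abs_self _).trans
    (norm_setIntegral_le_of_norm_le_const hS.volume_interior_lt_top hpt)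
  obtain ⟨c, hc⟩ := hM i
  have hsurf : (surf d).real (frontier (M.T i)) ≤ d * t / (σ * Metric.diam (M.T i)) := by
    rw [le_div_iff₀ (by positivity), mul_comm]
    exact hS.mul_surf_frontier_le (by positivity) hc
  have hface : ∀ e ∈ M.facesOf i,
      (d / (σ * Metric.diam (M.T i))) ^ (p - 1) * J e ≤ L * ∫ x in M.face e,
        γ e * M.faceSize e ^ (1 - p) * |M.jump (M.traces p v) e x| ^ p ∂surf d := by
    intro e he
    have hei := mem_facesOf.1 he
    have hemem := mem_interiorFaces.2 hei.1
    have hfs := faceSize_pos hd hemem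
    have hγe := hγ e hemem
    rw [integral_const_mul]
    have h1 : d / (σ * Metric.diam (M.T i)) ≤ d * κ / σ * (M.faceSize e)⁻¹ := by
      rw [div_le_iff₀ (by positivity)]
      have : 1 ≤ κ * Metric.diam (M.T i) * (M.faceSize e)⁻¹ := by
        rw [← div_eq_mul_inv, one_le_div hfs]
        exact faceSize_le hQ hei.2
      calc (d : ℝ) = d * 1 := (mul_one _).symm
        _ ≤ d * (κ * Metric.diam (M.T i) * (M.faceSize e)⁻¹) := by gcongr
        _ = _ := by field_simp
    have h2 : (d / (σ * Metric.diam (M.T i))) ^ (p - 1) ≤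
        (d * κ / σ) ^ (p - 1) * M.faceSize e ^ (1 - p) := by
      refine (Real.rpow_le_rpow (by positivity) h1 hp1.le).trans_eq ?_
      rw [Real.mul_rpow (by positivity) (by positivity), Real.inv_rpow hfs.le,
        ← Real.rpow_neg hfs.le, neg_sub]
    have h3 : 1 ≤ γ₀⁻¹ * γ e := by
      rw [inv_mul_eq_div, one_le_div hγ₀]; exact hγe
    calc (d / (σ * Metric.diam (M.T i))) ^ (p - 1) * J e
        ≤ (d * κ / σ) ^ (p - 1) * M.faceSize e ^ (1 - p) * J e :=
          mul_le_mul_of_nonneg_right h2 (hJ0 e)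
      _ = 1 * ((d * κ / σ) ^ (p - 1) * M.faceSize e ^ (1 - p) * J e) := (one_mul _).symm
      _ ≤ γ₀⁻¹ * γ e * ((d * κ / σ) ^ (p - 1) * M.faceSize e ^ (1 - p) * J e) :=
          mul_le_mul_of_nonneg_right h3 (mul_nonneg (by positivity) (hJ0 e))
      _ = _ := by rw [hL]; ring
  set W := ∑ e ∈ M.facesOf i, (∫ x in M.face e,
    γ e * M.faceSize e ^ (1 - p) * |M.jump (M.traces p v) e x| ^ p ∂surf d) with hW
  have hsum : (d / (σ * Metric.diam (M.T i))) ^ (p - 1) * ∑ e ∈ M.facesOf i, J e ≤ L * W := by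
    rw [hW, Finset.mul_sum, Finset.mul_sum]
    exact Finset.sum_le_sum hface
  have hW0 : 0 ≤ W := by
    refine nonneg_of_mul_nonneg_right (le_trans ?_ hsum) hL0
    exact mul_nonneg (by positivity) (Finset.sum_nonneg fun e _ => hJ0 e)
  have hApow := localVariation_rpow_le hΩo hΩ hp hv i
  have hsurfp : (surf d).real (frontier (M.T i)) ^ (p - 1) ≤
      t ^ (p - 1) * (d / (σ * Metric.diam (M.T i))) ^ (p - 1) := by
    rw [← Real.mul_rpow ht0.le (by positivity)]
    refine Real.rpow_le_rpow measureReal_nonneg (hsurf.trans_eq ?_) hp1.le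
    ring
  have htp : t ^ p = t * t ^ (p - 1) := by
    rw [← Real.rpow_one_add' ht0.le (by linarith)]; congr 1; ring
  have hAt : A ^ p ≤ 2 ^ (p - 1) * t ^ (p - 1) * (L * W + 𝒢) := by
    refine hApow.trans ?_
    rw [mul_assoc, mul_add (t ^ (p - 1))]
    refine mul_le_mul_of_nonneg_left (add_le_add ?_ le_rfl) (by positivity)
    calc _ ≤ t ^ (p - 1) * (d / (σ * Metric.diam (M.T i))) ^ (p - 1) * ∑ e ∈ M.facesOf i, J e :=
          mul_le_mul_of_nonneg_right hsurfp (Finset.sum_nonneg fun e _ => hJ0 e)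
      _ ≤ _ := by
        rw [mul_assoc]
        exact mul_le_mul_of_nonneg_left hsum (by positivity)
  -- The power `t ^ (p - 1)` left in the denominator is exactly the one contained in the bound for
  -- `A ^ p`.
  calc _ ≤ (d * (K * A / t)) ^ p * t := hint
    _ = (d * K) ^ p * A ^ p / t ^ (p - 1) := by
      rw [show d * (K * A / t) = d * K * A / t by ring, Real.div_rpow (by positivity) ht0.le,
        Real.mul_rpow (by positivity) hA, htp]
      field_simp
    _ ≤ (d * K) ^ p * (2 ^ (p - 1) * t ^ (p - 1) * (L * W + 𝒢)) / t ^ (p - 1) := by gcongr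
    _ = (d * K) ^ p * 2 ^ (p - 1) * (L * W + 𝒢) := by field_simp
    _ ≤ (d * K) ^ p * 2 ^ (p - 1) * ((L + 1) * (W + 𝒢)) := by
      refine mul_le_mul_of_nonneg_left ?_ hdK.le
      have := mul_nonneg hL0.le h𝒢0
      linarith
    _ = _ := by ring

/-- Each interior face belongs to the two elements it separates. -/
theorem sum_sum_facesOf_le {a : Fin M.N × Fin M.N → ℝ} (ha : ∀ e ∈ M.interiorFaces, 0 ≤ a e) :
    ∑ i, ∑ e ∈ M.facesOf i, a e ≤ 2 * ∑ e ∈ M.interiorFaces, a e := by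
  simp only [facesOf, Finset.sum_filter]
  rw [Finset.sum_comm, Finset.mul_sum]
  refine Finset.sum_le_sum fun e he => ?_
  calc ∑ i, (if e.1 = i ∨ e.2 = i then a e else 0)
      ≤ ∑ i, ((if e.1 = i then a e else 0) + if e.2 = i then a e else 0) := by
        refine Finset.sum_le_sum fun i _ => ?_
        have := ha e he
        by_cases h1 : e.1 = i <;> by_cases h2 : e.2 = i <;> simp [h1, h2, this]
    _ = 2 * a e := by
        rw [Finset.sum_add_distrib]
        simp [two_mul]

/-- Stability of the numerical gradient with respect to the broken Sobolev seminorm. -/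
theorem exists_brokenLpNorm_numGrad_le (hd : 1 ≤ d) (k : ℕ) (hp : 1 < p) {σ κ γ₀ : ℝ} (hσ : 0 < σ)
    (hκ : 0 < κ) (hγ₀ : 0 < γ₀) :
    ∃ C : ℝ, 0 < C ∧ ∀ (Ω : Set (E d)), IsOpen Ω → interior (closure Ω) = Ω → ∀ (M : Mesh Ω),
      M.ShapeRegular σ → M.QuasiUniform κ →
      ∀ γ : Fin M.N × Fin M.N → ℝ, (∀ e ∈ M.interiorFaces, γ₀ ≤ γ e) →
      ∀ v : Fin M.N → E d → ℝ, M.MemBroken p v →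
        M.brokenLpNorm p (M.numGrad p k v) ≤ C * M.brokenSeminorm p γ v := by
  obtain ⟨C, hC, h⟩ := exists_integral_numGrad_le hd k hp hσ hκ hγ₀
  refine ⟨(2 * C) ^ (1 / p), by positivity, fun Ω hΩo hΩ M hM hQ γ hγ v hv => ?_⟩
  have hp0 : 0 < p := zero_lt_one.trans hp
  unfold brokenSeminorm brokenLpNorm piecewiseGrad
  set a : Fin M.N × Fin M.N → ℝ := fun e => ∫ x in M.face e,
    γ e * M.faceSize e ^ (1 - p) * |M.jump (M.traces p v) e x| ^ p ∂surf d with ha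
  set 𝒢 := ∑ i, ∫ x in interior (M.T i), ‖weakGrad (interior (M.T i)) (v i) x‖ ^ p with h𝒢
  have ha0 : ∀ e ∈ M.interiorFaces, 0 ≤ a e := fun e he => integral_nonneg fun x =>
    mul_nonneg (mul_nonneg (hγ₀.le.trans (hγ e he)) (Real.rpow_nonneg (faceSize_pos hd he).le _))
      (Real.rpow_nonneg (abs_nonneg _) _)
  have h𝒢0 : 0 ≤ 𝒢 := Finset.sum_nonneg fun i _ =>
    integral_nonneg fun x => Real.rpow_nonneg (norm_nonneg _) _
  have h𝒮0 := Finset.sum_nonneg ha0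
  have hmain : ∑ i, ∫ x in interior (M.T i), ‖M.numGrad p k v i x‖ ^ p ≤
      2 * C * (𝒢 + ∑ e ∈ M.interiorFaces, a e) := by
    refine (Finset.sum_le_sum fun i _ => h Ω hΩo hΩ M hM hQ γ hγ v hv i).trans ?_
    rw [← Finset.mul_sum, Finset.sum_add_distrib]
    have h1 := mul_le_mul_of_nonneg_left (sum_sum_facesOf_le ha0) hC.le
    have h2 := mul_nonneg hC.le h𝒢0
    rw [mul_add]
    linarith
  refine (Real.rpow_le_rpow (Finset.sum_nonneg fun i _ => integral_nonneg fun x =>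
    Real.rpow_nonneg (norm_nonneg _) _) hmain (by positivity)).trans ?_
  rw [Real.mul_rpow (by positivity) (add_nonneg h𝒢0 h𝒮0)]
  refine mul_le_mul_of_nonneg_left ?_ (by positivity)
  -- Subadditivity of the `p`-th root passes from one root of the sum to the two separate roots in
  -- the seminorm.
  exact Real.rpow_add_le_add_rpow h𝒢0 h𝒮0 (by positivity) ((div_le_one hp0).2 hp.le)

end Mesh

end DGFE

theorem mainTheorem5 (d : ℕ) (hd1 : 1 ≤ d) (hd3 : d ≤ 3) (Ω : Set (DGFE.E d))
    (hΩ : DGFE.IsPolygonalDomain Ω) (k : ℕ) (p : ℝ) (hp : 1 < p)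
    (σ κ γ₀ : ℝ) (hσ : 0 < σ) (hκ : 0 < κ) (hγ₀ : 0 < γ₀) :
    ∃ C : ℝ, 0 < C ∧ ∀ M : DGFE.Mesh Ω, M.ShapeRegular σ → M.QuasiUniform κ →
      ∀ γ : Fin M.N × Fin M.N → ℝ, (∀ e ∈ M.interiorFaces, γ₀ ≤ γ e) →
        ∀ v : Fin M.N → DGFE.E d → ℝ, M.MemBroken p v →
          M.brokenLpNorm p (M.numGrad p k v) ≤ C * M.brokenSeminorm p γ v := by
  obtain ⟨C, hC, h⟩ := DGFE.Mesh.exists_brokenLpNorm_numGrad_le hd1 k hp hσ hκ hγ₀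
  exact ⟨C, hC, h Ω hΩ.1 hΩ.2.2.2.1⟩
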